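/- Let $\mathcal O\subset\mathbb R^3$ be a bounded, open, convex set and let $\Omega$ be an open subset of the plane $\{x_3=0\}$ with $\Omega\subset\partial\mathcal O$, such that $S:=\partial\mathcal O\setminus\overline{\Omega}$ lies in $\{x_3\le 0\}$; the outer unit normal $\mathbf n$ is then $(0,0,1)$ on $\Omega$. Let $\nu>0$, $\lambda\ge 0$, $\eta>0$. Put $\epsilon_{ij}(\mathbf u)=\frac12(\partial_iu_j+\partial_ju_i)$, $\sigma(\mathbf u)=2\nu\,\epsilon(\mathbf u)+\lambda\,(\operatorname{tr}\epsilon(\mathbf u))\,I_3$ and $a_{\mathcal O}(\mathbf u,\boldsymbol\psi)=(\sigma(\mathbf u),\epsilon(\boldsymbol\psi))_{\mathcal O}+\eta(\mathbf u,\boldsymbol\psi)_{\mathcal O}$, where $(\cdot,\cdot)_D$ is the inner product of $L^2(D)$. All functions are real valued. Let $$\mathbf V_0=\{\mathbf v\in \mathbf H^1(\mathcal O):\mathbf v\cdot\mathbf n=0\text{ on }\partial\mathcal O\},$$ let $\mathbf V_\Omega$ be the set of all $\boldsymbol\psi=\boldsymbol\psi(\beta)\in\mathbf H^1(\mathcal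 O)$ with $\boldsymbol\psi\cdot\mathbf n=\beta\in H^2_0(\Omega)$ on $\Omega$ and $\boldsymbol\psi\cdot\mathbf n=0$ on the rest of $\partial\mathcal O$, let $\mathbf U\in\mathbf V_0\cap\mathbf H^3(\mathcal O)$, and let $W_{\mathbf U}=\{q\in L^2(\mathcal O):\mathbf U\cdot\nabla q\in L^2(\mathcal O)\}$. A *stationary weak solution* is a triple $(p,\mathbf u,w)\in L^2(\mathcal O)\times\mathbf V_0\times H^2_0(\Omega)$ with $$(\operatorname{div}\mathbf u,q)_{\mathcal O}=\int_{\mathcal O}(\operatorname{div}\mathbf U)\,p\,q\,dx+\int_{\mathcal O}(\mathbf U\cdot\nabla q)\,p\,dx\qquad\text{for all }q\in W_{\mathbf U},$$ $$a_{\mathcal O}(\mathbf u,\boldsymbol\psi)-(p,\operatorname{div}\boldsymbol\psi)_{\mathcal O}=-\int_{\mathcal O}(\mathbf U\cdot\nabla\mathbf u)\cdot\boldsymbol\psi\,dx-(\Delta w,\Delta\beta)_{\Omega}\qquad\text{for all }\boldsymbol\psi=\boldsymbol\psi(\beta)\in\mathbf V_\Omega.$$ A *solution of the stationary system* is a triple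 $(p,\mathbf u,w)\in L^2(\mathcal O)\times\mathbf V_0\times H^2_0(\Omega)$ such that $\mathbf U\cdot\nabla p\in L^2(\mathcal O)$ and $\operatorname{div}\sigma(\mathbf u)-\nabla p\in \mathbf L^2(\mathcal O)$ (in the sense of distributions), and $$\mathbf U\cdot\nabla p+\operatorname{div}\mathbf u=0,\qquad \mathbf U\cdot\nabla\mathbf u-\operatorname{div}\sigma(\mathbf u)+\eta\mathbf u+\nabla p=0\qquad\text{a.e. in }\mathcal O,$$ $$\langle\sigma(\mathbf u)\mathbf n-p\mathbf n,\boldsymbol\tau\rangle_{\partial\mathcal O}=0\quad\text{for the trace }\boldsymbol\tau\text{ of every element of }\mathbf V_0,$$ $$\Delta^2w+\big[2\nu\,\partial_{x_3}u_3+\lambda\operatorname{div}\mathbf u-p\big]_\Omega=0\quad\text{in the sense of distributions on }\Omega,$$ where the boundary traction $\sigma(\mathbf u)\mathbf n-p\mathbf n$ is defined by Green's formula $$\langle\sigma(\mathbf u)\mathbf n-p\mathbf n,\boldsymbol\psi\rangle_{\partial\mathcal O}=(\sigma(\mathbf u),\epsilon(\boldsymbol\psi))_{\mathcal O}-(p,\operatorname{div}\boldsymbol\psi)_{\mathcal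 O}+(\operatorname{div}\sigma(\mathbf u)-\nabla p,\boldsymbol\psi)_{\mathcal O}\qquad(\boldsymbol\psi\in\mathbf H^1(\mathcal O)),$$ and the bracket $[\cdot]_\Omega$ is its third component on $\Omega$: its value at $\beta\in C_0^\infty(\Omega)$ is the pairing with any $\boldsymbol\psi\in\mathbf H^1(\mathcal O)$ whose trace is $\beta\mathbf n$ on $\Omega$ and $0$ on the rest of $\partial\mathcal O$. Assume $\operatorname{div}\mathbf U=0$ in $\mathcal O$. Then a triple is a stationary weak solution if and only if it is a solution of the stationary system, and every such triple has the form $(c,\mathbf 0,w_c)$, where $c\in\mathbb R$ is a constant and $w_c\in H^2_0(\Omega)$ solves the clamped problem $$\Delta^2w=c\ \text{ in }\Omega,\qquad w=\nabla w=0\ \text{ on }\partial\Omega,$$ that is, $(\Delta w_c,\Delta v)_\Omega=(c,v)_\Omega$ for all $v\in H^2_0(\Omega)$. -/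

import Mathlib

open MeasureTheory Filter Topology
open scoped ContDiff

/-- Euclidean `n`-space. -/
abbrev Eu (n : ℕ) : Type := EuclideanSpace ℝ (Fin n)

namespace FluidPlate

/-! ### Sobolev spaces through weak derivatives -/

/-- The classical partial derivative `∂φ/∂xᵢ` at `x` (used for smooth functions only). -/
noncomputable def pderiv {n : ℕ} (i : Fin n) (φ : Eu n → ℝ) (x : Eu n) : ℝ :=
  fderiv ℝ φ x (EuclideanSpace.single i 1)

/-- `φ ∈ C₀^∞(D)`. -/
def IsTestFunction {n : ℕ} (D : Set (Eu n)) (φ : Eu n → ℝ) : Prop :=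
  ContDiff ℝ ∞ φ ∧ HasCompactSupport φ ∧ tsupport φ ⊆ D

/-- `f ∈ L²(D)`. -/
def MemL2 {n : ℕ} (D : Set (Eu n)) (f : Eu n → ℝ) : Prop :=
  MemLp f 2 (volume.restrict D)

/-- `g` is the distributional derivative `∂f/∂xᵢ` in the open set `D`. -/
def HasWeakPDeriv {n : ℕ} (D : Set (Eu n)) (i : Fin n) (f g : Eu n → ℝ) : Prop :=
  ∀ φ : Eu n → ℝ, IsTestFunction D φ →
    ∫ x in D, f x * pderiv i φ x = -∫ x in D, g x * φ x

open Classical in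
/-- The weak derivative `∂f/∂xᵢ ∈ L²(D)` (unique up to null sets); it is `0` by convention if there
is none. -/
noncomputable def wderiv {n : ℕ} (D : Set (Eu n)) (i : Fin n) (f : Eu n → ℝ) : Eu n → ℝ :=
  if h : ∃ g : Eu n → ℝ, MemL2 D g ∧ HasWeakPDeriv D i f g then h.choose else 0

/-- `f ∈ H^k(D)`: all weak derivatives of order at most `k` exist and lie in `L²(D)`. -/
def MemH {n : ℕ} (D : Set (Eu n)) : ℕ → (Eu n → ℝ) → Prop
  | 0, f => MemL2 D f
  | k + 1, f => MemL2 D f ∧ ∀ i : Fin n, ∃ g : Eu n → ℝ, HasWeakPDeriv D i f g ∧ MemH D k g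

/-- A norm of `H^k(D)`: the sum of the `L²(D)` norms of the weak derivatives of order at most
`k`. -/
noncomputable def normH {n : ℕ} (D : Set (Eu n)) : ℕ → (Eu n → ℝ) → ENNReal
  | 0, f => eLpNorm f 2 (volume.restrict D)
  | k + 1, f => eLpNorm f 2 (volume.restrict D) + ∑ i : Fin n, normH D k (wderiv D i f)

/-- `f ∈ H^k_0(D)`, the closure of `C₀^∞(D)` in `H^k(D)`. -/
def MemH0 {n : ℕ} (D : Set (Eu n)) (k : ℕ) (f : Eu n → ℝ) : Prop :=
  MemH D k f ∧ ∃ φ : ℕ → Eu n → ℝ, (∀ m, IsTestFunction D (φ m)) ∧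
    Tendsto (fun m => normH D k (fun x => f x - φ m x)) atTop (𝓝 0)

/-- `v ∈ H^k(D)` for a vector field: every component is in `H^k(D)`. -/
def MemHVec {n : ℕ} (D : Set (Eu n)) (k : ℕ) (v : Eu n → Eu n) : Prop :=
  ∀ i : Fin n, MemH D k (fun x => v x i)

/-! ### Differential operators, in the weak sense -/

/-- The weak Laplacian `Δw` of `w ∈ H²(D)`. -/
noncomputable def lap {n : ℕ} (D : Set (Eu n)) (w : Eu n → ℝ) (x : Eu n) : ℝ :=
  ∑ i : Fin n, wderiv D i (wderiv D i w) x

/-- `div v` for `v ∈ H¹(D)`. -/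
noncomputable def divg {n : ℕ} (D : Set (Eu n)) (v : Eu n → Eu n) (x : Eu n) : ℝ :=
  ∑ i : Fin n, wderiv D i (fun y => v y i) x

/-- The `j`-th component of `U · ∇u`, for `u ∈ H¹(D)`. -/
noncomputable def convect {n : ℕ} (D : Set (Eu n)) (U u : Eu n → Eu n) (j : Fin n) (x : Eu n) : ℝ :=
  ∑ i : Fin n, U x i * wderiv D i (fun y => u y j) x

/-- The strain tensor `ε_{ij}(u) = (∂ᵢuⱼ + ∂ⱼuᵢ) / 2`. -/
noncomputable def strain (O : Set (Eu 3)) (u : Eu 3 → Eu 3) (i j : Fin 3) (x : Eu 3) : ℝ :=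
  (1 / 2) * (wderiv O i (fun y => u y j) x + wderiv O j (fun y => u y i) x)

/-- The stress tensor `σ(u) = 2 ν ε(u) + λ (tr ε(u)) I₃`. -/
noncomputable def stress (O : Set (Eu 3)) (ν lam : ℝ) (u : Eu 3 → Eu 3) (i j : Fin 3) (x : Eu 3) :
    ℝ :=
  2 * ν * strain O u i j x + if i = j then lam * ∑ k : Fin 3, strain O u k k x else 0

/-- `g = U · ∇q` in the sense of distributions in `D`, for `q` merely in `L²(D)`:
`⟨U · ∇q, φ⟩ = -∫ q div (φ U) = -∫ q (U · ∇φ + (div U) φ)`. -/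
def HasTransport {n : ℕ} (D : Set (Eu n)) (U : Eu n → Eu n) (q g : Eu n → ℝ) : Prop :=
  ∀ φ : Eu n → ℝ, IsTestFunction D φ →
    ∫ x in D, g x * φ x
      = -∫ x in D, q x * (∑ i : Fin n, U x i * pderiv i φ x + divg D U x * φ x)

/-! ### The geometry -/

/-- The embedding of the plane as `{x₃ = 0}` in space (coordinates are numbered from `0`). -/
noncomputable def plateEmb (y : Eu 2) : Eu 3 := !₂[y 0, y 1, 0]

/-- The solid (inactive) part `S` of the boundary of the fluid domain `O`, when the active part is
the flat piece `Ω` in the plane `{x₃ = 0}`. -/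
def solidPart (O : Set (Eu 3)) (Ω : Set (Eu 2)) : Set (Eu 3) :=
  frontier O \ closure (plateEmb '' Ω)

/-- `O` is a bounded convex open fluid domain, whose boundary consists of a flat piece `Ω`, open in
the plane `{x₃ = 0}`, and of the solid part, which lies in `{x₃ ≤ 0}`. (Hence `O` lies below the
plane, and the outer unit normal on `Ω` is `(0, 0, 1)`.) -/
structure IsFluidPlateDomain (O : Set (Eu 3)) (Ω : Set (Eu 2)) : Prop where
  isOpen_fluid : IsOpen O
  convex_fluid : Convex ℝ O
  bounded_fluid : Bornology.IsBounded O
  isOpen_plate : IsOpen Ω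
  plate_subset : plateEmb '' Ω ⊆ frontier O
  solid_below : ∀ x ∈ solidPart O Ω, x 2 ≤ 0

/-! ### Boundary values

Boundary values of `H¹` fields on `∂O` are expressed through Green's formula
`∫_O (∂ᵢv) φ + v ∂ᵢφ = ∫_{∂O} v φ nᵢ`, tested with all `φ` smooth up to the boundary. The data
vanish on the solid part, so that the boundary integral runs over `Ω`, where `n = (0, 0, 1)`. -/

/-- The normal trace `v · n` on `∂O` is `β` on `Ω` and `0` on the rest of `∂O`. -/
def HasNormalTrace (O : Set (Eu 3)) (Ω : Set (Eu 2)) (v : Eu 3 → Eu 3) (β : Eu 2 → ℝ) : Prop :=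
  ∀ φ : Eu 3 → ℝ, ContDiff ℝ ∞ φ →
    ∫ x in O, (divg O v x * φ x + ∑ i : Fin 3, v x i * pderiv i φ x)
      = ∫ y in Ω, β y * φ (plateEmb y)

/-- The full trace of `v` on `∂O` is `β n = (0, 0, β)` on `Ω` and `0` on the rest of `∂O`. -/
def HasVerticalTrace (O : Set (Eu 3)) (Ω : Set (Eu 2)) (v : Eu 3 → Eu 3) (β : Eu 2 → ℝ) : Prop :=
  ∀ i k : Fin 3, ∀ φ : Eu 3 → ℝ, ContDiff ℝ ∞ φ →
    ∫ x in O, (wderiv O i (fun y => v y k) x * φ x + v x k * pderiv i φ x)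
      = if i = 2 ∧ k = 2 then ∫ y in Ω, β y * φ (plateEmb y) else 0

/-- The space `V₀` of all `v ∈ H¹(O)` with `v · n = 0` on `∂O`. -/
def MemV0 (O : Set (Eu 3)) (Ω : Set (Eu 2)) (v : Eu 3 → Eu 3) : Prop :=
  MemHVec O 1 v ∧ HasNormalTrace O Ω v 0

/-- `v = v(β)` belongs to `V_Ω`: `v ∈ H¹(O)`, and `v · n` is `0` on `S` and `β ∈ H²₀(Ω)` on `Ω`. -/
def MemVPlate (O : Set (Eu 3)) (Ω : Set (Eu 2)) (v : Eu 3 → Eu 3) (β : Eu 2 → ℝ) : Prop :=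
  MemHVec O 1 v ∧ MemH0 Ω 2 β ∧ HasNormalTrace O Ω v β

/-- The standing assumption `U ∈ V₀ ∩ H³(O)` on the ambient flow field. -/
def IsAmbientField (O : Set (Eu 3)) (Ω : Set (Eu 2)) (U : Eu 3 → Eu 3) : Prop :=
  MemV0 O Ω U ∧ MemHVec O 3 U

/-! ### The stationary problem -/

/-- The bilinear form `a_O(u, ψ) = (σ(u), ε(ψ))_O + η (u, ψ)_O`. -/
noncomputable def aForm (O : Set (Eu 3)) (ν lam η : ℝ) (u ψ : Eu 3 → Eu 3) : ℝ :=
  (∫ x in O, ∑ i : Fin 3, ∑ j : Fin 3, stress O ν lam u i j x * strain O ψ i j x)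
    + η * ∫ x in O, ∑ j : Fin 3, u x j * ψ x j

/-- Weak (variational) stationary solutions `(p, u, w) ∈ L²(O) × V₀ × H²₀(Ω)`. In
`transport_eq`, `q` runs over `W_U = {q ∈ L²(O) : U · ∇q ∈ L²(O)}` and `g = U · ∇q`. -/
structure IsWeakSolution (O : Set (Eu 3)) (Ω : Set (Eu 2)) (ν lam η : ℝ) (U : Eu 3 → Eu 3)
    (p : Eu 3 → ℝ) (u : Eu 3 → Eu 3) (w : Eu 2 → ℝ) : Prop where
  memL2_p : MemL2 O p
  memV0_u : MemV0 O Ω u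
  memH0_w : MemH0 Ω 2 w
  transport_eq : ∀ q g : Eu 3 → ℝ, MemL2 O q → MemL2 O g → HasTransport O U q g →
    ∫ x in O, divg O u x * q x
      = (∫ x in O, divg O U x * (p x * q x)) + ∫ x in O, g x * p x
  momentum_eq : ∀ (ψ : Eu 3 → Eu 3) (β : Eu 2 → ℝ), MemVPlate O Ω ψ β →
    aForm O ν lam η u ψ - ∫ x in O, p x * divg O ψ x
      = -(∫ x in O, ∑ j : Fin 3, convect O U u j x * ψ x j) - ∫ y in Ω, lap Ω w y * lap Ω β y

/-- `F = div σ(u) - ∇p` in the sense of distributions in `O`. -/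
def IsStressDivergence (O : Set (Eu 3)) (ν lam : ℝ) (p : Eu 3 → ℝ) (u F : Eu 3 → Eu 3) : Prop :=
  ∀ (j : Fin 3) (φ : Eu 3 → ℝ), IsTestFunction O φ →
    ∫ x in O, F x j * φ x
      = -∫ x in O, ((∑ i : Fin 3, stress O ν lam u i j x * pderiv i φ x) - p x * pderiv j φ x)

/-- The duality pairing `⟨σ(u) n - p n, ψ⟩` over `∂O` of the boundary traction in
`H^{-1/2}(∂O)` with the trace of `ψ ∈ H¹(O)`, defined through Green's formula, where
`F = div σ(u) - ∇p ∈ L²(O)`. -/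
noncomputable def traction (O : Set (Eu 3)) (ν lam : ℝ) (p : Eu 3 → ℝ) (u F ψ : Eu 3 → Eu 3) : ℝ :=
  (∫ x in O, ∑ i : Fin 3, ∑ j : Fin 3, stress O ν lam u i j x * strain O ψ i j x)
    - (∫ x in O, p x * divg O ψ x) + ∫ x in O, ∑ j : Fin 3, F x j * ψ x j

/-- Solutions `(p, u, w) ∈ L²(O) × V₀ × H²₀(Ω)` of the stationary system itself:
* `U · ∇p + div u = 0` a.e. in `O`, with `U · ∇p ∈ L²(O)`;
* `U · ∇u - (div σ(u) - ∇p) + η u = 0` a.e. in `O`, with `div σ(u) - ∇p ∈ L²(O)`;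
* `⟨σ(u) n - p n, τ⟩ = 0` for all tangential boundary fields `τ` (the traces of `V₀`);
* `Δ²w + [2 ν ∂₃u₃ + λ div u - p]_Ω = 0` in the distributions on `Ω`, the bracket being the
  third component of the traction, so that its value at `β` is the pairing of the traction with
  `β n` on `Ω`, `0` on `S`.
The conditions `u · n = 0` on `∂O` and `w = ∂w/∂n = 0` on `∂Ω` are in the spaces. -/
def IsStrongSolution (O : Set (Eu 3)) (Ω : Set (Eu 2)) (ν lam η : ℝ) (U : Eu 3 → Eu 3)
    (p : Eu 3 → ℝ) (u : Eu 3 → Eu 3) (w : Eu 2 → ℝ) : Prop :=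
  MemL2 O p ∧ MemV0 O Ω u ∧ MemH0 Ω 2 w ∧
  (∃ g : Eu 3 → ℝ, MemL2 O g ∧ HasTransport O U p g ∧
    ∀ᵐ x ∂(volume.restrict O), g x + divg O u x = 0) ∧
  ∃ F : Eu 3 → Eu 3, (∀ j : Fin 3, MemL2 O (fun x => F x j)) ∧ IsStressDivergence O ν lam p u F ∧
    (∀ᵐ x ∂(volume.restrict O), ∀ j : Fin 3, convect O U u j x - F x j + η * u x j = 0) ∧
    (∀ τ : Eu 3 → Eu 3, MemV0 O Ω τ → traction O ν lam p u F τ = 0) ∧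
    ∀ (β : Eu 2 → ℝ) (ψ : Eu 3 → Eu 3), IsTestFunction Ω β → MemHVec O 1 ψ →
      HasVerticalTrace O Ω ψ β →
      (∫ y in Ω, lap Ω w y * lap Ω β y) + traction O ν lam p u F ψ = 0

/-- `w ∈ H²₀(Ω)` solves the clamped problem `Δ²w = c` in `Ω`, `w = ∇w = 0` on `∂Ω`:
`(Δw, Δv)_Ω = (c, v)_Ω` for all `v ∈ H²₀(Ω)`. -/
def IsClampedBiharmonic (Ω : Set (Eu 2)) (c : ℝ) (w : Eu 2 → ℝ) : Prop :=
  MemH0 Ω 2 w ∧ ∀ v : Eu 2 → ℝ, MemH0 Ω 2 v →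
    ∫ y in Ω, lap Ω w y * lap Ω v y = ∫ y in Ω, c * v y

end FluidPlate

/-! Both notions of solution are compared with the rest states `(c, 0, w_c)`: each implies being a
rest state, and a rest state satisfies both systems.

The core is an energy argument. Since `div U = 0` and `U · n = 0`, transport by `U` is skew: `∫
(U·∇p) p = 0` and `∫ (U·∇u)·u = 0`. The continuity equation says `U·∇p = -div u`, so `∫ p div u =
0`. As `u · n = 0`, the field `u` is an admissible test field with `β = 0`, and the momentum
equation collapses to `a(u, u) = 0`. The strain part is nonnegative and `η > 0`, so `u = 0`. What
remains is `(p, div ψ) = (Δw, Δβ)`. Fields `ψ` with compact support in `O` give `∇p = 0`, hence `p =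
c`. Fields that lift a given `β ∈ C₀^∞(Ω)` to the fluid give `(Δw, Δβ) = c ∫ div ψ = c ∫ β`, and
density extends this to `H²₀(Ω)`. In the converse direction the weak transport equation requires `c
∫ U·∇q = 0` for every `q ∈ W_U`.

The analytic burden is the skewness for `q` merely in `L²` with `U·∇q ∈ L²`, on a domain with
boundary. Convexity supplies smoothing without any extension: average `q` over the points `(1 - ε) x
+ ε a`, with `a` in a fixed compact part of `O`. These averages are smooth on the whole space, hence
admissible in the zero flux identity. They nearly commute with `U·∇`: the commutator carries `ε⁻¹ (U
y - U x)`, and `U ∈ H¹` makes this bounded from `L²` to `L¹`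
(`exists_eLpNorm_dirDeriv_kernelAvg_sub_le`). Density of smooth functions then gives convergence of
`U·∇` of the averages in `L¹` (`tendsto_dirDeriv_kernelAvg_of_hasTransport`). Convergence in `L¹` is
too weak to multiply by `q`, so the energy is first replaced by `δ⁻¹ √(1 + δ |q|²)`, whose gradient
is bounded, and then `δ → 0` (`setIntegral_mul_eq_zero_of_tendsto_dirDeriv`).

Two further ingredients: fields in `H²` of a three-dimensional convex domain are bounded
(`exists_ae_bound_of_memH_two`), so `U·∇u ∈ L²`; and the layer just below a compact part of the
plate lies in `O`, which allows the lifting of `β` (`IsFluidPlateDomain.exists_hasVerticalTrace`).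
-/

namespace FluidPlate

/-! ### Test functions and partial derivatives -/

section TestFunctions

variable {n : ℕ} {D : Set (Eu n)} {i : Fin n}

theorem pderiv_sub {f g : Eu n → ℝ} {x : Eu n} (hf : DifferentiableAt ℝ f x)
    (hg : DifferentiableAt ℝ g x) :
    pderiv i (fun y => f y - g y) x = pderiv i f x - pderiv i g x := by
  unfold pderiv
  rw [fderiv_fun_sub hf hg]; rfl

theorem pderiv_mul {f g : Eu n → ℝ} {x : Eu n} (hf : DifferentiableAt ℝ f x)
    (hg : DifferentiableAt ℝ g x) :
    pderiv i (fun y => f y * g y) x = f x * pderiv i g x + g x * pderiv i f x := by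
  unfold pderiv
  rw [fderiv_fun_mul hf hg]; simp

theorem pderiv_const (c : ℝ) (x : Eu n) : pderiv i (fun _ => c) x = 0 := by
  simp [pderiv]

theorem _root_.ContDiff.pderiv {f : Eu n → ℝ} (hf : ContDiff ℝ ∞ f) (i : Fin n) :
    ContDiff ℝ ∞ (FluidPlate.pderiv i f) := by
  unfold FluidPlate.pderiv
  exact (hf.fderiv_right (m := ∞) le_rfl).clm_apply contDiff_const

theorem tsupport_pderiv_subset (f : Eu n → ℝ) : tsupport (pderiv i f) ⊆ tsupport f := by
  refine closure_minimal ?_ (isClosed_tsupport f)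
  intro x hx
  by_contra hxf
  apply hx
  have : fderiv ℝ f x = 0 := by
    by_contra h
    exact hxf (support_fderiv_subset ℝ (f := f) h)
  simp [pderiv, this]

namespace IsTestFunction

variable {φ : Eu n → ℝ}

theorem continuous (h : IsTestFunction D φ) : Continuous φ := h.1.continuous

theorem differentiable (h : IsTestFunction D φ) : Differentiable ℝ φ := h.1.differentiable (by simp)

theorem eq_zero (h : IsTestFunction D φ) {x : Eu n} (hx : x ∉ D) : φ x = 0 := by
  by_contra h'
  exact hx (h.2.2 (subset_tsupport _ h'))

theorem pderiv (h : IsTestFunction D φ) (i : Fin n) : IsTestFunction D (pderiv i φ) :=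
  ⟨h.1.pderiv i, h.2.1.of_isClosed_subset (isClosed_tsupport _) (tsupport_pderiv_subset φ),
    (tsupport_pderiv_subset φ).trans h.2.2⟩

theorem smooth_mul (h : IsTestFunction D φ) {f : Eu n → ℝ} (hf : ContDiff ℝ ∞ f) :
    IsTestFunction D (fun x => f x * φ x) :=
  ⟨hf.mul h.1, h.2.1.mul_left, (tsupport_mul_subset_right (f := f)).trans h.2.2⟩

theorem zero : IsTestFunction D (0 : Eu n → ℝ) :=
  ⟨contDiff_const, HasCompactSupport.zero, by simp [tsupport]⟩

theorem integrable (h : IsTestFunction D φ) : Integrable φ :=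
  h.continuous.integrable_of_hasCompactSupport h.2.1

theorem setIntegral_eq (h : IsTestFunction D φ) : ∫ x in D, φ x = ∫ x, φ x :=
  setIntegral_eq_integral_of_forall_compl_eq_zero fun _ hx => h.eq_zero hx

theorem integral_pderiv (h : IsTestFunction D φ) (i : Fin n) :
    ∫ x, FluidPlate.pderiv i φ x = 0 := by
  have := integral_mul_fderiv_eq_neg_fderiv_mul_of_integrable (μ := (volume : Measure (Eu n)))
    (f := fun _ => (1 : ℝ)) (g := φ) (v := EuclideanSpace.single i 1) (by simp)
    (by simp only [one_mul]; exact (h.pderiv i).integrable) (by simpa using h.integrable)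
    (fun _ _ => by fun_prop) (fun x _ => h.differentiable x)
  simpa [FluidPlate.pderiv] using this

theorem setIntegral_pderiv (h : IsTestFunction D φ) (i : Fin n) :
    ∫ x in D, FluidPlate.pderiv i φ x = 0 := by
  rw [(h.pderiv i).setIntegral_eq, h.integral_pderiv]

end IsTestFunction

end TestFunctions

/-! ### Square integrable functions on bounded sets -/

section Integrability

variable {n : ℕ} {D : Set (Eu n)}

theorem isFiniteMeasure_restrict (hb : Bornology.IsBounded D) :
    IsFiniteMeasure (volume.restrict D) :=
  ⟨by simpa using hb.measure_lt_top⟩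

theorem MemL2.integrable {f : Eu n → ℝ} (hb : Bornology.IsBounded D) (hf : MemL2 D f) :
    Integrable f (volume.restrict D) := by
  have := isFiniteMeasure_restrict hb
  exact MemLp.integrable one_le_two hf

theorem exists_bound_of_continuous {φ : Eu n → ℝ} (hb : Bornology.IsBounded D)
    (hφ : Continuous φ) : ∃ C, 0 ≤ C ∧ ∀ x ∈ D, ‖φ x‖ ≤ C := by
  obtain ⟨C, hC⟩ := hb.isCompact_closure.exists_bound_of_continuousOn hφ.continuousOn
  exact ⟨max C 0, le_max_right _ _, fun x hx => (hC x (subset_closure hx)).trans (le_max_left _ _)⟩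

theorem ae_restrict_of_forall (hD : IsOpen D) {P : Eu n → Prop} (h : ∀ x ∈ D, P x) :
    ∀ᵐ x ∂(volume.restrict D), P x :=
  (ae_restrict_iff' hD.measurableSet).2 (Eventually.of_forall h)

theorem memL2_of_continuous {φ : Eu n → ℝ} (hD : IsOpen D) (hb : Bornology.IsBounded D)
    (hφ : Continuous φ) : MemL2 D φ := by
  have := isFiniteMeasure_restrict hb
  obtain ⟨C, -, hC⟩ := exists_bound_of_continuous hb hφ
  exact MemLp.of_bound hφ.aestronglyMeasurable C (ae_restrict_of_forall hD hC)

theorem integrable_mul_continuous {f φ : Eu n → ℝ} (hD : IsOpen D) (hb : Bornology.IsBounded D)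
    (hf : Integrable f (volume.restrict D)) (hφ : Continuous φ) :
    Integrable (fun x => f x * φ x) (volume.restrict D) := by
  obtain ⟨C, -, hC⟩ := exists_bound_of_continuous hb hφ
  exact hf.mul_bdd hφ.aestronglyMeasurable (ae_restrict_of_forall hD hC)

theorem MemL2.integrable_mul {f g : Eu n → ℝ} (hf : MemL2 D f) (hg : MemL2 D g) :
    Integrable (fun x => f x * g x) (volume.restrict D) :=
  MemLp.integrable_mul hf hg

theorem MemL2.mul_continuous {f φ : Eu n → ℝ} (hD : IsOpen D) (hb : Bornology.IsBounded D)
    (hf : MemL2 D f) (hφ : Continuous φ) : MemL2 D (fun x => f x * φ x) := by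
  obtain ⟨C, -, hC⟩ := exists_bound_of_continuous hb hφ
  refine MemLp.of_le_mul (c := C) hf (hf.1.mul hφ.aestronglyMeasurable) ?_
  filter_upwards [ae_restrict_of_forall hD hC] with x hx
  rw [norm_mul, mul_comm]
  gcongr

theorem MemL2.congr {f g : Eu n → ℝ} (hf : MemL2 D f) (h : f =ᵐ[volume.restrict D] g) :
    MemL2 D g := (memLp_congr_ae h).1 hf

end Integrability

/-! ### Weak derivatives -/

section WeakDerivatives

variable {n : ℕ} {D : Set (Eu n)} {i : Fin n}

theorem HasWeakPDeriv.congr {f f' g g' : Eu n → ℝ} (h : HasWeakPDeriv D i f g)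
    (hf : f =ᵐ[volume.restrict D] f') (hg : g =ᵐ[volume.restrict D] g') :
    HasWeakPDeriv D i f' g' := by
  intro φ hφ
  have h1 : ∫ x in D, f' x * pderiv i φ x = ∫ x in D, f x * pderiv i φ x :=
    integral_congr_ae (by filter_upwards [hf] with x hx; rw [hx])
  have h2 : ∫ x in D, g' x * φ x = ∫ x in D, g x * φ x :=
    integral_congr_ae (by filter_upwards [hg] with x hx; rw [hx])
  rw [h1, h2, h φ hφ]

theorem HasWeakPDeriv.ae_eq {f g g' : Eu n → ℝ} (hD : IsOpen D) (hb : Bornology.IsBounded D)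
    (h : HasWeakPDeriv D i f g) (h' : HasWeakPDeriv D i f g')
    (hg : Integrable g (volume.restrict D)) (hg' : Integrable g' (volume.restrict D)) :
    g =ᵐ[volume.restrict D] g' := by
  have hloc : LocallyIntegrableOn (fun x => g x - g' x) D volume :=
    IntegrableOn.locallyIntegrableOn (hg.sub hg')
  have := hD.ae_eq_zero_of_integral_contDiff_smul_eq_zero hloc (fun φ h1 h2 h3 => by
    have ht : IsTestFunction D φ := ⟨h1, h2, h3⟩
    have e1 := h φ ht
    have e2 := h' φ ht
    have : ∫ x in D, φ x • (g x - g' x) = 0 := by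
      simp_rw [smul_eq_mul, mul_sub]
      rw [integral_sub]
      · simp_rw [mul_comm (φ _)]
        linarith
      · simpa only [mul_comm] using integrable_mul_continuous hD hb hg ht.continuous
      · simpa only [mul_comm] using integrable_mul_continuous hD hb hg' ht.continuous
    rw [← this]
    exact (setIntegral_eq_integral_of_forall_compl_eq_zero fun x hx => by
      simp [ht.eq_zero hx]).symm)
  filter_upwards [(ae_restrict_iff' hD.measurableSet).2 this] with x hx
  linarith

theorem HasWeakPDeriv.sub {f f' g g' : Eu n → ℝ} (hD : IsOpen D) (hb : Bornology.IsBounded D)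
    (h : HasWeakPDeriv D i f g) (h' : HasWeakPDeriv D i f' g') (hf : MemL2 D f)
    (hf' : MemL2 D f') (hg : MemL2 D g) (hg' : MemL2 D g') :
    HasWeakPDeriv D i (fun x => f x - f' x) (fun x => g x - g' x) := by
  intro φ hφ
  simp_rw [sub_mul]
  rw [integral_sub (integrable_mul_continuous hD hb (hf.integrable hb) (hφ.pderiv i).continuous)
      (integrable_mul_continuous hD hb (hf'.integrable hb) (hφ.pderiv i).continuous),
    integral_sub (integrable_mul_continuous hD hb (hg.integrable hb) hφ.continuous)
      (integrable_mul_continuous hD hb (hg'.integrable hb) hφ.continuous), h φ hφ, h' φ hφ]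
  ring

theorem _root_.ContDiff.hasWeakPDeriv {v : Eu n → ℝ} (hv : ContDiff ℝ ∞ v) (D : Set (Eu n))
    (i : Fin n) : HasWeakPDeriv D i v (pderiv i v) := by
  intro φ hφ
  have e1 : ∫ x in D, v x * pderiv i φ x = ∫ x, v x * pderiv i φ x :=
    ((hφ.pderiv i).smooth_mul hv).setIntegral_eq
  have e2 : ∫ x in D, pderiv i v x * φ x = ∫ x, pderiv i v x * φ x :=
    (hφ.smooth_mul (hv.pderiv i)).setIntegral_eq
  rw [e1, e2]
  exact integral_mul_fderiv_eq_neg_fderiv_mul_of_integrable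
    (hφ.smooth_mul (hv.pderiv i)).integrable ((hφ.pderiv i).smooth_mul hv).integrable
    (hφ.smooth_mul hv).integrable (fun x _ => hv.differentiable (by simp) x)
    (fun x _ => hφ.differentiable x)

theorem wderiv_spec {f : Eu n → ℝ} (h : ∃ g, MemL2 D g ∧ HasWeakPDeriv D i f g) :
    MemL2 D (wderiv D i f) ∧ HasWeakPDeriv D i f (wderiv D i f) := by
  rw [wderiv, dif_pos h]
  exact h.choose_spec

theorem HasWeakPDeriv.wderiv_ae_eq {f g : Eu n → ℝ} (hD : IsOpen D) (hb : Bornology.IsBounded D)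
    (h : HasWeakPDeriv D i f g) (hg : MemL2 D g) : wderiv D i f =ᵐ[volume.restrict D] g := by
  have := wderiv_spec ⟨g, hg, h⟩
  exact this.2.ae_eq hD hb h (this.1.integrable hb) (hg.integrable hb)

theorem wderiv_smooth {v : Eu n → ℝ} (hD : IsOpen D) (hb : Bornology.IsBounded D)
    (hv : ContDiff ℝ ∞ v) (i : Fin n) : wderiv D i v =ᵐ[volume.restrict D] pderiv i v :=
  (hv.hasWeakPDeriv D i).wderiv_ae_eq hD hb (memL2_of_continuous hD hb (hv.pderiv i).continuous)

theorem wderiv_congr {f g : Eu n → ℝ} (h : f =ᵐ[volume.restrict D] g) (i : Fin n) :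
    wderiv D i f = wderiv D i g := by
  have : HasWeakPDeriv D i f = HasWeakPDeriv D i g := funext fun k => propext
    ⟨fun hk => hk.congr h ae_eq_rfl, fun hk => hk.congr h.symm ae_eq_rfl⟩
  unfold wderiv
  rw [this]

theorem MemH.memL2 : ∀ {k : ℕ} {f : Eu n → ℝ}, MemH D k f → MemL2 D f
  | 0, _, h => h
  | _ + 1, _, h => h.1

theorem MemH.wderiv_spec {k : ℕ} {f : Eu n → ℝ} (h : MemH D (k + 1) f) (i : Fin n) :
    MemL2 D (wderiv D i f) ∧ HasWeakPDeriv D i f (wderiv D i f) := by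
  obtain ⟨g, h1, h2⟩ := h.2 i
  exact FluidPlate.wderiv_spec ⟨g, h2.memL2, h1⟩

theorem MemH.congr : ∀ {k : ℕ} {f g : Eu n → ℝ}, MemH D k f → f =ᵐ[volume.restrict D] g →
    MemH D k g
  | 0, _, _, h, e => MemL2.congr h e
  | _ + 1, _, _, h, e => ⟨MemL2.congr h.1 e, fun i => by
      obtain ⟨k, h1, h2⟩ := h.2 i
      exact ⟨k, h1.congr e ae_eq_rfl, h2⟩⟩

theorem MemH.wderiv {k : ℕ} {f : Eu n → ℝ} (hD : IsOpen D) (hb : Bornology.IsBounded D)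
    (h : MemH D (k + 1) f) (i : Fin n) : MemH D k (wderiv D i f) := by
  obtain ⟨g, h1, h2⟩ := h.2 i
  exact h2.congr (h1.wderiv_ae_eq hD hb h2.memL2).symm

theorem MemH.of_succ : ∀ {k : ℕ} {f : Eu n → ℝ}, MemH D (k + 1) f → MemH D k f
  | 0, _, h => h.1
  | _ + 1, _, h => ⟨h.1, fun i => by
      obtain ⟨g, h1, h2⟩ := h.2 i
      exact ⟨g, h1, h2.of_succ⟩⟩

theorem memH_of_contDiff (hD : IsOpen D) (hb : Bornology.IsBounded D) :
    ∀ (k : ℕ) {v : Eu n → ℝ}, ContDiff ℝ ∞ v → MemH D k v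
  | 0, _, hv => memL2_of_continuous hD hb hv.continuous
  | k + 1, _, hv => ⟨memL2_of_continuous hD hb hv.continuous, fun i =>
      ⟨_, hv.hasWeakPDeriv D i, memH_of_contDiff hD hb k (hv.pderiv i)⟩⟩

theorem MemH.sub (hD : IsOpen D) (hb : Bornology.IsBounded D) :
    ∀ {k : ℕ} {f g : Eu n → ℝ}, MemH D k f → MemH D k g → MemH D k (fun x => f x - g x)
  | 0, _, _, hf, hg => MemLp.sub hf hg
  | _ + 1, _, _, hf, hg => ⟨MemLp.sub hf.1 hg.1, fun i => by
      obtain ⟨f', h1, h2⟩ := hf.2 i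
      obtain ⟨g', h3, h4⟩ := hg.2 i
      exact ⟨_, h1.sub hD hb h3 hf.1 hg.1 h2.memL2 h4.memL2, h2.sub hD hb h4⟩⟩

theorem MemH.wderiv_sub {k : ℕ} {f g : Eu n → ℝ} (hD : IsOpen D) (hb : Bornology.IsBounded D)
    (hf : MemH D (k + 1) f) (hg : MemH D (k + 1) g) (i : Fin n) :
    FluidPlate.wderiv D i (fun x => f x - g x) =ᵐ[volume.restrict D]
      fun x => FluidPlate.wderiv D i f x - FluidPlate.wderiv D i g x := by
  have h1 := hf.wderiv_spec i
  have h2 := hg.wderiv_spec i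
  exact (h1.2.sub hD hb h2.2 hf.1 hg.1 h1.1 h2.1).wderiv_ae_eq hD hb (MemLp.sub h1.1 h2.1)

theorem wderiv_zero (hD : IsOpen D) (hb : Bornology.IsBounded D) (i : Fin n) :
    wderiv D i (0 : Eu n → ℝ) =ᵐ[volume.restrict D] 0 := by
  have := wderiv_smooth (v := 0) hD hb contDiff_const i
  filter_upwards [this] with x hx
  rw [hx]
  exact pderiv_const 0 x

end WeakDerivatives

/-! ### Integration lemmas -/

section Integration

/-- Cauchy–Schwarz with weight `k`, obtained by giving `√k` to each factor. -/
theorem lintegral_mul_mul_sq_le {α : Type*} [MeasurableSpace α] {μ : Measure α}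
    {f g k : α → ENNReal} (hf : AEMeasurable f μ) (hg : AEMeasurable g μ) (hk : AEMeasurable k μ) :
    (∫⁻ x, f x * g x * k x ∂μ) ^ 2 ≤ (∫⁻ x, f x ^ 2 * k x ∂μ) * ∫⁻ x, g x ^ 2 * k x ∂μ := by
  have hs : ∀ a : ENNReal, a ^ (1 / 2 : ℝ) * a ^ (1 / 2 : ℝ) = a := fun a => by
    rw [← ENNReal.rpow_add_of_nonneg _ _ (by norm_num) (by norm_num)]; norm_num
  have hs2 : ∀ a : ENNReal, (a ^ (1 / 2 : ℝ)) ^ 2 = a := fun a => by rw [sq, hs]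
  have hk' : AEMeasurable (fun x => k x ^ (1 / 2 : ℝ)) μ := hk.pow_const _
  have h := ENNReal.lintegral_mul_le_Lp_mul_Lq μ Real.HolderConjugate.two_two
    (hf.mul hk') (hg.mul hk')
  have e : ∀ F : α → ENNReal, (fun x => ((F * fun x => k x ^ (1 / 2 : ℝ)) x) ^ (2 : ℝ))
      = fun x => F x ^ 2 * k x := fun F => by
    ext x
    simp only [Pi.mul_apply]
    rw [ENNReal.rpow_two, mul_pow, hs2]
  have e' : (fun x => ((f * fun x => k x ^ (1 / 2 : ℝ)) * (g * fun x => k x ^ (1 / 2 : ℝ))) x)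
      = fun x => f x * g x * k x := by
    ext x
    simp only [Pi.mul_apply]
    rw [mul_mul_mul_comm, hs]
  rw [e, e, e'] at h
  calc _ ≤ _ := pow_le_pow_left' h 2
    _ = _ := by rw [mul_pow, hs2, hs2]

theorem lintegral_mul_sq_le {α : Type*} [MeasurableSpace α] {μ : Measure α}
    {f k : α → ENNReal} (hf : AEMeasurable f μ) (hk : AEMeasurable k μ) :
    (∫⁻ x, f x * k x ∂μ) ^ 2 ≤ (∫⁻ x, f x ^ 2 * k x ∂μ) * ∫⁻ x, k x ∂μ := by
  simpa using lintegral_mul_mul_sq_le hf (aemeasurable_const (b := 1)) hk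

theorem eLpNorm_two_sq {α : Type*} [MeasurableSpace α] {μ : Measure α} (f : α → ℝ) :
    eLpNorm f 2 μ ^ 2 = ∫⁻ x, ‖f x‖ₑ ^ 2 ∂μ := by
  have := eLpNorm_nnreal_pow_eq_lintegral (μ := μ) (f := f) (p := 2) (by norm_num)
  simpa using this

theorem lintegral_comp_smul_add {n : ℕ} {F : Eu n → ENNReal} (hF : Measurable F) {c : ℝ}
    (hc : c ≠ 0) (b : Eu n) :
    ∫⁻ x, F (c • x + b) = ENNReal.ofReal |(c ^ n)⁻¹| * ∫⁻ x, F x := by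
  have h1 : ∫⁻ x, F (c • x + b) = ∫⁻ x, F (x + b) ∂(Measure.map (fun x => c • x) volume) := by
    rw [lintegral_map (by fun_prop) (by fun_prop)]
  rw [h1, Measure.map_addHaar_smul _ hc, lintegral_smul_measure, lintegral_add_right_eq_self]
  simp

theorem integral_comp_smul_add {n : ℕ} (F : Eu n → ℝ) (c : ℝ) (b : Eu n) :
    ∫ x, F (c • x + b) = |(c ^ n)⁻¹| * ∫ x, F x := by
  have := Measure.integral_comp_smul volume (fun x => F (x + b)) c
  rw [this, integral_add_right_eq_self F b]
  simp

end Integration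

/-! ### Averaging kernels

For `x` in a convex open set `O` and `f` supported in `O`, the kernel `y ↦ scaledKernel f ε x y` is
supported in `O`: it is the image of the density `f` under `a ↦ (1 - ε) x + ε a`. -/

section Kernel

variable {n : ℕ}

/-- The density `f` transported by the map `a ↦ (1 - ε) x + ε a`. -/
noncomputable def scaledKernel (f : Eu n → ℝ) (ε : ℝ) (x y : Eu n) : ℝ :=
  (ε ^ n)⁻¹ * f (ε⁻¹ • (y - (1 - ε) • x))

/-- The average of `q` over `O` against the kernel `scaledKernel f ε x`. -/
noncomputable def kernelAvg (O : Set (Eu n)) (f : Eu n → ℝ) (ε : ℝ) (q : Eu n → ℝ) (x : Eu n) : ℝ :=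
  ∫ y in O, q y * scaledKernel f ε x y

variable {O : Set (Eu n)} {f : Eu n → ℝ} {ε : ℝ}

theorem continuous_scaledKernel (hf : Continuous f) (ε : ℝ) :
    Continuous (fun z : Eu n × Eu n => scaledKernel f ε z.1 z.2) := by
  unfold scaledKernel; fun_prop

theorem lintegral_scaledKernel_right (hf : Continuous f) (hε : 0 < ε) (x : Eu n) :
    ∫⁻ y, ‖scaledKernel f ε x y‖ₑ = ∫⁻ a, ‖f a‖ₑ := by
  have hm : Measurable fun a => ‖f a‖ₑ := hf.enorm.measurable
  have h := lintegral_comp_smul_add hm (inv_ne_zero hε.ne') (-(ε⁻¹ • (1 - ε) • x))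
  have e : ∀ y : Eu n, ‖scaledKernel f ε x y‖ₑ
      = ENNReal.ofReal (ε ^ n)⁻¹ * ‖f (ε⁻¹ • y + -(ε⁻¹ • (1 - ε) • x))‖ₑ := fun y => by
    rw [scaledKernel, enorm_mul, Real.enorm_of_nonneg (by positivity), smul_sub, sub_eq_add_neg]
  simp_rw [e]
  rw [lintegral_const_mul _ (by have := hf.measurable; fun_prop), h, ← mul_assoc, ← ENNReal.ofReal_mul (by positivity)]
  rw [inv_pow, inv_inv, abs_of_pos (by positivity), inv_mul_cancel₀ (by positivity)]
  simp

/-- As a function of `x` the kernel scales by `(1 - ε) / ε`, which leaves the factor `(1 - ε)⁻ⁿ`.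
The restriction `ε ≤ 1 / 2` bounds it by `2 ^ n`. -/
theorem lintegral_scaledKernel_left (hf : Continuous f) (hε : 0 < ε) (hε' : ε ≤ 1 / 2) (y : Eu n) :
    ∫⁻ x, ‖scaledKernel f ε x y‖ₑ ≤ 2 ^ n * ∫⁻ a, ‖f a‖ₑ := by
  have hm : Measurable fun a => ‖f a‖ₑ := hf.enorm.measurable
  have h1 : 0 < 1 - ε := by linarith
  have h := lintegral_comp_smul_add hm (c := -(ε⁻¹ * (1 - ε)))
    (neg_ne_zero.2 (by positivity)) (ε⁻¹ • y)
  have e : ∀ x : Eu n, ‖scaledKernel f ε x y‖ₑ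
      = ENNReal.ofReal (ε ^ n)⁻¹ * ‖f (-(ε⁻¹ * (1 - ε)) • x + ε⁻¹ • y)‖ₑ := fun x => by
    rw [scaledKernel, enorm_mul, Real.enorm_of_nonneg (by positivity)]
    congr 3
    module
  simp_rw [e]
  rw [lintegral_const_mul _ (by have := hf.measurable; fun_prop), h, ← mul_assoc, ← ENNReal.ofReal_mul (by positivity)]
  gcongr
  rw [abs_inv, abs_pow, abs_neg, abs_of_pos (by positivity), mul_pow, inv_pow, mul_inv, inv_inv,
    ← mul_assoc, inv_mul_cancel₀ (by positivity), one_mul, ← inv_pow]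
  have : (1 - ε)⁻¹ ≤ 2 := by
    rw [inv_le_comm₀ h1 (by norm_num)]; linarith
  calc ENNReal.ofReal ((1 - ε)⁻¹ ^ n) ≤ ENNReal.ofReal (2 ^ n) := by gcongr
    _ = 2 ^ n := by rw [ENNReal.ofReal_pow (by norm_num)]; simp

theorem integral_scaledKernel_right (f : Eu n → ℝ) (hε : 0 < ε) (x : Eu n) :
    ∫ y, scaledKernel f ε x y = ∫ a, f a := by
  have h := integral_comp_smul_add f (ε⁻¹) (-(ε⁻¹ • (1 - ε) • x))
  have e : ∀ y : Eu n, scaledKernel f ε x y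
      = (ε ^ n)⁻¹ * f (ε⁻¹ • y + -(ε⁻¹ • (1 - ε) • x)) := fun y => by
    rw [scaledKernel, smul_sub, sub_eq_add_neg]
  simp_rw [e]
  rw [integral_const_mul, h, inv_pow, inv_inv, abs_of_pos (by positivity), ← mul_assoc,
    inv_mul_cancel₀ (by positivity), one_mul]

theorem exists_of_scaledKernel_ne_zero (hε : 0 < ε) {x y : Eu n} (h : scaledKernel f ε x y ≠ 0) :
    ∃ a, f a ≠ 0 ∧ y = (1 - ε) • x + ε • a := by
  refine ⟨ε⁻¹ • (y - (1 - ε) • x), fun h0 => h (by rw [scaledKernel, h0, mul_zero]), ?_⟩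
  rw [smul_inv_smul₀ hε.ne']
  abel

/-- By convexity the support, an image of `tsupport f` under `a ↦ (1 - ε) x + ε a`, stays inside
`O`. Hence weak equations in `O` may be tested with the kernel for every `x ∈ O`, however close to
the boundary. -/
theorem isTestFunction_scaledKernel (hO : Convex ℝ O) (hf : IsTestFunction O f) (hε : 0 < ε)
    (hε' : ε ≤ 1 / 2) {x : Eu n} (hx : x ∈ O) : IsTestFunction O (scaledKernel f ε x) := by
  have hK : IsCompact ((fun a => (1 - ε) • x + ε • a) '' tsupport f) :=
    hf.2.1.isCompact.image (by fun_prop)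
  have hz : ∀ y ∉ ((fun a => (1 - ε) • x + ε • a) '' tsupport f), scaledKernel f ε x y = 0 := by
    intro y hy
    by_contra h
    obtain ⟨a, ha, rfl⟩ := exists_of_scaledKernel_ne_zero hε h
    exact hy ⟨a, subset_tsupport f ha, rfl⟩
  refine ⟨?_, HasCompactSupport.intro hK hz, ?_⟩
  · have := hf.1
    unfold scaledKernel
    fun_prop
  · have hsub : tsupport (scaledKernel f ε x) ⊆ (fun a => (1 - ε) • x + ε • a) '' tsupport f :=
      closure_minimal (fun y hy => by_contra fun h => hy (hz y h)) hK.isClosed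
    refine hsub.trans ?_
    rintro _ ⟨a, ha, rfl⟩
    exact hO hx (hf.2.2 ha) (by linarith) hε.le (by ring)

theorem pderiv_scaledKernel (hf : Differentiable ℝ f) (x y : Eu n) (i : Fin n) :
    pderiv i (scaledKernel f ε x) y = ε⁻¹ * scaledKernel (pderiv i f) ε x y := by
  have h1 : HasFDerivAt (fun y : Eu n => ε⁻¹ • (y - (1 - ε) • x))
      (ε⁻¹ • ContinuousLinearMap.id ℝ (Eu n)) y :=
    ((hasFDerivAt_id y).sub_const _).fun_const_smul _
  have h2 := ((hf _).hasFDerivAt.comp y h1).const_mul (ε ^ n)⁻¹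
  have h3 : HasFDerivAt (scaledKernel f ε x) _ y := h2
  rw [pderiv, h3.fderiv]
  simp [scaledKernel, pderiv]
  ring

/-- The kernel depends on `y - (1 - ε) x` only. The average is therefore a convolution of the zero
extension of `q`, evaluated at `(1 - ε) x`, and inherits smoothness on the whole space, which test
functions of the trace identities need. -/
theorem kernelAvg_eq_convolution (f : Eu n → ℝ) (ε : ℝ) (q : Eu n → ℝ) (hO : MeasurableSet O) :
    kernelAvg O f ε q = fun x =>
      (MeasureTheory.convolution (O.indicator q) (fun z => (ε ^ n)⁻¹ * f (-(ε⁻¹ • z)))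
        (ContinuousLinearMap.mul ℝ ℝ) volume) ((1 - ε) • x) := by
  ext x
  rw [kernelAvg, convolution, ← integral_indicator hO]
  congr 1
  ext y
  by_cases hy : y ∈ O
  · simp only [hy, Set.indicator_of_mem, ContinuousLinearMap.mul_apply', scaledKernel]
    congr 3
    rw [← smul_neg, neg_sub]
  · simp [hy]

theorem contDiff_kernelAvg {q : Eu n → ℝ} (hO : MeasurableSet O) (hf : IsTestFunction O f)
    (hε : 0 < ε) (hq : Integrable q (volume.restrict O)) : ContDiff ℝ ∞ (kernelAvg O f ε q) := by
  rw [kernelAvg_eq_convolution f ε q hO]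
  have hc : HasCompactSupport fun z : Eu n => (ε ^ n)⁻¹ * f (-(ε⁻¹ • z)) := by
    refine HasCompactSupport.mul_left ?_
    exact hf.2.1.comp_homeomorph
      ((Homeomorph.smulOfNeZero (ε⁻¹) (inv_ne_zero hε.ne')).trans (Homeomorph.neg (Eu n)))
  have hs : ContDiff ℝ ∞ fun z : Eu n => (ε ^ n)⁻¹ * f (-(ε⁻¹ • z)) := by
    have := hf.1
    fun_prop
  have := hc.contDiff_convolution_right (ContinuousLinearMap.mul ℝ ℝ)
    (integrable_indicator_iff hO |>.2 hq).locallyIntegrable hs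
  exact this.comp (by fun_prop)

theorem pderiv_kernelAvg {q : Eu n → ℝ} (hO : MeasurableSet O) (hf : IsTestFunction O f)
    (hε : 0 < ε) (hq : Integrable q (volume.restrict O)) (i : Fin n) (x : Eu n) :
    pderiv i (kernelAvg O f ε q) x = -((1 - ε) * ε⁻¹) * kernelAvg O (pderiv i f) ε q x := by
  have hc : HasCompactSupport fun z : Eu n => (ε ^ n)⁻¹ * f (-(ε⁻¹ • z)) := by
    refine HasCompactSupport.mul_left ?_
    exact hf.2.1.comp_homeomorph
      ((Homeomorph.smulOfNeZero (ε⁻¹) (inv_ne_zero hε.ne')).trans (Homeomorph.neg (Eu n)))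
  have hs : ContDiff ℝ ∞ fun z : Eu n => (ε ^ n)⁻¹ * f (-(ε⁻¹ • z)) := by
    have := hf.1
    fun_prop
  have h1 := hc.hasFDerivAt_convolution_right (ContinuousLinearMap.mul ℝ ℝ)
    (integrable_indicator_iff hO |>.2 hq).locallyIntegrable (hs.of_le (by simp)) ((1 - ε) • x)
  have h2 : HasFDerivAt (fun x : Eu n => (1 - ε) • x)
      ((1 - ε) • ContinuousLinearMap.id ℝ (Eu n)) x := (hasFDerivAt_id x).fun_const_smul _
  have h3 := h1.comp x h2
  rw [pderiv, kernelAvg_eq_convolution f ε q hO]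
  rw [kernelAvg_eq_convolution (pderiv i f) ε q hO]
  have h4 := h3.fderiv
  simp only [Function.comp_def] at h4
  rw [h4]
  simp only [ContinuousLinearMap.comp_smul, ContinuousLinearMap.comp_id,
    _root_.smul_apply]
  rw [convolution_precompR_apply (ContinuousLinearMap.mul ℝ ℝ)
    (integrable_indicator_iff hO |>.2 hq).locallyIntegrable (hc.fderiv ℝ)
    (hs.continuous_fderiv (by simp))]
  have e : (fun a => (fderiv ℝ (fun z : Eu n => (ε ^ n)⁻¹ * f (-(ε⁻¹ • z))) a)
      (EuclideanSpace.single i 1)) =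
      fun z => -ε⁻¹ * ((ε ^ n)⁻¹ * pderiv i f (-(ε⁻¹ • z))) := by
    ext z
    have g1 : HasFDerivAt (fun y : Eu n => -(ε⁻¹ • y))
      (-(ε⁻¹ • ContinuousLinearMap.id ℝ (Eu n))) z := ((hasFDerivAt_id z).fun_const_smul _).fun_neg
    have g2 := ((hf.differentiable _).hasFDerivAt.comp z g1).const_mul (ε ^ n)⁻¹
    simp only [Function.comp_def] at g2
    rw [g2.fderiv]
    simp [pderiv]
    ring
  rw [e]
  simp only [convolution, ContinuousLinearMap.mul_apply', smul_eq_mul]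
  rw [← integral_const_mul, ← integral_const_mul]
  congr 1
  ext t
  ring

end Kernel

/-! ### Boundedness and convergence of the averages in `L²`. -/

section Averaging

variable {n : ℕ} {O : Set (Eu n)} {f κ : Eu n → ℝ} {ε : ℝ}

theorem tendsto_zero_of_forall_approx {α : Type*} {l : Filter α} {F : α → ENNReal} {C : ENNReal}
    (hC : C ≠ ⊤) (h : ∀ η : ℝ, 0 < η → ∃ b : α → ENNReal, Tendsto b l (𝓝 0) ∧
      ∀ᶠ ε in l, F ε ≤ C * ENNReal.ofReal η + b ε) : Tendsto F l (𝓝 0) := by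
  rw [ENNReal.tendsto_nhds_zero]
  intro δ hδ
  have h1 : Tendsto (fun η : ℝ => C * ENNReal.ofReal η) (𝓝[>] 0) (𝓝 0) := by
    have : Tendsto (fun η : ℝ => C * ENNReal.ofReal η) (𝓝 0) (𝓝 (C * ENNReal.ofReal 0)) :=
      ENNReal.Tendsto.const_mul (ENNReal.continuous_ofReal.tendsto 0) (Or.inr hC)
    simpa using this.mono_left nhdsWithin_le_nhds
  have hδ2 : 0 < δ / 2 := ENNReal.half_pos hδ.ne'
  obtain ⟨η, hη, hη0⟩ := (((ENNReal.tendsto_nhds_zero.1 h1) _ hδ2).and self_mem_nhdsWithin).exists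
  obtain ⟨b, hb, hF⟩ := h η hη0
  filter_upwards [hF, (ENNReal.tendsto_nhds_zero.1 hb) _ hδ2] with ε h2 h3
  calc F ε ≤ C * ENNReal.ofReal η + b ε := h2
    _ ≤ δ / 2 + δ / 2 := add_le_add hη h3
    _ = δ := ENNReal.add_halves δ

theorem lintegral_enorm_lt_top (hf : IsTestFunction O f) : ∫⁻ a, ‖f a‖ₑ < ⊤ :=
  hf.integrable.2

theorem aemeasurable_enorm_scaledKernel (hf : Continuous f) (ε : ℝ) {μ : Measure (Eu n × Eu n)} :
    AEMeasurable (fun z : Eu n × Eu n => ‖scaledKernel f ε z.1 z.2‖ₑ) μ :=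
  (continuous_scaledKernel hf ε).enorm.measurable.aemeasurable

theorem lintegral_lintegral_scaledKernel_le (hf : Continuous f) (hε : 0 < ε) (hε' : ε ≤ 1 / 2)
    {g : Eu n → ENNReal} (hg : AEMeasurable g (volume.restrict O)) :
    ∫⁻ x in O, ∫⁻ y in O, g y * ‖scaledKernel f ε x y‖ₑ
      ≤ (2 ^ n * ∫⁻ a, ‖f a‖ₑ) * ∫⁻ y in O, g y := by
  rw [lintegral_lintegral_swap]
  · calc ∫⁻ y in O, ∫⁻ x in O, g y * ‖scaledKernel f ε x y‖ₑ
        ≤ ∫⁻ y in O, (2 ^ n * ∫⁻ a, ‖f a‖ₑ) * g y := by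
          refine lintegral_mono fun y => ?_
          have hm : Measurable fun x => ‖scaledKernel f ε x y‖ₑ :=
            ((continuous_scaledKernel hf ε).comp
              (by fun_prop : Continuous fun x => (x, y))).enorm.measurable
          rw [lintegral_const_mul _ hm, mul_comm]
          gcongr
          exact (setLIntegral_le_lintegral _ _).trans (lintegral_scaledKernel_left hf hε hε' y)
      _ = _ := lintegral_const_mul'' _ hg
  · exact hg.comp_snd.mul (aemeasurable_enorm_scaledKernel hf ε)

/-- Schur's test: Cauchy–Schwarz against the kernel, whose integrals in either variable are bounded
uniformly in `ε`. -/
theorem eLpNorm_kernelAvg_le (hf : Continuous f) (hε : 0 < ε) (hε' : ε ≤ 1 / 2)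
    {q : Eu n → ℝ} (hq : MemL2 O q) :
    eLpNorm (kernelAvg O f ε q) 2 (volume.restrict O)
      ≤ (2 ^ n * ∫⁻ a, ‖f a‖ₑ) * eLpNorm q 2 (volume.restrict O) := by
  set A := ∫⁻ a, ‖f a‖ₑ with hA
  have hqm : AEMeasurable (fun y => ‖q y‖ₑ) (volume.restrict O) := hq.1.enorm
  rw [← ENNReal.pow_le_pow_left_iff two_ne_zero, mul_pow, eLpNorm_two_sq, eLpNorm_two_sq]
  calc ∫⁻ x in O, ‖kernelAvg O f ε q x‖ₑ ^ 2
      ≤ ∫⁻ x in O, (∫⁻ y in O, ‖q y‖ₑ ^ 2 * ‖scaledKernel f ε x y‖ₑ) * A := by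
        refine lintegral_mono fun x => ?_
        have hk : AEMeasurable (fun y => ‖scaledKernel f ε x y‖ₑ) (volume.restrict O) := by
          have : Continuous fun y => scaledKernel f ε x y :=
            (continuous_scaledKernel hf ε).comp (by fun_prop : Continuous fun y => (x, y))
          exact this.enorm.measurable.aemeasurable
        calc ‖kernelAvg O f ε q x‖ₑ ^ 2
            ≤ (∫⁻ y in O, ‖q y‖ₑ * ‖scaledKernel f ε x y‖ₑ) ^ 2 := by
              gcongr
              refine (enorm_integral_le_lintegral_enorm _).trans_eq ?_
              simp_rw [enorm_mul]
          _ ≤ _ := lintegral_mul_sq_le hqm hk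
          _ ≤ _ := by
              gcongr
              exact (setLIntegral_le_lintegral _ _).trans_eq (lintegral_scaledKernel_right hf hε x)
    _ = (∫⁻ x in O, ∫⁻ y in O, ‖q y‖ₑ ^ 2 * ‖scaledKernel f ε x y‖ₑ) * A := by
        refine lintegral_mul_const'' _ ?_
        exact AEMeasurable.lintegral_prod_right' (μ := volume.restrict O) (ν := volume.restrict O)
          (f := fun z : Eu n × Eu n => ‖q z.2‖ₑ ^ 2 * ‖scaledKernel f ε z.1 z.2‖ₑ)
          (((hqm.pow_const 2).comp_snd).mul (aemeasurable_enorm_scaledKernel hf ε))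
    _ ≤ ((2 ^ n * A) * ∫⁻ y in O, ‖q y‖ₑ ^ 2) * A := by
        gcongr
        exact lintegral_lintegral_scaledKernel_le hf hε hε' (hqm.pow_const 2)
    _ ≤ (2 ^ n * A) ^ 2 * ∫⁻ y in O, ‖q y‖ₑ ^ 2 := by
        have h1 : (1 : ENNReal) ≤ 2 ^ n := one_le_pow₀ (by norm_num)
        calc _ = (1 * A) * (2 ^ n * A) * ∫⁻ y in O, ‖q y‖ₑ ^ 2 := by ring
          _ ≤ (2 ^ n * A) * (2 ^ n * A) * ∫⁻ y in O, ‖q y‖ₑ ^ 2 := by gcongr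
          _ = _ := by ring

theorem memL2_kernelAvg (hO : IsOpen O) (hb : Bornology.IsBounded O) (hf : IsTestFunction O f)
    (hε : 0 < ε) {q : Eu n → ℝ} (hq : MemL2 O q) : MemL2 O (kernelAvg O f ε q) :=
  memL2_of_continuous hO hb
    (contDiff_kernelAvg hO.measurableSet hf hε (hq.integrable hb)).continuous

theorem integrable_mul_scaledKernel (hO : IsOpen O) (hb : Bornology.IsBounded O)
    (hf : Continuous f) (ε : ℝ) {q : Eu n → ℝ} (hq : Integrable q (volume.restrict O)) (x : Eu n) :
    Integrable (fun y => q y * scaledKernel f ε x y) (volume.restrict O) :=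
  integrable_mul_continuous hO hb hq
    ((continuous_scaledKernel hf ε).comp (by fun_prop : Continuous fun y => (x, y)))

theorem kernelAvg_sub (hO : IsOpen O) (hb : Bornology.IsBounded O) (hf : Continuous f)
    {q r : Eu n → ℝ} (hq : Integrable q (volume.restrict O))
    (hr : Integrable r (volume.restrict O)) (x : Eu n) :
    kernelAvg O f ε (fun y => q y - r y) x = kernelAvg O f ε q x - kernelAvg O f ε r x := by
  unfold kernelAvg
  rw [← integral_sub (integrable_mul_scaledKernel hO hb hf ε hq x)
    (integrable_mul_scaledKernel hO hb hf ε hr x)]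
  simp_rw [sub_mul]

theorem setIntegral_scaledKernel (hO : Convex ℝ O) (hf : IsTestFunction O f) (hε : 0 < ε)
    (hε' : ε ≤ 1 / 2) {x : Eu n} (hx : x ∈ O) : ∫ y in O, scaledKernel f ε x y = ∫ a, f a := by
  rw [(isTestFunction_scaledKernel hO hf hε hε' hx).setIntegral_eq, integral_scaledKernel_right f hε]

/-- The kernel has mass one in `O`, and its support consists of points at distance `ε ‖a - x‖ ≤ ε
diam O` from `x`. -/
theorem norm_kernelAvg_sub_le_of_lipschitz (hO : IsOpen O) (hconv : Convex ℝ O)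
    (hb : Bornology.IsBounded O) (hκ : IsTestFunction O κ) (hκ1 : ∫ a, κ a = 1) (hε : 0 < ε)
    (hε' : ε ≤ 1 / 2) {q : Eu n → ℝ} {L : NNReal} (hq : LipschitzWith L q) {x : Eu n}
    (hx : x ∈ O) :
    ‖kernelAvg O κ ε q x - q x‖ ≤ L * (ε * Metric.diam O) * ∫ a, ‖κ a‖ := by
  have hk := isTestFunction_scaledKernel hconv hκ hε hε' hx
  have hqi : Integrable q (volume.restrict O) :=
    (memL2_of_continuous hO hb hq.continuous).integrable hb
  have e : kernelAvg O κ ε q x - q x = ∫ y in O, (q y - q x) * scaledKernel κ ε x y := by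
    simp_rw [sub_mul]
    rw [integral_sub (integrable_mul_scaledKernel hO hb hκ.continuous ε hqi x)
      (hk.integrable.integrableOn.const_mul _), integral_const_mul,
      setIntegral_scaledKernel hconv hκ hε hε' hx, hκ1, mul_one, kernelAvg]
  have hn : ∫ y, ‖scaledKernel κ ε x y‖ = ∫ a, ‖κ a‖ := by
    have := integral_scaledKernel_right (fun a => ‖κ a‖) hε x
    rw [← this]
    congr 1
    ext y
    rw [scaledKernel, scaledKernel, norm_mul, Real.norm_of_nonneg (by positivity)]
  rw [e, ← hn, ← integral_const_mul]
  calc ‖∫ y in O, (q y - q x) * scaledKernel κ ε x y‖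
      ≤ ∫ y in O, L * (ε * Metric.diam O) * ‖scaledKernel κ ε x y‖ := by
        refine norm_integral_le_of_norm_le ?_ (Eventually.of_forall fun y => ?_)
        · exact (hk.integrable.norm.const_mul _).integrableOn
        · rw [norm_mul]
          by_cases h0 : scaledKernel κ ε x y = 0
          · simp [h0]
          gcongr
          obtain ⟨a, ha, rfl⟩ := exists_of_scaledKernel_ne_zero hε h0
          have ha' : a ∈ O := hκ.2.2 (subset_tsupport _ ha)
          rw [← dist_eq_norm]
          refine (hq.dist_le_mul _ _).trans ?_
          gcongr
          rw [dist_eq_norm]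
          have : (1 - ε) • x + ε • a - x = ε • (a - x) := by module
          rw [this, norm_smul, Real.norm_of_nonneg hε.le, ← dist_eq_norm]
          gcongr
          exact Metric.dist_le_diam_of_mem hb ha' hx
    _ ≤ _ := by
        refine setIntegral_le_integral (hk.integrable.norm.const_mul _)
          (Eventually.of_forall fun y => ?_)
        have := Metric.diam_nonneg (s := O)
        simp only [Pi.zero_apply]
        positivity

theorem eventually_small : ∀ᶠ ε : ℝ in 𝓝[>] 0, 0 < ε ∧ ε ≤ 1 / 2 := by
  filter_upwards [Ioc_mem_nhdsGT (show (0 : ℝ) < 1 / 2 by norm_num)] with ε h using h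

/-- Uniform boundedness in `L²` and density: the estimate for Lipschitz functions handles a smooth
approximation of `q`. -/
theorem tendsto_kernelAvg (hO : IsOpen O) (hconv : Convex ℝ O)
    (hb : Bornology.IsBounded O) (hκ : IsTestFunction O κ) (hκ1 : ∫ a, κ a = 1)
    {q : Eu n → ℝ} (hq : MemL2 O q) :
    Tendsto (fun ε => eLpNorm (fun x => kernelAvg O κ ε q x - q x) 2 (volume.restrict O))
      (𝓝[>] 0) (𝓝 0) := by
  have := isFiniteMeasure_restrict hb
  -- The extra `1` accounts for `q - g` itself, next to its average.
  have hA : (2 ^ n * ∫⁻ a, ‖κ a‖ₑ) + 1 ≠ ⊤ := by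
    have := (lintegral_enorm_lt_top hκ).ne
    finiteness
  refine tendsto_zero_of_forall_approx hA fun η hη => ?_
  obtain ⟨g, hgc, hgs, hg⟩ := hq.exist_eLpNorm_sub_le (by norm_num) one_le_two hη
  obtain ⟨L, hL⟩ := hgs.lipschitzWith_of_hasCompactSupport hgc (by simp)
  have hg2 : MemL2 O g := memL2_of_continuous hO hb hgs.continuous
  have hqg : MemL2 O (fun y => q y - g y) := MemLp.sub hq hg2
  refine ⟨fun ε => (volume.restrict O) Set.univ ^ (2 : ENNReal).toReal⁻¹ *
    ENNReal.ofReal (L * (ε * Metric.diam O) * ∫ a, ‖κ a‖), ?_, ?_⟩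
  · have h1 : Tendsto (fun ε : ℝ => L * (ε * Metric.diam O) * ∫ a, ‖κ a‖) (𝓝[>] 0) (𝓝 0) := by
      have : Continuous fun ε : ℝ => L * (ε * Metric.diam O) * ∫ a, ‖κ a‖ := by fun_prop
      simpa using (this.tendsto 0).mono_left nhdsWithin_le_nhds
    have h2 := ENNReal.Tendsto.const_mul
      (a := (volume.restrict O) Set.univ ^ (2 : ENNReal).toReal⁻¹) (ENNReal.tendsto_ofReal h1)
      (Or.inr (by finiteness))
    simpa using h2
  · filter_upwards [eventually_small] with ε hε
    have e : (fun x => kernelAvg O κ ε q x - q x) =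
        ((kernelAvg O κ ε fun y => q y - g y) - fun y => q y - g y)
          + fun x => kernelAvg O κ ε g x - g x := by
      ext x
      simp only [Pi.add_apply, Pi.sub_apply]
      rw [kernelAvg_sub hO hb hκ.continuous (hq.integrable hb) (hg2.integrable hb)]
      ring
    have m1 := memL2_kernelAvg hO hb hκ hε.1 hqg
    have m2 := memL2_kernelAvg hO hb hκ hε.1 hg2
    rw [e]
    refine (eLpNorm_add_le (m1.1.sub hqg.1) (m2.1.sub hg2.1) one_le_two).trans ?_
    gcongr
    · refine (eLpNorm_sub_le m1.1 hqg.1 one_le_two).trans ?_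
      rw [add_mul, one_mul]
      gcongr
      · exact (eLpNorm_kernelAvg_le hκ.continuous hε.1 hε.2 hqg).trans (by gcongr; exact hg)
      · exact hg
    · exact eLpNorm_le_of_ae_bound (ae_restrict_of_forall hO fun x hx =>
        norm_kernelAvg_sub_le_of_lipschitz hO hconv hb hκ hκ1 hε.1 hε.2 hL hx)

/-- A derivative in `x` of the kernel is `-(1 - ε)` times one in `y`; the latter is moved onto `q`,
the kernel being a test function in `O`. -/
theorem pderiv_kernelAvg_of_hasWeakPDeriv (hO : IsOpen O) (hconv : Convex ℝ O)
    (hb : Bornology.IsBounded O) (hκ : IsTestFunction O κ) (hε : 0 < ε) (hε' : ε ≤ 1 / 2)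
    {q g : Eu n → ℝ} (hq : MemL2 O q) {i : Fin n} (hg : HasWeakPDeriv O i q g) {x : Eu n}
    (hx : x ∈ O) : pderiv i (kernelAvg O κ ε q) x = (1 - ε) * kernelAvg O κ ε g x := by
  rw [pderiv_kernelAvg hO.measurableSet hκ hε (hq.integrable hb)]
  have h := hg _ (isTestFunction_scaledKernel hconv hκ hε hε' hx)
  simp_rw [pderiv_scaledKernel hκ.differentiable] at h
  have e : kernelAvg O (pderiv i κ) ε q x
      = ε * ∫ y in O, q y * (ε⁻¹ * scaledKernel (pderiv i κ) ε x y) := by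
    rw [← integral_const_mul, kernelAvg]
    congr 1
    ext y
    field_simp
  rw [e, h, kernelAvg]
  field_simp

theorem exists_weight (hO : IsOpen O) (hne : O.Nonempty) :
    ∃ κ : Eu n → ℝ, IsTestFunction O κ ∧ ∫ a, κ a = 1 := by
  obtain ⟨x, hx⟩ := hne
  obtain ⟨r, hr, hrO⟩ := Metric.isOpen_iff.1 hO x hx
  let b : ContDiffBump x := ⟨r / 4, r / 2, by positivity, by linarith⟩
  refine ⟨b.normed volume, ⟨b.contDiff_normed, b.hasCompactSupport_normed, ?_⟩, b.integral_normed⟩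
  rw [b.tsupport_normed_eq]
  exact (Metric.closedBall_subset_ball (by simp [b]; linarith)).trans hrO

/-- The averages have zero gradient on the connected set `O`, so they are constant there, and a
subsequence converges to `p` almost everywhere. -/
theorem ae_eq_const_of_hasWeakPDeriv_zero (hO : IsOpen O) (hconv : Convex ℝ O)
    (hb : Bornology.IsBounded O) {p : Eu n → ℝ} (hp : MemL2 O p)
    (h : ∀ i, HasWeakPDeriv O i p 0) : ∃ c : ℝ, ∀ᵐ x ∂(volume.restrict O), p x = c := by
  rcases O.eq_empty_or_nonempty with rfl | hne
  · exact ⟨0, by simp⟩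
  obtain ⟨κ, hκ, hκ1⟩ := exists_weight hO hne
  obtain ⟨x₀, hx₀⟩ := hne
  have h0 : ∀ᶠ m : ℕ in atTop, 0 < 1 / ((m : ℝ) + 1) ∧ 1 / ((m : ℝ) + 1) ≤ 1 / 2 :=
    (tendsto_nhdsWithin_iff.2 ⟨tendsto_one_div_add_atTop_nhds_zero_nat,
      Eventually.of_forall fun m => by simp only [Set.mem_Ioi]; positivity⟩).eventually eventually_small
  have hconst : ∀ ε : ℝ, 0 < ε → ε ≤ 1 / 2 → ∀ x ∈ O,
      kernelAvg O κ ε p x = kernelAvg O κ ε p x₀ := by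
    intro ε hε hε' x hx
    have hd := (contDiff_kernelAvg hO.measurableSet hκ hε (hp.integrable hb)).differentiable
      (by simp)
    refine hO.is_const_of_fderiv_eq_zero (𝕜 := ℝ) hconv.isPreconnected hd.differentiableOn ?_ hx hx₀
    intro y hy
    have h1 : ∀ i, fderiv ℝ (kernelAvg O κ ε p) y (EuclideanSpace.single i 1) = 0 := fun i => by
      have := pderiv_kernelAvg_of_hasWeakPDeriv hO hconv hb hκ hε hε' hp (h i) hy
      rw [pderiv] at this
      rw [this]
      simp [kernelAvg]
    simp only [Pi.zero_apply]
    apply ContinuousLinearMap.coe_injective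
    refine (EuclideanSpace.basisFun (Fin n) ℝ).toBasis.ext fun i => ?_
    simpa using h1 i
  have ht := tendsto_kernelAvg hO hconv hb hκ hκ1 hp
  have hseq : Tendsto (fun m : ℕ => 1 / ((m : ℝ) + 1)) atTop (𝓝[>] 0) :=
    tendsto_nhdsWithin_iff.2 ⟨tendsto_one_div_add_atTop_nhds_zero_nat,
      Eventually.of_forall fun m => by simp only [Set.mem_Ioi]; positivity⟩
  have ht' := ht.comp hseq
  have hm := tendstoInMeasure_of_tendsto_eLpNorm (p := 2) (by norm_num)
    (f := fun (m : ℕ) x => kernelAvg O κ (1 / ((m : ℝ) + 1)) p x) (g := p)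
    (fun m => (memL2_kernelAvg hO hb hκ (by positivity) hp).1) hp.1 ht'
  obtain ⟨ns, hns, hae⟩ := hm.exists_seq_tendsto_ae
  have hmem : ∀ᵐ x ∂(volume.restrict O), x ∈ O := ae_restrict_mem hO.measurableSet
  -- Positive measure provides a point of convergence `x₁`, whose value serves as the constant.
  have hpos : (volume.restrict O) Set.univ ≠ 0 := by
    simpa using (hO.measure_pos volume ⟨x₀, hx₀⟩).ne'
  have : NeBot (ae (volume.restrict O)) := ae_neBot.2 (by
    intro h; rw [h] at hpos; simp at hpos)
  obtain ⟨x₁, hx₁, hx₁O⟩ := (hae.and hmem).exists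
  refine ⟨p x₁, ?_⟩
  filter_upwards [hae, hmem] with x hx hxO
  refine tendsto_nhds_unique hx (hx₁.congr' ?_)
  filter_upwards [hns.tendsto_atTop.eventually h0] with m hm
  rw [hconst _ hm.1 hm.2 x hxO, hconst _ hm.1 hm.2 x₁ hx₁O]

end Averaging

/-! ### Mean square differences of `H¹` functions against the kernel. -/

section Translation

variable {n : ℕ} {O : Set (Eu n)} {f κ : Eu n → ℝ} {ε : ℝ}

theorem measurable_enorm_scaledKernel (hf : Continuous f) (ε : ℝ) (x : Eu n) :
    Measurable fun y => ‖scaledKernel f ε x y‖ₑ :=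
  ((continuous_scaledKernel hf ε).comp
    (by fun_prop : Continuous fun y => (x, y))).enorm.measurable

theorem lintegral_mul_scaledKernel {F : Eu n → ENNReal} (hF : Measurable F) (hf : Continuous f)
    (hε : 0 < ε) (x : Eu n) :
    ∫⁻ y, F y * ‖scaledKernel f ε x y‖ₑ = ∫⁻ a, F ((1 - ε) • x + ε • a) * ‖f a‖ₑ := by
  have hm : Measurable fun a => F ((1 - ε) • x + ε • a) * ‖f a‖ₑ := by
    have := hf.enorm.measurable
    fun_prop
  have h := lintegral_comp_smul_add hm (inv_ne_zero hε.ne') (-(ε⁻¹ • (1 - ε) • x))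
  have e : ∀ y : Eu n, F y * ‖scaledKernel f ε x y‖ₑ = ENNReal.ofReal (ε ^ n)⁻¹ *
      (F ((1 - ε) • x + ε • (ε⁻¹ • y + -(ε⁻¹ • (1 - ε) • x)))
        * ‖f (ε⁻¹ • y + -(ε⁻¹ • (1 - ε) • x))‖ₑ) := fun y => by
    have e1 : (1 - ε) • x + ε • (ε⁻¹ • y + -(ε⁻¹ • (1 - ε) • x)) = y := by
      rw [smul_add, smul_neg, smul_inv_smul₀ hε.ne', smul_inv_smul₀ hε.ne']; abel
    rw [e1, scaledKernel, enorm_mul, Real.enorm_of_nonneg (by positivity), smul_sub, sub_eq_add_neg]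
    ring
  simp_rw [e]
  have hm' : Measurable fun y => F ((1 - ε) • x + ε • (ε⁻¹ • y + -(ε⁻¹ • (1 - ε) • x)))
      * ‖f (ε⁻¹ • y + -(ε⁻¹ • (1 - ε) • x))‖ₑ :=
    hm.comp (by fun_prop : Measurable fun y : Eu n => ε⁻¹ • y + -(ε⁻¹ • (1 - ε) • x))
  rw [lintegral_const_mul _ hm', h, ← mul_assoc, ← ENNReal.ofReal_mul (by positivity)]
  rw [inv_pow, inv_inv, abs_of_pos (by positivity), inv_mul_cancel₀ (by positivity)]
  simp

theorem lintegral_comp_segment_le {G : Eu n → ENNReal} (hG : Measurable G) {t : ℝ}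
    (ht : t ≤ 1 / 2) (a : Eu n) :
    ∫⁻ x, G ((1 - t) • x + t • a) ≤ 2 ^ n * ∫⁻ x, G x := by
  have h1 : 0 < 1 - t := by linarith
  rw [lintegral_comp_smul_add hG h1.ne']
  gcongr
  rw [abs_of_pos (by positivity), ← inv_pow]
  have : (1 - t)⁻¹ ≤ 2 := by
    rw [inv_le_comm₀ h1 (by norm_num)]; linarith
  calc ENNReal.ofReal ((1 - t)⁻¹ ^ n) ≤ ENNReal.ofReal (2 ^ n) := by gcongr
    _ = 2 ^ n := by rw [ENNReal.ofReal_pow (by norm_num)]; simp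

theorem norm_fderiv_apply_le (v : Eu n → ℝ) (z w : Eu n) :
    ‖fderiv ℝ v z w‖ ≤ ‖w‖ * ∑ i, ‖pderiv i v z‖ := by
  have hw : w = ∑ i, w i • EuclideanSpace.single i (1 : ℝ) := by
    have := (EuclideanSpace.basisFun (Fin n) ℝ).sum_repr w
    simpa using this.symm
  conv_lhs => rw [hw, map_sum]
  rw [Finset.mul_sum]
  refine (norm_sum_le _ _).trans (Finset.sum_le_sum fun i _ => ?_)
  rw [map_smul, norm_smul]
  exact mul_le_mul_of_nonneg_right (PiLp.norm_apply_le w i) (norm_nonneg _)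

/-- The fundamental theorem of calculus along the segment, then Cauchy–Schwarz on the unit interval.
-/
theorem enorm_sub_sq_le_of_contDiff {v : Eu n → ℝ} (hv : ContDiff ℝ ∞ v) (x w : Eu n) :
    ‖v (x + w) - v x‖ₑ ^ 2
      ≤ ‖w‖ₑ ^ 2 * ∫⁻ s in Set.Ioc (0 : ℝ) 1, ‖∑ i, ‖pderiv i v (x + s • w)‖‖ₑ ^ 2 := by
  have hd : ∀ s : ℝ, HasDerivAt (fun s : ℝ => v (x + s • w)) (fderiv ℝ v (x + s • w) w) s := by
    intro s
    have h1 : HasDerivAt (fun s : ℝ => x + s • w) w s := by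
      simpa using ((hasDerivAt_id s).smul_const w).const_add x
    exact ((hv.differentiable (by simp)) _).hasFDerivAt.comp_hasDerivAt s h1
  have hcont : Continuous fun s : ℝ => fderiv ℝ v (x + s • w) w :=
    ((hv.continuous_fderiv (by simp)).comp (by fun_prop)).clm_apply continuous_const
  have hG : Continuous fun s : ℝ => ∑ i, ‖pderiv i v (x + s • w)‖ := by
    refine continuous_finsetSum _ fun i _ => ?_
    exact ((hv.pderiv i).continuous.comp (by fun_prop)).norm
  have h := intervalIntegral.integral_eq_sub_of_hasDerivAt (fun s _ => hd s)
    (hcont.intervalIntegrable 0 1)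
  simp only [one_smul, zero_smul, add_zero] at h
  rw [← h, intervalIntegral.integral_of_le zero_le_one]
  have h2 : ‖∫ s in Set.Ioc (0 : ℝ) 1, fderiv ℝ v (x + s • w) w‖ₑ
      ≤ ∫⁻ s in Set.Ioc (0 : ℝ) 1, ‖w‖ₑ * ‖∑ i, ‖pderiv i v (x + s • w)‖‖ₑ := by
    refine (enorm_integral_le_lintegral_enorm _).trans (lintegral_mono fun s => ?_)
    rw [← ofReal_norm, ← ofReal_norm, ← ofReal_norm, ← ENNReal.ofReal_mul (norm_nonneg _)]
    refine ENNReal.ofReal_le_ofReal ((norm_fderiv_apply_le v _ w).trans ?_)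
    gcongr
    exact Real.le_norm_self _
  have hGm : Measurable fun s : ℝ => ‖∑ i, ‖pderiv i v (x + s • w)‖‖ₑ := hG.enorm.measurable
  calc _ ≤ (∫⁻ s in Set.Ioc (0 : ℝ) 1, ‖w‖ₑ * ‖∑ i, ‖pderiv i v (x + s • w)‖‖ₑ) ^ 2 := by gcongr
    _ = ‖w‖ₑ ^ 2 * (∫⁻ s in Set.Ioc (0 : ℝ) 1, ‖∑ i, ‖pderiv i v (x + s • w)‖‖ₑ * 1) ^ 2 := by
        rw [lintegral_const_mul _ hGm, mul_pow]; simp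
    _ ≤ _ := by
        gcongr
        refine (lintegral_mul_sq_le hGm.aemeasurable aemeasurable_const).trans_eq ?_
        simp

/-- The translation estimate of a smooth function along the segments that define
`scaledKernel`. -/
theorem lintegral_sub_sq_scaledKernel_le_of_contDiff (hO : IsOpen O) (hconv : Convex ℝ O)
    (hb : Bornology.IsBounded O) (hf : IsTestFunction O f) (hε : 0 < ε) (hε' : ε ≤ 1 / 2)
    {v : Eu n → ℝ} (hv : ContDiff ℝ ∞ v) :
    ∫⁻ x in O, ∫⁻ y in O, ‖v y - v x‖ₑ ^ 2 * ‖scaledKernel f ε x y‖ₑ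
      ≤ ((ENNReal.ofReal (Metric.diam O)) ^ 2 * (2 ^ n * ∫⁻ a, ‖f a‖ₑ)) * ENNReal.ofReal ε ^ 2 *
        (∑ i, eLpNorm (pderiv i v) 2 (volume.restrict O)) ^ 2 := by
  set d := ENNReal.ofReal (Metric.diam O)
  set S : Eu n → ℝ := fun z => ∑ i, ‖pderiv i v z‖ with hS
  have hSc : Continuous S :=
    continuous_finsetSum _ fun i _ => (hv.pderiv i).continuous.norm
  -- The gradient is extended by zero, so that the bound can later be integrated over all `x`.
  set G : Eu n → ENNReal := O.indicator fun z => ‖S z‖ₑ ^ 2 with hG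
  have hGm : Measurable G := (hSc.enorm.measurable.pow_const 2).indicator hO.measurableSet
  have hGi : ∫⁻ z, G z ≤ (∑ i, eLpNorm (pderiv i v) 2 (volume.restrict O)) ^ 2 := by
    rw [hG, lintegral_indicator hO.measurableSet, ← eLpNorm_two_sq]
    gcongr
    have : S = ∑ i, fun z => ‖pderiv i v z‖ := by ext z; simp [hS]
    rw [this]
    refine (eLpNorm_sum_le (fun i _ => (hv.pderiv i).continuous.norm.aestronglyMeasurable)
      one_le_two).trans_eq ?_
    simp_rw [eLpNorm_norm]
  have hvm : ∀ x, Measurable fun y => ‖v y - v x‖ₑ ^ 2 := fun x => by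
    have := hv.continuous
    exact (by fun_prop : Continuous fun y => v y - v x).enorm.measurable.pow_const 2
  have hin : ∀ x ∈ O, ∫⁻ y in O, ‖v y - v x‖ₑ ^ 2 * ‖scaledKernel f ε x y‖ₑ
      ≤ ∫⁻ a, ∫⁻ s in Set.Ioc (0 : ℝ) 1, (d ^ 2 * ENNReal.ofReal ε ^ 2 * ‖f a‖ₑ) *
          G ((1 - s * ε) • x + (s * ε) • a) := by
    intro x hx
    refine (setLIntegral_le_lintegral _ _).trans ?_
    rw [lintegral_mul_scaledKernel (hvm x) hf.continuous hε]
    refine lintegral_mono fun a => ?_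
    have hGs : Measurable fun s : ℝ => G ((1 - s * ε) • x + (s * ε) • a) :=
      hGm.comp (by fun_prop)
    rw [lintegral_const_mul _ hGs]
    by_cases h0 : f a = 0
    · simp [h0]
    have ha : a ∈ O := hf.2.2 (subset_tsupport _ h0)
    have e1 : (1 - ε) • x + ε • a = x + ε • (a - x) := by module
    rw [e1]
    have h1 : ∫⁻ s in Set.Ioc (0 : ℝ) 1, ‖S (x + s • ε • (a - x))‖ₑ ^ 2
        = ∫⁻ s in Set.Ioc (0 : ℝ) 1, G ((1 - s * ε) • x + (s * ε) • a) := by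
      refine setLIntegral_congr_fun measurableSet_Ioc fun s hs => ?_
      have e2 : x + s • ε • (a - x) = (1 - s * ε) • x + (s * ε) • a := by module
      have hmem : (1 - s * ε) • x + (s * ε) • a ∈ O :=
        hconv hx ha (by nlinarith [hs.1, hs.2]) (mul_nonneg hs.1.le hε.le) (by ring)
      simp only [hG, Set.indicator_of_mem hmem, e2]
    have h2 : ‖ε • (a - x)‖ₑ ≤ d * ENNReal.ofReal ε := by
      rw [enorm_smul, Real.enorm_of_nonneg hε.le, mul_comm, ← ofReal_norm]
      gcongr
      rw [← dist_eq_norm]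
      exact ENNReal.ofReal_le_ofReal (Metric.dist_le_diam_of_mem hb ha hx)
    calc ‖v (x + ε • (a - x)) - v x‖ₑ ^ 2 * ‖f a‖ₑ
        ≤ (‖ε • (a - x)‖ₑ ^ 2 * ∫⁻ s in Set.Ioc (0 : ℝ) 1, ‖S (x + s • ε • (a - x))‖ₑ ^ 2)
            * ‖f a‖ₑ := by
          gcongr
          exact enorm_sub_sq_le_of_contDiff hv x _
      _ ≤ ((d * ENNReal.ofReal ε) ^ 2 *
            ∫⁻ s in Set.Ioc (0 : ℝ) 1, G ((1 - s * ε) • x + (s * ε) • a)) * ‖f a‖ₑ := by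
          rw [h1]; gcongr
      _ = _ := by ring
  have hfm : Measurable fun a => ‖f a‖ₑ := hf.continuous.enorm.measurable
  calc ∫⁻ x in O, ∫⁻ y in O, ‖v y - v x‖ₑ ^ 2 * ‖scaledKernel f ε x y‖ₑ
      ≤ ∫⁻ x in O, ∫⁻ a, ∫⁻ s in Set.Ioc (0 : ℝ) 1, (d ^ 2 * ENNReal.ofReal ε ^ 2 * ‖f a‖ₑ) *
          G ((1 - s * ε) • x + (s * ε) • a) := setLIntegral_mono' hO.measurableSet hin
    _ ≤ ∫⁻ x, ∫⁻ a, ∫⁻ s in Set.Ioc (0 : ℝ) 1, (d ^ 2 * ENNReal.ofReal ε ^ 2 * ‖f a‖ₑ) *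
          G ((1 - s * ε) • x + (s * ε) • a) := setLIntegral_le_lintegral _ _
    -- The `x`-integral is brought innermost: for fixed `a` and `s` the map `x ↦ (1 - sε) x + sε a`
    -- is an affine change of variables with Jacobian at least `2⁻ⁿ`.
    _ = ∫⁻ a, ∫⁻ x, ∫⁻ s in Set.Ioc (0 : ℝ) 1, (d ^ 2 * ENNReal.ofReal ε ^ 2 * ‖f a‖ₑ) *
          G ((1 - s * ε) • x + (s * ε) • a) := by
        refine lintegral_lintegral_swap (Measurable.aemeasurable ?_)
        refine Measurable.lintegral_prod_right' (ν := volume.restrict (Set.Ioc (0 : ℝ) 1))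
          (f := fun z : (Eu n × Eu n) × ℝ => (d ^ 2 * ENNReal.ofReal ε ^ 2 * ‖f z.1.2‖ₑ) *
          G ((1 - z.2 * ε) • z.1.1 + (z.2 * ε) • z.1.2)) ?_
        exact (measurable_const.mul (hfm.comp (by fun_prop))).mul (hGm.comp (by fun_prop))
    _ = ∫⁻ a, ∫⁻ s in Set.Ioc (0 : ℝ) 1, ∫⁻ x, (d ^ 2 * ENNReal.ofReal ε ^ 2 * ‖f a‖ₑ) *
          G ((1 - s * ε) • x + (s * ε) • a) := by
        congr 1
        ext a
        refine lintegral_lintegral_swap (Measurable.aemeasurable ?_)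
        exact measurable_const.mul (hGm.comp (by fun_prop))
    _ ≤ ∫⁻ a, ∫⁻ s in Set.Ioc (0 : ℝ) 1, (d ^ 2 * ENNReal.ofReal ε ^ 2 * ‖f a‖ₑ) *
          (2 ^ n * ∫⁻ z, G z) := by
        refine lintegral_mono fun a => setLIntegral_mono' measurableSet_Ioc fun s hs => ?_
        have hGs : Measurable fun x => G ((1 - s * ε) • x + (s * ε) • a) :=
          hGm.comp (by fun_prop)
        rw [lintegral_const_mul _ hGs]
        gcongr
        exact lintegral_comp_segment_le hGm (by nlinarith [hs.1, hs.2]) a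
    _ = (d ^ 2 * ENNReal.ofReal ε ^ 2) * (∫⁻ a, ‖f a‖ₑ) * (2 ^ n * ∫⁻ z, G z) := by
        simp only [lintegral_const, MeasurableSet.univ, Measure.restrict_apply, Set.univ_inter,
          Real.volume_Ioc, sub_zero, ENNReal.ofReal_one, mul_one]
        rw [lintegral_mul_const _ (by fun_prop), lintegral_const_mul _ hfm]
    _ ≤ (d ^ 2 * ENNReal.ofReal ε ^ 2) * (∫⁻ a, ‖f a‖ₑ) *
          (2 ^ n * (∑ i, eLpNorm (pderiv i v) 2 (volume.restrict O)) ^ 2) := by gcongr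
    _ = _ := by ring

theorem enorm_add_three_sq_le (a b c : ℝ) :
    ‖a + b + c‖ₑ ^ 2 ≤ 3 * (‖a‖ₑ ^ 2 + ‖b‖ₑ ^ 2 + ‖c‖ₑ ^ 2) := by
  have h : ∀ r : ℝ, ‖r‖ₑ ^ 2 = ENNReal.ofReal (r ^ 2) := fun r => by
    rw [Real.enorm_eq_ofReal_abs, ← ENNReal.ofReal_pow (abs_nonneg r), sq_abs]
  rw [h, h, h, h, ← ENNReal.ofReal_add (by positivity) (by positivity),
    ← ENNReal.ofReal_add (by positivity) (by positivity),
    show (3 : ENNReal) = ENNReal.ofReal 3 by simp, ← ENNReal.ofReal_mul (by norm_num)]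
  refine ENNReal.ofReal_le_ofReal ?_
  nlinarith [sq_nonneg (a - b), sq_nonneg (b - c), sq_nonneg (a - c)]

/-- The smooth estimate is applied to the averages `kernelAvg O κ δ v`, whose gradients are bounded
in `L²` uniformly in `δ`. Since `ε` is fixed and the left side does not involve `δ`, the
approximation errors disappear as `δ → 0`. -/
theorem lintegral_sub_sq_scaledKernel_le (hO : IsOpen O) (hconv : Convex ℝ O)
    (hb : Bornology.IsBounded O) (hf : IsTestFunction O f) (hκ : IsTestFunction O κ)
    (hκ1 : ∫ a, κ a = 1) {v : Eu n → ℝ} (hv : MemH O 1 v) :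
    ∃ C : ENNReal, C ≠ ⊤ ∧ ∀ ε : ℝ, 0 < ε → ε ≤ 1 / 2 →
      ∫⁻ x in O, ∫⁻ y in O, ‖v y - v x‖ₑ ^ 2 * ‖scaledKernel f ε x y‖ₑ
        ≤ C * ENNReal.ofReal ε ^ 2 := by
  have hA := (lintegral_enorm_lt_top hf).ne
  have hB := (lintegral_enorm_lt_top hκ).ne
  set A := ∫⁻ a, ‖f a‖ₑ
  set B := ∫⁻ a, ‖κ a‖ₑ
  set d := ENNReal.ofReal (Metric.diam O)
  set E := ∑ i, (2 ^ n * B) * eLpNorm (wderiv O i v) 2 (volume.restrict O)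
  have hE : E ≠ ⊤ := by
    refine ENNReal.sum_ne_top.2 fun i _ => ?_
    have := (hv.wderiv_spec i).1.2.ne
    finiteness
  refine ⟨3 * ((d ^ 2 * (2 ^ n * A)) * E ^ 2), by finiteness, fun ε hε hε' => ?_⟩
  have hbound : ∀ δ : ℝ, 0 < δ → δ ≤ 1 / 2 →
      ∑ i, eLpNorm (pderiv i (kernelAvg O κ δ v)) 2 (volume.restrict O) ≤ E := by
    intro δ hδ hδ'
    refine Finset.sum_le_sum fun i _ => ?_
    refine le_trans ?_ (eLpNorm_kernelAvg_le hκ.continuous hδ hδ' (hv.wderiv_spec i).1)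
    refine eLpNorm_mono_ae (ae_restrict_of_forall hO fun x hx => ?_)
    rw [pderiv_kernelAvg_of_hasWeakPDeriv hO hconv hb hκ hδ hδ' hv.1 (hv.wderiv_spec i).2 hx,
      norm_mul]
    refine mul_le_of_le_one_left (norm_nonneg _) ?_
    rw [Real.norm_of_nonneg (by linarith)]
    linarith
  have hlim := tendsto_kernelAvg hO hconv hb hκ hκ1 hv.1
  set N : ℝ → ENNReal := fun δ =>
    eLpNorm (fun x => kernelAvg O κ δ v x - v x) 2 (volume.restrict O)
  -- The difference `v y - v x` is passed through `r y` and `r x`, where `r` is the average; the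
  -- factor `3` comes from squaring three summands.
  have hkey : ∀ᶠ δ in 𝓝[>] (0 : ℝ),
      ∫⁻ x in O, ∫⁻ y in O, ‖v y - v x‖ₑ ^ 2 * ‖scaledKernel f ε x y‖ₑ
        ≤ 3 * ((2 ^ n * A) * N δ ^ 2 + (d ^ 2 * (2 ^ n * A)) * ENNReal.ofReal ε ^ 2 * E ^ 2
            + A * N δ ^ 2) := by
    filter_upwards [eventually_small] with δ hδ
    set r := kernelAvg O κ δ v
    have hr : ContDiff ℝ ∞ r := contDiff_kernelAvg hO.measurableSet hκ hδ.1 (hv.1.integrable hb)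
    have hrv : AEStronglyMeasurable (fun x => r x - v x) (volume.restrict O) :=
      hr.continuous.aestronglyMeasurable.sub hv.1.1
    have hm0 : AEMeasurable (fun x => ‖r x - v x‖ₑ ^ 2) (volume.restrict O) :=
      hrv.enorm.pow_const 2
    have hkm := aemeasurable_enorm_scaledKernel hf.continuous ε
      (μ := (volume.restrict O).prod (volume.restrict O))
    have hm1 : AEMeasurable (fun z : Eu n × Eu n => ‖r z.2 - v z.2‖ₑ ^ 2 *
        ‖scaledKernel f ε z.1 z.2‖ₑ) ((volume.restrict O).prod (volume.restrict O)) :=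
      hm0.comp_snd.mul hkm
    have hm2 : AEMeasurable (fun z : Eu n × Eu n => ‖r z.2 - r z.1‖ₑ ^ 2 *
        ‖scaledKernel f ε z.1 z.2‖ₑ) ((volume.restrict O).prod (volume.restrict O)) := by
      have := hr.continuous
      have h : Continuous fun z : Eu n × Eu n => r z.2 - r z.1 := by fun_prop
      exact (h.enorm.measurable.pow_const 2).aemeasurable.mul hkm
    have hm3 : AEMeasurable (fun z : Eu n × Eu n => ‖r z.1 - v z.1‖ₑ ^ 2 *
        ‖scaledKernel f ε z.1 z.2‖ₑ) ((volume.restrict O).prod (volume.restrict O)) :=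
      hm0.comp_fst.mul hkm
    have hvm : AEMeasurable (fun z : Eu n × Eu n => ‖v z.2 - v z.1‖ₑ ^ 2 *
        ‖scaledKernel f ε z.1 z.2‖ₑ) ((volume.restrict O).prod (volume.restrict O)) :=
      ((hv.1.1.comp_snd.sub hv.1.1.comp_fst).enorm.pow_const 2).mul hkm
    have hI1 := lintegral_lintegral_scaledKernel_le hf.continuous hε hε' hm0
    have hI2 := lintegral_sub_sq_scaledKernel_le_of_contDiff hO hconv hb hf hε hε' hr
    have hI3 : ∫⁻ x in O, ∫⁻ y in O, ‖r x - v x‖ₑ ^ 2 * ‖scaledKernel f ε x y‖ₑ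
        ≤ A * ∫⁻ x in O, ‖r x - v x‖ₑ ^ 2 := by
      rw [← lintegral_const_mul'' _ hm0]
      refine lintegral_mono fun x => ?_
      rw [lintegral_const_mul _ (measurable_enorm_scaledKernel hf.continuous ε x), mul_comm]
      gcongr
      exact (setLIntegral_le_lintegral _ _).trans_eq
        (lintegral_scaledKernel_right hf.continuous hε x)
    rw [← eLpNorm_two_sq] at hI1 hI3
    calc ∫⁻ x in O, ∫⁻ y in O, ‖v y - v x‖ₑ ^ 2 * ‖scaledKernel f ε x y‖ₑ
        = ∫⁻ z, ‖v z.2 - v z.1‖ₑ ^ 2 * ‖scaledKernel f ε z.1 z.2‖ₑ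
            ∂((volume.restrict O).prod (volume.restrict O)) := (lintegral_prod _ hvm).symm
      _ ≤ ∫⁻ z, 3 * (‖r z.2 - v z.2‖ₑ ^ 2 * ‖scaledKernel f ε z.1 z.2‖ₑ
            + ‖r z.2 - r z.1‖ₑ ^ 2 * ‖scaledKernel f ε z.1 z.2‖ₑ
            + ‖r z.1 - v z.1‖ₑ ^ 2 * ‖scaledKernel f ε z.1 z.2‖ₑ)
            ∂((volume.restrict O).prod (volume.restrict O)) := by
          refine lintegral_mono fun z => ?_
          have e : v z.2 - v z.1 = -(r z.2 - v z.2) + (r z.2 - r z.1) + (r z.1 - v z.1) := by ring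
          rw [← add_mul, ← add_mul, ← mul_assoc]
          gcongr
          rw [e]
          refine (enorm_add_three_sq_le _ _ _).trans_eq ?_
          rw [enorm_neg]
      _ = 3 * ((∫⁻ x in O, ∫⁻ y in O, ‖r y - v y‖ₑ ^ 2 * ‖scaledKernel f ε x y‖ₑ)
            + (∫⁻ x in O, ∫⁻ y in O, ‖r y - r x‖ₑ ^ 2 * ‖scaledKernel f ε x y‖ₑ)
            + ∫⁻ x in O, ∫⁻ y in O, ‖r x - v x‖ₑ ^ 2 * ‖scaledKernel f ε x y‖ₑ) := by
          rw [lintegral_const_mul'' _ ((hm1.fun_add hm2).fun_add hm3), lintegral_add_right' _ hm3,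
            lintegral_add_right' _ hm2, lintegral_prod _ hm1, lintegral_prod _ hm2,
            lintegral_prod _ hm3]
      _ ≤ _ := by
          gcongr
          refine hI2.trans ?_
          gcongr
          exact hbound δ hδ.1 hδ.2
  have hfin : Tendsto (fun δ => 3 * ((2 ^ n * A) * N δ ^ 2
      + (d ^ 2 * (2 ^ n * A)) * ENNReal.ofReal ε ^ 2 * E ^ 2 + A * N δ ^ 2)) (𝓝[>] (0 : ℝ))
      (𝓝 (3 * ((2 ^ n * A) * 0 ^ 2
      + (d ^ 2 * (2 ^ n * A)) * ENNReal.ofReal ε ^ 2 * E ^ 2 + A * 0 ^ 2))) := by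
    have h2 : Tendsto (fun δ => N δ ^ 2) (𝓝[>] (0 : ℝ)) (𝓝 (0 ^ 2)) := ENNReal.Tendsto.pow hlim
    refine ENNReal.Tendsto.const_mul ?_ (Or.inr (by norm_num))
    refine Tendsto.add (Tendsto.add ?_ tendsto_const_nhds) ?_
    · exact ENNReal.Tendsto.const_mul h2 (Or.inr (by finiteness))
    · exact ENNReal.Tendsto.const_mul h2 (Or.inr (by finiteness))
  refine (ge_of_tendsto hfin hkey).trans_eq ?_
  simp only [ne_eq, OfNat.ofNat_ne_zero, not_false_eq_true, zero_pow, mul_zero, zero_add, add_zero]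
  ring

end Translation

/-! ### Transport by a solenoidal `H¹` field -/

section Transport

variable {n : ℕ} {O : Set (Eu n)} {f κ : Eu n → ℝ} {ε : ℝ} {U : Eu n → Eu n}

/-- `U · ∇φ` for smooth `φ`. -/
noncomputable def dirDeriv (U : Eu n → Eu n) (φ : Eu n → ℝ) (x : Eu n) : ℝ :=
  ∑ i : Fin n, U x i * pderiv i φ x

/-- Cauchy–Schwarz on `O × O` with the kernel as weight: one factor is controlled by `q` in `L²`,
the other, of size `ε`, by the translation estimate for `v ∈ H¹`. This power of `ε` pays for the
`ε⁻¹` of the differentiated kernel. -/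
theorem lintegral_commutator_le (hO : IsOpen O) (hconv : Convex ℝ O)
    (hb : Bornology.IsBounded O) (hf : IsTestFunction O f) (hκ : IsTestFunction O κ)
    (hκ1 : ∫ a, κ a = 1) {v : Eu n → ℝ} (hv : MemH O 1 v) :
    ∃ C : ENNReal, C ≠ ⊤ ∧ ∀ ε : ℝ, 0 < ε → ε ≤ 1 / 2 → ∀ q : Eu n → ℝ, MemL2 O q →
      ∫⁻ x in O, ‖∫ y in O, q y * (v y - v x) * scaledKernel f ε x y‖ₑ
        ≤ C * ENNReal.ofReal ε * eLpNorm q 2 (volume.restrict O) := by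
  obtain ⟨C, hC, h⟩ := lintegral_sub_sq_scaledKernel_le hO hconv hb hf hκ hκ1 hv
  have hA := (lintegral_enorm_lt_top hf).ne
  set A := ∫⁻ a, ‖f a‖ₑ
  -- After squaring, the constant is the product `(2 ^ n * A) * C`; the sum is a convenient upper
  -- bound for its root.
  refine ⟨2 ^ n * A + C, by finiteness, fun ε hε hε' q hq => ?_⟩
  rw [← ENNReal.pow_le_pow_left_iff two_ne_zero, mul_pow, mul_pow, eLpNorm_two_sq]
  have hqm : AEMeasurable (fun x => ‖q x‖ₑ) (volume.restrict O) := hq.1.enorm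
  have hkm := aemeasurable_enorm_scaledKernel hf.continuous ε
      (μ := (volume.restrict O).prod (volume.restrict O))
  have hvm : AEMeasurable (fun z : Eu n × Eu n => ‖v z.2 - v z.1‖ₑ)
      ((volume.restrict O).prod (volume.restrict O)) :=
    (hv.1.1.comp_snd.sub hv.1.1.comp_fst).enorm
  have hm1 : AEMeasurable (fun z : Eu n × Eu n => ‖q z.2‖ₑ * ‖v z.2 - v z.1‖ₑ *
      ‖scaledKernel f ε z.1 z.2‖ₑ) ((volume.restrict O).prod (volume.restrict O)) :=
    (hqm.comp_snd.mul hvm).mul hkm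
  have hm2 : AEMeasurable (fun z : Eu n × Eu n => ‖q z.2‖ₑ ^ 2 *
      ‖scaledKernel f ε z.1 z.2‖ₑ) ((volume.restrict O).prod (volume.restrict O)) :=
    (hqm.comp_snd.pow_const 2).mul hkm
  have hm3 : AEMeasurable (fun z : Eu n × Eu n => ‖v z.2 - v z.1‖ₑ ^ 2 *
      ‖scaledKernel f ε z.1 z.2‖ₑ) ((volume.restrict O).prod (volume.restrict O)) :=
    (hvm.pow_const 2).mul hkm
  calc (∫⁻ x in O, ‖∫ y in O, q y * (v y - v x) * scaledKernel f ε x y‖ₑ) ^ 2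
      ≤ (∫⁻ x in O, ∫⁻ y in O, ‖q y‖ₑ * ‖v y - v x‖ₑ * ‖scaledKernel f ε x y‖ₑ) ^ 2 := by
        gcongr with x
        refine (enorm_integral_le_lintegral_enorm _).trans_eq ?_
        simp_rw [enorm_mul]
    _ = (∫⁻ z, ‖q z.2‖ₑ * ‖v z.2 - v z.1‖ₑ * ‖scaledKernel f ε z.1 z.2‖ₑ
            ∂((volume.restrict O).prod (volume.restrict O))) ^ 2 := by rw [lintegral_prod _ hm1]
    _ ≤ (∫⁻ x in O, ∫⁻ y in O, ‖q y‖ₑ ^ 2 * ‖scaledKernel f ε x y‖ₑ) *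
          ∫⁻ x in O, ∫⁻ y in O, ‖v y - v x‖ₑ ^ 2 * ‖scaledKernel f ε x y‖ₑ := by
        rw [← lintegral_prod _ hm2, ← lintegral_prod _ hm3]
        exact lintegral_mul_mul_sq_le hqm.comp_snd hvm hkm
    _ ≤ ((2 ^ n * A) * ∫⁻ y in O, ‖q y‖ₑ ^ 2) * (C * ENNReal.ofReal ε ^ 2) := by
        gcongr
        · exact lintegral_lintegral_scaledKernel_le hf.continuous hε hε' (hqm.pow_const 2)
        · exact h ε hε hε'
    _ = ((2 ^ n * A) * C) * ENNReal.ofReal ε ^ 2 * ∫⁻ y in O, ‖q y‖ₑ ^ 2 := by ring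
    _ ≤ _ := by
        gcongr
        rw [sq]
        gcongr
        · exact le_self_add
        · exact le_add_self

theorem HasTransport.sub (hO : IsOpen O) (hb : Bornology.IsBounded O)
    (hU : ∀ i, MemH O 1 fun x => U x i) {q r g h : Eu n → ℝ} (hq : MemL2 O q) (hr : MemL2 O r)
    (hg : MemL2 O g) (hh : MemL2 O h) (hqg : HasTransport O U q g) (hrh : HasTransport O U r h) :
    HasTransport O U (fun x => q x - r x) (fun x => g x - h x) := by
  intro φ hφ
  have hw : MemL2 O fun x => ∑ i : Fin n, U x i * pderiv i φ x + divg O U x * φ x := by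
    refine MemLp.add (memLp_finsetSum _ fun i _ =>
      (hU i).1.mul_continuous hO hb (hφ.pderiv i).continuous) ?_
    exact MemL2.mul_continuous hO hb (memLp_finsetSum _ fun i _ => ((hU i).wderiv_spec i).1)
      hφ.continuous
  simp_rw [sub_mul]
  rw [integral_sub (integrable_mul_continuous hO hb (hg.integrable hb) hφ.continuous)
      (integrable_mul_continuous hO hb (hh.integrable hb) hφ.continuous),
    integral_sub (hq.integrable_mul hw) (hr.integrable_mul hw), hqg φ hφ, hrh φ hφ]
  ring

/-- For smooth `q` the product `q φ` is a test function, admissible in the weak derivatives of the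
components of `U`. -/
theorem hasTransport_of_contDiff (hO : IsOpen O) (hb : Bornology.IsBounded O)
    (hU : ∀ i, MemH O 1 fun x => U x i) {q : Eu n → ℝ} (hq : ContDiff ℝ ∞ q) :
    HasTransport O U q (dirDeriv U q) := by
  intro φ hφ
  have hw : ∀ i, ∫ x in O, U x i * pderiv i (fun y => q y * φ y) x
      = -∫ x in O, wderiv O i (fun y => U y i) x * (q x * φ x) := fun i =>
    ((hU i).wderiv_spec i).2 _ (hφ.smooth_mul hq)
  have hd : ∀ i x, pderiv i (fun y => q y * φ y) x = q x * pderiv i φ x + φ x * pderiv i q x :=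
    fun i x => pderiv_mul (hq.differentiable (by simp) x) (hφ.differentiable x)
  have i1 : ∀ i, Integrable (fun x => U x i * pderiv i (fun y => q y * φ y) x)
      (volume.restrict O) := fun i => integrable_mul_continuous hO hb ((hU i).1.integrable hb)
        ((hφ.smooth_mul hq).pderiv i).continuous
  have i2 : ∀ i, Integrable (fun x => wderiv O i (fun y => U y i) x * (q x * φ x))
      (volume.restrict O) := fun i => integrable_mul_continuous hO hb
        (((hU i).wderiv_spec i).1.integrable hb) (hφ.smooth_mul hq).continuous
  have i3 : Integrable (fun x => dirDeriv U q x * φ x) (volume.restrict O) := by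
    refine integrable_mul_continuous hO hb (integrable_finsetSum _ fun i _ => ?_) hφ.continuous
    exact integrable_mul_continuous hO hb ((hU i).1.integrable hb) (hq.pderiv i).continuous
  have i4 : Integrable (fun x => q x * (∑ i : Fin n, U x i * pderiv i φ x + divg O U x * φ x))
      (volume.restrict O) := by
    simp_rw [mul_comm (q _)]
    refine integrable_mul_continuous hO hb (Integrable.add
      (integrable_finsetSum _ fun i _ => ?_) ?_) hq.continuous
    · exact integrable_mul_continuous hO hb ((hU i).1.integrable hb) (hφ.pderiv i).continuous
    · exact integrable_mul_continuous hO hb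
        (integrable_finsetSum _ fun i _ => ((hU i).wderiv_spec i).1.integrable hb) hφ.continuous
  have h0 : ∫ x in O, ((∑ i, U x i * pderiv i (fun y => q y * φ y) x)
      + ∑ i, wderiv O i (fun y => U y i) x * (q x * φ x)) = 0 := by
    rw [integral_add (integrable_finsetSum _ fun i _ => i1 i)
      (integrable_finsetSum _ fun i _ => i2 i), integral_finsetSum _ fun i _ => i1 i,
      integral_finsetSum _ fun i _ => i2 i, ← Finset.sum_add_distrib]
    refine Finset.sum_eq_zero fun i _ => ?_
    rw [hw i]; ring
  rw [eq_neg_iff_add_eq_zero, ← integral_add i3 i4, ← h0]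
  congr 1
  ext x
  simp only [dirDeriv, divg, hd, Finset.sum_mul, Finset.mul_sum, mul_add, Finset.sum_add_distrib]
  have e : ∀ a b c d : ℝ, a = c → b = d → a + b = c + d := fun _ _ _ _ h1 h2 => by rw [h1, h2]
  rw [← add_assoc]
  refine e _ _ _ _ ?_ ?_
  · rw [add_comm]
    refine e _ _ _ _ ?_ ?_ <;> refine Finset.sum_congr rfl fun i _ => ?_ <;> ring
  · refine Finset.sum_congr rfl fun i _ => ?_
    ring

/-- The commutator of averaging and `U·∇`. The transport equation tested with the kernel puts `U y`
in front of the kernel's gradient, differentiation of the average puts `U x` there, and `div U = 0`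
removes the zero order term. -/
theorem dirDeriv_kernelAvg_sub (hO : IsOpen O) (hconv : Convex ℝ O) (hb : Bornology.IsBounded O)
    (hκ : IsTestFunction O κ) (hU : ∀ i, MemH O 1 fun x => U x i)
    (hdiv : ∀ᵐ x ∂(volume.restrict O), divg O U x = 0) (hε : 0 < ε) (hε' : ε ≤ 1 / 2)
    {q g : Eu n → ℝ} (hq : MemL2 O q) (hqg : HasTransport O U q g) {x : Eu n} (hx : x ∈ O) :
    dirDeriv U (kernelAvg O κ ε q) x - (1 - ε) * kernelAvg O κ ε g x
      = ((1 - ε) * ε⁻¹) * ∑ i, ∫ y in O, q y * (U y i - U x i) * scaledKernel (pderiv i κ) ε x y := by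
  have hc : ∀ i, Continuous fun y => scaledKernel (pderiv i κ) ε x y := fun i =>
    (continuous_scaledKernel (hκ.pderiv i).continuous ε).comp
      (by fun_prop : Continuous fun y => (x, y))
  have i1 : ∀ i, Integrable (fun y => q y * U y i * scaledKernel (pderiv i κ) ε x y)
      (volume.restrict O) := fun i => integrable_mul_continuous hO hb (hq.integrable_mul (hU i).1)
        (hc i)
  have i2 : ∀ i, Integrable (fun y => q y * scaledKernel (pderiv i κ) ε x y)
      (volume.restrict O) := fun i => integrable_mul_continuous hO hb (hq.integrable hb) (hc i)
  have h1 : kernelAvg O κ ε g x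
      = -(ε⁻¹ * ∑ i, ∫ y in O, q y * U y i * scaledKernel (pderiv i κ) ε x y) := by
    rw [kernelAvg, hqg _ (isTestFunction_scaledKernel hconv hκ hε hε' hx), ← integral_finsetSum _
      (fun i _ => i1 i), ← integral_const_mul]
    congr 1
    refine integral_congr_ae ?_
    filter_upwards [hdiv] with y hy
    rw [hy, zero_mul, add_zero, Finset.mul_sum, Finset.mul_sum]
    refine Finset.sum_congr rfl fun i _ => ?_
    rw [pderiv_scaledKernel hκ.differentiable]
    ring
  have h2 : dirDeriv U (kernelAvg O κ ε q) x = -((1 - ε) * ε⁻¹) *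
      ∑ i, U x i * ∫ y in O, q y * scaledKernel (pderiv i κ) ε x y := by
    rw [dirDeriv, Finset.mul_sum]
    refine Finset.sum_congr rfl fun i _ => ?_
    rw [pderiv_kernelAvg hO.measurableSet hκ hε (hq.integrable hb), kernelAvg]
    ring
  have h3 : ∀ i, ∫ y in O, q y * (U y i - U x i) * scaledKernel (pderiv i κ) ε x y
      = (∫ y in O, q y * U y i * scaledKernel (pderiv i κ) ε x y)
        - U x i * ∫ y in O, q y * scaledKernel (pderiv i κ) ε x y := fun i => by
    rw [← integral_const_mul, ← integral_sub (i1 i) ((i2 i).const_mul _)]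
    congr 1
    ext y
    ring
  simp_rw [h3]
  rw [h1, h2, Finset.sum_sub_distrib]
  ring

/-- The factor `ε⁻¹` of the commutator cancels the `ε` of `lintegral_commutator_le`. The bound is
uniform in `ε` and involves `q` only, so that density arguments apply without controlling `g`. -/
theorem exists_eLpNorm_dirDeriv_kernelAvg_sub_le (hO : IsOpen O) (hconv : Convex ℝ O)
    (hb : Bornology.IsBounded O) (hκ : IsTestFunction O κ) (hκ1 : ∫ a, κ a = 1)
    (hU : ∀ i, MemH O 1 fun x => U x i) (hdiv : ∀ᵐ x ∂(volume.restrict O), divg O U x = 0) :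
    ∃ C : ENNReal, C ≠ ⊤ ∧ ∀ ε : ℝ, 0 < ε → ε ≤ 1 / 2 → ∀ q g : Eu n → ℝ, MemL2 O q →
      HasTransport O U q g →
      eLpNorm (fun x => dirDeriv U (kernelAvg O κ ε q) x - (1 - ε) * kernelAvg O κ ε g x) 1
        (volume.restrict O) ≤ C * eLpNorm q 2 (volume.restrict O) := by
  choose C hC h using fun i => lintegral_commutator_le hO hconv hb (hκ.pderiv i) hκ hκ1 (hU i)
  refine ⟨∑ i, C i, ENNReal.sum_ne_top.2 fun i _ => hC i, fun ε hε hε' q g hq hqg => ?_⟩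
  rw [eLpNorm_one_eq_lintegral_enorm]
  have hm : ∀ i, AEMeasurable (fun x =>
      ‖∫ y in O, q y * (U y i - U x i) * scaledKernel (pderiv i κ) ε x y‖ₑ)
      (volume.restrict O) := fun i => by
    refine AEStronglyMeasurable.enorm ?_
    refine AEStronglyMeasurable.integral_prod_right' (μ := volume.restrict O)
      (ν := volume.restrict O) (f := fun z : Eu n × Eu n => q z.2 * (U z.2 i - U z.1 i) *
      scaledKernel (pderiv i κ) ε z.1 z.2) ?_
    exact (hq.1.comp_snd.mul ((hU i).1.1.comp_snd.sub (hU i).1.1.comp_fst)).mul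
      (continuous_scaledKernel (hκ.pderiv i).continuous ε).aestronglyMeasurable
  have h1 : 0 ≤ (1 - ε) * ε⁻¹ := mul_nonneg (by linarith) (by positivity)
  calc _ ≤ ∫⁻ x in O, ENNReal.ofReal ε⁻¹ * ∑ i,
        ‖∫ y in O, q y * (U y i - U x i) * scaledKernel (pderiv i κ) ε x y‖ₑ := by
        refine setLIntegral_mono' hO.measurableSet fun x hx => ?_
        rw [dirDeriv_kernelAvg_sub hO hconv hb hκ hU hdiv hε hε' hq hqg hx, enorm_mul,
          Real.enorm_of_nonneg h1]
        gcongr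
        · nlinarith [inv_pos.2 hε]
        · exact enorm_sum_le _ _
    _ = ENNReal.ofReal ε⁻¹ * ∑ i, ∫⁻ x in O,
        ‖∫ y in O, q y * (U y i - U x i) * scaledKernel (pderiv i κ) ε x y‖ₑ := by
        rw [lintegral_const_mul'' _ (Finset.aemeasurable_fun_sum _ fun i _ => hm i),
          lintegral_finsetSum' _ fun i _ => hm i]
    _ ≤ ENNReal.ofReal ε⁻¹ * ∑ i, C i * ENNReal.ofReal ε * eLpNorm q 2 (volume.restrict O) := by
        gcongr with i
        exact h i ε hε hε' q hq
    _ = (ENNReal.ofReal ε⁻¹ * ENNReal.ofReal ε) *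
          ((∑ i, C i) * eLpNorm q 2 (volume.restrict O)) := by
        rw [← Finset.sum_mul, ← Finset.sum_mul]; ring
    _ = _ := by
        rw [← ENNReal.ofReal_mul (by positivity), inv_mul_cancel₀ hε.ne']; simp

theorem tendsto_one_sub_mul_kernelAvg (hO : IsOpen O) (hconv : Convex ℝ O)
    (hb : Bornology.IsBounded O) (hκ : IsTestFunction O κ) (hκ1 : ∫ a, κ a = 1)
    {q : Eu n → ℝ} (hq : MemL2 O q) :
    Tendsto (fun ε => eLpNorm (fun x => (1 - ε) * kernelAvg O κ ε q x - q x) 2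
      (volume.restrict O)) (𝓝[>] 0) (𝓝 0) := by
  have h1 := tendsto_kernelAvg hO hconv hb hκ hκ1 hq
  have h2 : Tendsto (fun ε : ℝ => ENNReal.ofReal ε * eLpNorm q 2 (volume.restrict O))
      (𝓝[>] 0) (𝓝 0) := by
    have : Tendsto (fun ε : ℝ => ENNReal.ofReal ε * eLpNorm q 2 (volume.restrict O)) (𝓝 0)
        (𝓝 (ENNReal.ofReal 0 * eLpNorm q 2 (volume.restrict O))) :=
      ENNReal.Tendsto.mul_const (ENNReal.continuous_ofReal.tendsto 0) (Or.inr hq.2.ne)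
    simpa using this.mono_left nhdsWithin_le_nhds
  refine tendsto_of_tendsto_of_tendsto_of_le_of_le' tendsto_const_nhds (by simpa using h1.add h2)
    (Eventually.of_forall fun _ => zero_le) ?_
  filter_upwards [eventually_small] with ε hε
  have hm := memL2_kernelAvg hO hb hκ hε.1 hq
  have m1 : AEStronglyMeasurable (fun x => (1 - ε) * (kernelAvg O κ ε q x - q x))
      (volume.restrict O) := (hm.1.sub hq.1).const_mul _
  have m2 : AEStronglyMeasurable (fun x => ε * q x) (volume.restrict O) := hq.1.const_mul _
  have e : (fun x => (1 - ε) * kernelAvg O κ ε q x - q x)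
      = (fun x => (1 - ε) * (kernelAvg O κ ε q x - q x)) - fun x => ε * q x := by
    ext x; simp only [Pi.sub_apply]; ring
  rw [e]
  refine (eLpNorm_sub_le m1 m2 one_le_two).trans ?_
  gcongr
  · refine eLpNorm_mono fun x => ?_
    rw [norm_mul]
    refine mul_le_of_le_one_left (norm_nonneg _) ?_
    rw [Real.norm_of_nonneg (by linarith)]
    linarith
  · refine eLpNorm_le_mul_eLpNorm_of_ae_le_mul (Eventually.of_forall fun x => ?_) 2
    rw [norm_mul, Real.norm_of_nonneg hε.1.le]

theorem eLpNorm_one_mul_le {f g : Eu n → ℝ} (hf : MemL2 O f) (hg : MemL2 O g) :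
    eLpNorm (fun x => f x * g x) 1 (volume.restrict O)
      ≤ eLpNorm f 2 (volume.restrict O) * eLpNorm g 2 (volume.restrict O) := by
  have := eLpNorm_le_eLpNorm_mul_eLpNorm_of_nnnorm (p := 2) (q := 2) (r := 1) hf.1 hg.1
    (fun a b : ℝ => a * b) 1 (Eventually.of_forall fun x => by simp)
  simpa using this

theorem tendsto_dirDeriv_kernelAvg_of_memH (hO : IsOpen O) (hconv : Convex ℝ O)
    (hb : Bornology.IsBounded O) (hκ : IsTestFunction O κ) (hκ1 : ∫ a, κ a = 1)
    (hU : ∀ i, MemL2 O fun x => U x i) {q : Eu n → ℝ} (hq : MemH O 1 q) :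
    Tendsto (fun ε => eLpNorm (fun x => dirDeriv U (kernelAvg O κ ε q) x
      - ∑ i, U x i * wderiv O i q x) 1 (volume.restrict O)) (𝓝[>] 0) (𝓝 0) := by
  have h1 : ∀ i, Tendsto (fun ε => eLpNorm (fun x => U x i) 2 (volume.restrict O) *
      eLpNorm (fun x => (1 - ε) * kernelAvg O κ ε (wderiv O i q) x - wderiv O i q x) 2
      (volume.restrict O)) (𝓝[>] 0) (𝓝 0) := fun i => by
    have := ENNReal.Tendsto.const_mul (a := eLpNorm (fun x => U x i) 2 (volume.restrict O))
      (tendsto_one_sub_mul_kernelAvg hO hconv hb hκ hκ1 (hq.wderiv_spec i).1)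
      (Or.inr (hU i).2.ne)
    simpa using this
  have h2 := tendsto_finsetSum Finset.univ fun i _ => h1 i
  refine tendsto_of_tendsto_of_tendsto_of_le_of_le' tendsto_const_nhds (by simpa using h2)
    (Eventually.of_forall fun _ => zero_le) ?_
  filter_upwards [eventually_small] with ε hε
  have hm : ∀ i, MemL2 O fun x => (1 - ε) * kernelAvg O κ ε (wderiv O i q) x - wderiv O i q x :=
    fun i => MemLp.sub ((memL2_kernelAvg hO hb hκ hε.1 (hq.wderiv_spec i).1).const_mul _)
      (hq.wderiv_spec i).1
  have e : (fun x => dirDeriv U (kernelAvg O κ ε q) x - ∑ i, U x i * wderiv O i q x)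
      =ᵐ[volume.restrict O] ∑ i, fun x => U x i *
        ((1 - ε) * kernelAvg O κ ε (wderiv O i q) x - wderiv O i q x) := by
    filter_upwards [ae_restrict_mem hO.measurableSet] with x hx
    rw [dirDeriv, ← Finset.sum_sub_distrib, Finset.sum_apply]
    refine Finset.sum_congr rfl fun i _ => ?_
    rw [pderiv_kernelAvg_of_hasWeakPDeriv hO hconv hb hκ hε.1 hε.2 hq.1 (hq.wderiv_spec i).2 hx]
    ring
  rw [eLpNorm_congr_ae e]
  refine (eLpNorm_sum_le (fun i _ => ((hU i).1.mul (hm i).1)) le_rfl).trans ?_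
  exact Finset.sum_le_sum fun i _ => eLpNorm_one_mul_le (hU i) (hm i)

theorem memL2_dirDeriv_of_contDiff (hO : IsOpen O) (hb : Bornology.IsBounded O)
    (hU : ∀ i, MemL2 O fun x => U x i) {q : Eu n → ℝ} (hq : ContDiff ℝ ∞ q) :
    MemL2 O (dirDeriv U q) :=
  memLp_finsetSum _ fun i _ => (hU i).mul_continuous hO hb (hq.pderiv i).continuous

theorem tendsto_eLpNorm_one_of_two (hb : Bornology.IsBounded O) {F : ℝ → Eu n → ℝ}
    (hF : ∀ᶠ ε in 𝓝[>] (0 : ℝ), AEStronglyMeasurable (F ε) (volume.restrict O))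
    (h : Tendsto (fun ε => eLpNorm (F ε) 2 (volume.restrict O)) (𝓝[>] 0) (𝓝 0)) :
    Tendsto (fun ε => eLpNorm (F ε) 1 (volume.restrict O)) (𝓝[>] 0) (𝓝 0) := by
  have := isFiniteMeasure_restrict hb
  set c := (volume.restrict O) Set.univ ^ (1 / (1 : ENNReal).toReal - 1 / (2 : ENNReal).toReal)
  have h2 := ENNReal.Tendsto.mul_const (b := c) h (Or.inr
    (ENNReal.rpow_ne_top_of_nonneg (by norm_num) (by finiteness)))
  refine tendsto_of_tendsto_of_tendsto_of_le_of_le' tendsto_const_nhds (by simpa using h2)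
    (Eventually.of_forall fun _ => zero_le) ?_
  filter_upwards [hF] with ε hε
  exact eLpNorm_le_eLpNorm_mul_rpow_measure_univ one_le_two hε

/-- Friedrichs' lemma up to the boundary: averages of `q` approximate `q` in the graph norm of
`U · ∇`. -/
theorem tendsto_dirDeriv_kernelAvg_of_hasTransport (hO : IsOpen O) (hconv : Convex ℝ O)
    (hb : Bornology.IsBounded O) (hκ : IsTestFunction O κ) (hκ1 : ∫ a, κ a = 1)
    (hU : ∀ i, MemH O 1 fun x => U x i) (hdiv : ∀ᵐ x ∂(volume.restrict O), divg O U x = 0)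
    {q g : Eu n → ℝ} (hq : MemL2 O q) (hg : MemL2 O g) (hqg : HasTransport O U q g) :
    Tendsto (fun ε => eLpNorm (fun x => dirDeriv U (kernelAvg O κ ε q) x - g x) 1
      (volume.restrict O)) (𝓝[>] 0) (𝓝 0) := by
  obtain ⟨C, hC, hbd⟩ := exists_eLpNorm_dirDeriv_kernelAvg_sub_le hO hconv hb hκ hκ1 hU hdiv
  refine tendsto_zero_of_forall_approx hC fun η hη => ?_
  -- The approximation is in `L²` alone; nothing is claimed about the distance between `U·∇r` and
  -- `g`.
  obtain ⟨r, -, hr, hqr⟩ := hq.exist_eLpNorm_sub_le (by norm_num) one_le_two hη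
  have hr2 : MemL2 O r := memL2_of_continuous hO hb hr.continuous
  set s := dirDeriv U r with hs
  have hs2 : MemL2 O s := memL2_dirDeriv_of_contDiff hO hb (fun i => (hU i).1) hr
  have hrs : HasTransport O U r s := hasTransport_of_contDiff hO hb hU hr
  have hsub := hqg.sub hO hb hU hq hr2 hg hs2 hrs
  have hqr2 : MemL2 O fun x => q x - r x := MemLp.sub hq hr2
  have hA : ∀ {k : Eu n → ℝ}, MemL2 O k → ∀ᶠ ε in 𝓝[>] (0 : ℝ),
      AEStronglyMeasurable (fun x => (1 - ε) * kernelAvg O κ ε k x - k x) (volume.restrict O) :=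
    fun {k} hk => by
      filter_upwards [eventually_small] with ε hε
      exact ((memL2_kernelAvg hO hb hκ hε.1 hk).1.const_mul _).sub hk.1
  have t1 := tendsto_dirDeriv_kernelAvg_of_memH hO hconv hb hκ hκ1 (fun i => (hU i).1)
    (memH_of_contDiff hO hb 1 hr)
  have t2 := tendsto_eLpNorm_one_of_two hb (hA hs2)
    (tendsto_one_sub_mul_kernelAvg hO hconv hb hκ hκ1 hs2)
  have t3 := tendsto_eLpNorm_one_of_two hb (hA hg)
    (tendsto_one_sub_mul_kernelAvg hO hconv hb hκ hκ1 hg)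
  refine ⟨_, by simpa using (t1.add t2).add t3, ?_⟩
  filter_upwards [eventually_small, hA hs2, hA hg] with ε hε m2 m3
  have hsw : s =ᵐ[volume.restrict O] fun x => ∑ i, U x i * wderiv O i r x := by
    have : ∀ᵐ x ∂(volume.restrict O), ∀ i, wderiv O i r x = pderiv i r x :=
      ae_all_iff.2 fun i => wderiv_smooth hO hb hr i
    filter_upwards [this] with x hx
    simp only [hs, dirDeriv, hx]
  have mU : ∀ {k : Eu n → ℝ}, MemL2 O k → MemL2 O (dirDeriv U (kernelAvg O κ ε k)) := fun hk =>
    memL2_dirDeriv_of_contDiff hO hb (fun i => (hU i).1)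
      (contDiff_kernelAvg hO.measurableSet hκ hε.1 (hk.integrable hb))
  have hdd : ∀ x, dirDeriv U (kernelAvg O κ ε fun y => q y - r y) x
      = dirDeriv U (kernelAvg O κ ε q) x - dirDeriv U (kernelAvg O κ ε r) x := fun x => by
    have e : (kernelAvg O κ ε fun y => q y - r y)
        = fun x => kernelAvg O κ ε q x - kernelAvg O κ ε r x := funext fun x =>
      kernelAvg_sub hO hb hκ.continuous (hq.integrable hb) (hr2.integrable hb) x
    have d1 := (contDiff_kernelAvg hO.measurableSet hκ hε.1 (hq.integrable hb)).differentiable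
      (by simp)
    have d2 := (contDiff_kernelAvg hO.measurableSet hκ hε.1 (hr2.integrable hb)).differentiable
      (by simp)
    simp only [dirDeriv, e]
    rw [← Finset.sum_sub_distrib]
    refine Finset.sum_congr rfl fun i _ => ?_
    rw [pderiv_sub (d1 x) (d2 x)]
    ring
  have hks : ∀ x, kernelAvg O κ ε (fun y => g y - s y) x
      = kernelAvg O κ ε g x - kernelAvg O κ ε s x := fun x =>
    kernelAvg_sub hO hb hκ.continuous (hg.integrable hb) (hs2.integrable hb) x
  -- `F1` is the commutator of `q - r`, small by the uniform bound. The other three tend to zero: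
  -- `F2` because `r` is smooth, `F3` and `F4` because averages of `L²` functions converge.
  set F1 : Eu n → ℝ := fun x => dirDeriv U (kernelAvg O κ ε fun y => q y - r y) x
    - (1 - ε) * kernelAvg O κ ε (fun y => g y - s y) x
  set F2 : Eu n → ℝ := fun x => dirDeriv U (kernelAvg O κ ε r) x - ∑ i, U x i * wderiv O i r x
  set F3 : Eu n → ℝ := fun x => (1 - ε) * kernelAvg O κ ε s x - s x
  set F4 : Eu n → ℝ := fun x => (1 - ε) * kernelAvg O κ ε g x - g x
  have e : (fun x => dirDeriv U (kernelAvg O κ ε q) x - g x) =ᵐ[volume.restrict O]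
      F1 + (F2 - F3 + F4) := by
    filter_upwards [hsw] with x hx
    simp only [F1, F2, F3, F4, Pi.add_apply, Pi.sub_apply, hdd, hks, ← hx]
    ring
  have m1 : AEStronglyMeasurable F1 (volume.restrict O) :=
    (mU hqr2).1.sub ((memL2_kernelAvg hO hb hκ hε.1 (hg.sub hs2)).1.const_mul _)
  have mF2 : AEStronglyMeasurable F2 (volume.restrict O) :=
    (mU hr2).1.sub (hs2.1.congr hsw)
  rw [eLpNorm_congr_ae e]
  refine (eLpNorm_add_le m1 ((mF2.sub m2).add m3) le_rfl).trans ?_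
  gcongr
  · exact (hbd ε hε.1 hε.2 _ _ hqr2 hsub).trans (by gcongr; exact hqr)
  · refine (eLpNorm_add_le (mF2.sub m2) m3 le_rfl).trans ?_
    gcongr
    exact eLpNorm_sub_le mF2 m2 le_rfl

end Transport

/-! ### Flux and energy identities for transport. -/

section Energy

variable {n : ℕ} {O : Set (Eu n)} {κ : Eu n → ℝ} {U : Eu n → Eu n}

theorem tendsto_one_div_nhdsGT :
    Tendsto (fun m : ℕ => 1 / ((m : ℝ) + 1)) atTop (𝓝[>] 0) :=
  tendsto_nhdsWithin_iff.2 ⟨tendsto_one_div_add_atTop_nhds_zero_nat,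
    Eventually.of_forall fun m => by simp only [Set.mem_Ioi]; positivity⟩

/-- The averages are smooth on the whole space, so their flux vanishes exactly, and integrals pass
to the limit in `L¹`. -/
theorem setIntegral_eq_zero_of_tendsto_dirDeriv (hO : IsOpen O) (hb : Bornology.IsBounded O)
    (hκ : IsTestFunction O κ) (hU : ∀ i, MemL2 O fun x => U x i)
    (hflux : ∀ φ : Eu n → ℝ, ContDiff ℝ ∞ φ → ∫ x in O, dirDeriv U φ x = 0)
    {q g : Eu n → ℝ} (hq : MemL2 O q) (hg : Integrable g (volume.restrict O))
    (h : Tendsto (fun ε => eLpNorm (fun x => dirDeriv U (kernelAvg O κ ε q) x - g x) 1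
      (volume.restrict O)) (𝓝[>] 0) (𝓝 0)) : ∫ x in O, g x = 0 := by
  have hs : ∀ᶠ ε : ℝ in 𝓝[>] 0, ContDiff ℝ ∞ (kernelAvg O κ ε q) := by
    filter_upwards [eventually_small] with ε hε
    exact contDiff_kernelAvg hO.measurableSet hκ hε.1 (hq.integrable hb)
  have h1 := tendsto_integral_of_L1' (μ := volume.restrict O)
    (F := fun ε => dirDeriv U (kernelAvg O κ ε q)) (l := 𝓝[>] (0 : ℝ)) g hg.1 (by
      filter_upwards [hs] with ε hε
      exact (memL2_dirDeriv_of_contDiff hO hb hU hε).integrable hb) h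
  refine tendsto_nhds_unique h1 (tendsto_const_nhds.congr' ?_)
  filter_upwards [hs] with ε hε
  exact (hflux _ hε).symm

section Regularization

variable {ι : Type*} [Fintype ι]

/-- The partial derivatives of `s ↦ δ⁻¹ √(1 + δ |s|²)`. -/
noncomputable def truncation (δ : ℝ) (j : ι) (s : ι → ℝ) : ℝ :=
  s j / √(1 + δ * ∑ k, s k ^ 2)

theorem one_add_mul_sum_sq_pos {δ : ℝ} (hδ : 0 < δ) (s : ι → ℝ) : 0 < 1 + δ * ∑ k, s k ^ 2 := by
  have : 0 ≤ ∑ k, s k ^ 2 := Finset.sum_nonneg fun k _ => sq_nonneg _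
  positivity

/-- Boundedness is the purpose of the regularized energy: it lets the factor multiply sequences that
converge only in `L¹`. -/
theorem abs_truncation_le {δ : ℝ} (hδ : 0 < δ) (j : ι) (s : ι → ℝ) :
    |truncation δ j s| ≤ 1 / √δ := by
  have h := one_add_mul_sum_sq_pos hδ s
  rw [truncation, abs_div, abs_of_nonneg (Real.sqrt_nonneg _), div_le_div_iff₀ (by positivity)
    (by positivity), one_mul, ← Real.sqrt_sq_eq_abs, ← Real.sqrt_mul (sq_nonneg _)]
  refine Real.sqrt_le_sqrt ?_
  have : s j ^ 2 ≤ ∑ k, s k ^ 2 :=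
    Finset.single_le_sum (f := fun k => s k ^ 2) (fun k _ => sq_nonneg _) (Finset.mem_univ j)
  nlinarith

theorem continuous_truncation {δ : ℝ} (hδ : 0 < δ) (j : ι) :
    Continuous (truncation δ j : (ι → ℝ) → ℝ) := by
  unfold truncation
  refine Continuous.div (by fun_prop) (by fun_prop) fun s => ?_
  exact (Real.sqrt_pos.2 (one_add_mul_sum_sq_pos hδ s)).ne'

theorem contDiff_regularizedNorm {δ : ℝ} (hδ : 0 < δ) {r : ι → Eu n → ℝ}
    (hr : ∀ j, ContDiff ℝ ∞ (r j)) :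
    ContDiff ℝ ∞ fun x => δ⁻¹ * √(1 + δ * ∑ k, r k x ^ 2) := by
  refine contDiff_const.mul (ContDiff.sqrt ?_ fun x =>
    (one_add_mul_sum_sq_pos hδ fun k => r k x).ne')
  exact contDiff_const.add (contDiff_const.mul (ContDiff.sum fun k _ => (hr k).pow 2))

theorem dirDeriv_regularizedNorm {δ : ℝ} (hδ : 0 < δ) {r : ι → Eu n → ℝ}
    (hr : ∀ j, ContDiff ℝ ∞ (r j)) (x : Eu n) :
    dirDeriv U (fun x => δ⁻¹ * √(1 + δ * ∑ k, r k x ^ 2)) x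
      = ∑ j, truncation δ j (fun k => r k x) * dirDeriv U (r j) x := by
  have hpos := one_add_mul_sum_sq_pos hδ fun k => r k x
  have hd : ∀ j, HasFDerivAt (r j) (fderiv ℝ (r j) x) x := fun j =>
    ((hr j).differentiable (by simp) x).hasFDerivAt
  have h1 : HasFDerivAt (fun x => ∑ k, r k x ^ 2)
      (∑ k, (2 * r k x) • fderiv ℝ (r k) x) x := by
    refine HasFDerivAt.fun_sum fun k _ => ?_
    simpa using (hd k).pow 2
  have h2 := (((h1.const_mul δ).const_add 1).sqrt hpos.ne').const_mul δ⁻¹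
  have h3 : ∀ i, pderiv i (fun x => δ⁻¹ * √(1 + δ * ∑ k, r k x ^ 2)) x
      = ∑ j, truncation δ j (fun k => r k x) * pderiv i (r j) x := by
    intro i
    have hR := Real.sqrt_pos.2 hpos
    rw [pderiv, h2.fderiv]
    simp only [truncation, pderiv]
    generalize √(1 + δ * ∑ k, r k x ^ 2) = R at hR
    simp only [_root_.smul_apply, _root_.sum_apply, smul_eq_mul, Finset.mul_sum]
    refine Finset.sum_congr rfl fun j _ => ?_
    field_simp
  simp only [dirDeriv, h3]
  simp only [Finset.mul_sum]
  rw [Finset.sum_comm]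
  refine Finset.sum_congr rfl fun j _ => Finset.sum_congr rfl fun i _ => ?_
  ring

/-- One sequence serves all components: a subsequence is extracted from the sum of the absolute
errors. -/
theorem exists_seq_tendsto_ae_kernelAvg (hO : IsOpen O) (hconv : Convex ℝ O)
    (hb : Bornology.IsBounded O) (hκ : IsTestFunction O κ) (hκ1 : ∫ a, κ a = 1)
    {q : ι → Eu n → ℝ} (hq : ∀ j, MemL2 O (q j)) :
    ∃ ε : ℕ → ℝ, Tendsto ε atTop (𝓝[>] 0) ∧ ∀ᵐ x ∂(volume.restrict O), ∀ j,
      Tendsto (fun m => kernelAvg O κ (ε m) (q j) x) atTop (𝓝 (q j x)) := by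
  set e : ℕ → ℝ := fun m => 1 / ((m : ℝ) + 1)
  have hpos : ∀ m, 0 < e m := fun m => by positivity
  set S : ℕ → Eu n → ℝ := fun m x => ∑ j, ‖kernelAvg O κ (e m) (q j) x - q j x‖
  have hmeas : ∀ m j, AEStronglyMeasurable (fun x => kernelAvg O κ (e m) (q j) x - q j x)
      (volume.restrict O) := fun m j =>
    (memL2_kernelAvg hO hb hκ (hpos m) (hq j)).1.sub (hq j).1
  have hS : Tendsto (fun m => eLpNorm (S m - 0) 2 (volume.restrict O)) atTop (𝓝 0) := by
    have h := tendsto_finsetSum Finset.univ fun j _ =>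
      (tendsto_kernelAvg hO hconv hb hκ hκ1 (hq j)).comp tendsto_one_div_nhdsGT
    rw [Finset.sum_const_zero] at h
    refine tendsto_of_tendsto_of_tendsto_of_le_of_le tendsto_const_nhds h
      (fun _ => zero_le) fun m => ?_
    have e1 : S m - 0 = ∑ j, fun x => ‖kernelAvg O κ (e m) (q j) x - q j x‖ := by
      ext x; simp [S]
    rw [e1]
    refine (eLpNorm_sum_le (fun j _ => (hmeas m j).norm) one_le_two).trans_eq ?_
    simp_rw [eLpNorm_norm]
    rfl
  have hm := tendstoInMeasure_of_tendsto_eLpNorm (p := 2) (by norm_num) (f := S) (g := 0)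
    (fun m => Finset.aestronglyMeasurable_fun_sum _ fun j _ => (hmeas m j).norm)
    aestronglyMeasurable_zero hS
  obtain ⟨ns, hns, hae⟩ := hm.exists_seq_tendsto_ae
  refine ⟨fun m => e (ns m), tendsto_one_div_nhdsGT.comp hns.tendsto_atTop, ?_⟩
  filter_upwards [hae] with x hx j
  rw [tendsto_iff_norm_sub_tendsto_zero]
  refine squeeze_zero (fun _ => norm_nonneg _) (fun m => ?_) hx
  exact Finset.single_le_sum (f := fun j => ‖kernelAvg O κ (e (ns m)) (q j) x - q j x‖)
    (fun k _ => norm_nonneg _) (Finset.mem_univ j)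

/-- For the averages `r` of `q`, the chain rule turns the truncated sum of the `U·∇ r j` into `U·∇`
of one smooth function, with zero flux. Bounded factors converging almost everywhere, together with
derivatives converging in `L¹`, allow the limit. -/
theorem setIntegral_truncation_mul_eq_zero (hO : IsOpen O) (hconv : Convex ℝ O)
    (hb : Bornology.IsBounded O) (hκ : IsTestFunction O κ) (hκ1 : ∫ a, κ a = 1)
    (hU : ∀ i, MemL2 O fun x => U x i)
    (hflux : ∀ φ : Eu n → ℝ, ContDiff ℝ ∞ φ → ∫ x in O, dirDeriv U φ x = 0)
    {q g : ι → Eu n → ℝ} (hq : ∀ j, MemL2 O (q j))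
    (hg : ∀ j, Integrable (g j) (volume.restrict O))
    (h : ∀ j, Tendsto (fun ε => eLpNorm (fun x => dirDeriv U (kernelAvg O κ ε (q j)) x - g j x) 1
      (volume.restrict O)) (𝓝[>] 0) (𝓝 0)) {δ : ℝ} (hδ : 0 < δ) :
    ∫ x in O, ∑ j, truncation δ j (fun k => q k x) * g j x = 0 := by
  obtain ⟨ε, hε, hae⟩ := exists_seq_tendsto_ae_kernelAvg hO hconv hb hκ hκ1 hq
  set r : ℕ → ι → Eu n → ℝ := fun m j => kernelAvg O κ (ε m) (q j)
  have hr : ∀ᶠ m in atTop, ∀ j, ContDiff ℝ ∞ (r m j) := by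
    filter_upwards [hε.eventually eventually_small] with m hm j
    exact contDiff_kernelAvg hO.measurableSet hκ hm.1 ((hq j).integrable hb)
  have htm : ∀ᶠ m in atTop, ∀ j, AEStronglyMeasurable
      (fun x => truncation δ j fun k => r m k x) (volume.restrict O) := by
    filter_upwards [hr] with m hm j
    exact ((continuous_truncation hδ j).comp
      (continuous_pi fun k => (hm k).continuous)).aestronglyMeasurable
  have hbound : ∀ j s, ‖truncation δ j (s : ι → ℝ)‖ ≤ 1 / √δ := fun j s => abs_truncation_le hδ j s
  have hT1 : Tendsto (fun m => ∫ x in O, ∑ j, truncation δ j (fun k => r m k x) * g j x) atTop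
      (𝓝 (∫ x in O, ∑ j, truncation δ j (fun k => q k x) * g j x)) := by
    refine tendsto_integral_filter_of_dominated_convergence
      (fun x => ∑ j, 1 / √δ * ‖g j x‖) ?_ ?_ ?_ ?_
    · filter_upwards [htm] with m hm
      exact Finset.aestronglyMeasurable_fun_sum _ fun j _ => (hm j).mul (hg j).1
    · refine Eventually.of_forall fun m => Eventually.of_forall fun x => ?_
      refine (norm_sum_le _ _).trans (Finset.sum_le_sum fun j _ => ?_)
      rw [norm_mul]
      gcongr
      exact hbound _ _
    · exact integrable_finsetSum _ fun j _ => (hg j).norm.const_mul _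
    · filter_upwards [hae] with x hx
      refine tendsto_finsetSum _ fun j _ => Tendsto.mul_const _ ?_
      exact ((continuous_truncation hδ j).tendsto _).comp (tendsto_pi_nhds.2 hx)
  have hT2 : Tendsto (fun m => ∫ x in O, ∑ j, truncation δ j (fun k => r m k x) *
      (dirDeriv U (r m j) x - g j x)) atTop (𝓝 0) := by
    have hlim : Tendsto (fun m => (∑ j, ENNReal.ofReal (1 / √δ) *
        eLpNorm (fun x => dirDeriv U (r m j) x - g j x) 1 (volume.restrict O))) atTop (𝓝 0) := by
      have := tendsto_finsetSum Finset.univ fun j _ => ENNReal.Tendsto.const_mul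
        (a := ENNReal.ofReal (1 / √δ)) ((h j).comp hε) (Or.inr ENNReal.ofReal_ne_top)
      simpa using this
    rw [tendsto_zero_iff_enorm_tendsto_zero]
    refine tendsto_of_tendsto_of_tendsto_of_le_of_le' tendsto_const_nhds hlim
      (Eventually.of_forall fun _ => zero_le) ?_
    filter_upwards [htm, hr] with m hm hrm
    have hD : ∀ j, AEStronglyMeasurable (fun x => dirDeriv U (r m j) x - g j x)
        (volume.restrict O) := fun j =>
      (memL2_dirDeriv_of_contDiff hO hb hU (hrm j)).1.sub (hg j).1
    refine (enorm_integral_le_lintegral_enorm _).trans ?_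
    rw [← eLpNorm_one_eq_lintegral_enorm]
    have e1 : (fun x => ∑ j, truncation δ j (fun k => r m k x) * (dirDeriv U (r m j) x - g j x))
        = ∑ j, fun x => truncation δ j (fun k => r m k x) * (dirDeriv U (r m j) x - g j x) := by
      ext x; simp
    rw [e1]
    refine (eLpNorm_sum_le (fun j _ => (hm j).mul (hD j)) le_rfl).trans
      (Finset.sum_le_sum fun j _ => ?_)
    refine eLpNorm_le_mul_eLpNorm_of_ae_le_mul (Eventually.of_forall fun x => ?_) 1
    rw [Pi.mul_apply, norm_mul]
    gcongr
    exact hbound _ _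
  -- The two integrals add up to the flux of the regularized norm, which is zero for all late `m`.
  have hT3 : Tendsto (fun m => (∫ x in O, ∑ j, truncation δ j (fun k => r m k x) * g j x)
      + ∫ x in O, ∑ j, truncation δ j (fun k => r m k x) * (dirDeriv U (r m j) x - g j x)) atTop
      (𝓝 0) := by
    refine tendsto_const_nhds.congr' ?_
    filter_upwards [htm, hr] with m hm hrm
    have hi : ∀ {k : ι → Eu n → ℝ}, (∀ j, Integrable (k j) (volume.restrict O)) →
        Integrable (fun x => ∑ j, truncation δ j (fun k => r m k x) * k j x)
          (volume.restrict O) := fun {k} hk => by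
      refine integrable_finsetSum _ fun j _ => ?_
      exact (hk j).bdd_mul (hm j) (Eventually.of_forall fun x => hbound _ _)
    have hD : ∀ j, Integrable (dirDeriv U (r m j)) (volume.restrict O) := fun j =>
      (memL2_dirDeriv_of_contDiff hO hb hU (hrm j)).integrable hb
    have hDg : ∀ j, Integrable (fun x => dirDeriv U (r m j) x - g j x) (volume.restrict O) :=
      fun j => (hD j).sub (hg j)
    rw [← integral_add (hi hg) (hi hDg),
      ← hflux _ (contDiff_regularizedNorm hδ hrm)]
    congr 1
    ext x
    rw [dirDeriv_regularizedNorm hδ hrm, ← Finset.sum_add_distrib]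
    refine Finset.sum_congr rfl fun j _ => ?_
    ring
  have := hT1.add hT2
  rw [add_zero] at this
  exact tendsto_nhds_unique this hT3

/-- The energy identity `∫ (U · ∇q) · q = 0` for a solenoidal field with vanishing flux. -/
theorem setIntegral_mul_eq_zero_of_tendsto_dirDeriv (hO : IsOpen O) (hconv : Convex ℝ O)
    (hb : Bornology.IsBounded O) (hκ : IsTestFunction O κ) (hκ1 : ∫ a, κ a = 1)
    (hU : ∀ i, MemL2 O fun x => U x i)
    (hflux : ∀ φ : Eu n → ℝ, ContDiff ℝ ∞ φ → ∫ x in O, dirDeriv U φ x = 0)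
    {q g : ι → Eu n → ℝ} (hq : ∀ j, MemL2 O (q j))
    (hg : ∀ j, Integrable (g j) (volume.restrict O))
    (h : ∀ j, Tendsto (fun ε => eLpNorm (fun x => dirDeriv U (kernelAvg O κ ε (q j)) x - g j x) 1
      (volume.restrict O)) (𝓝[>] 0) (𝓝 0))
    (hsum : Integrable (fun x => ∑ j, g j x * q j x) (volume.restrict O)) :
    ∫ x in O, ∑ j, g j x * q j x = 0 := by
  set e : ℕ → ℝ := fun m => 1 / ((m : ℝ) + 1)
  have hpos : ∀ m, 0 < e m := fun m => by positivity
  have e0 : Tendsto e atTop (𝓝 0) := tendsto_one_div_add_atTop_nhds_zero_nat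
  have hrw : ∀ (m : ℕ) (x : Eu n), ∑ j, truncation (e m) j (fun k => q k x) * g j x
      = (∑ j, g j x * q j x) / √(1 + e m * ∑ k, q k x ^ 2) := fun m x => by
    rw [Finset.sum_div]
    refine Finset.sum_congr rfl fun j _ => ?_
    rw [truncation]; ring
  -- As `δ → 0` the square root decreases to one, and the integrands are dominated by `|∑ j, g j * q
  -- j|`.
  have hT : Tendsto (fun m => ∫ x in O, ∑ j, truncation (e m) j (fun k => q k x) * g j x) atTop
      (𝓝 (∫ x in O, ∑ j, g j x * q j x)) := by
    refine tendsto_integral_of_dominated_convergence (fun x => ‖∑ j, g j x * q j x‖) ?_ hsum.norm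
      ?_ ?_
    · intro m
      refine Finset.aestronglyMeasurable_fun_sum _ fun j _ => AEStronglyMeasurable.mul ?_ (hg j).1
      refine (continuous_truncation (hpos m) j).comp_aestronglyMeasurable ?_
      exact (aemeasurable_pi_iff.2 fun k => (hq k).1.aemeasurable).aestronglyMeasurable
    · intro m
      refine Eventually.of_forall fun x => ?_
      rw [hrw, norm_div]
      refine div_le_self (norm_nonneg _) ?_
      rw [Real.norm_of_nonneg (Real.sqrt_nonneg _), Real.one_le_sqrt]
      have : 0 ≤ ∑ k, q k x ^ 2 := Finset.sum_nonneg fun k _ => sq_nonneg _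
      have := hpos m
      nlinarith
    · refine Eventually.of_forall fun x => ?_
      simp_rw [hrw]
      have h1 : Tendsto (fun m => √(1 + e m * ∑ k, q k x ^ 2)) atTop
          (𝓝 √(1 + 0 * ∑ k, q k x ^ 2)) :=
        ((e0.mul_const _).const_add 1).sqrt
      simp only [zero_mul, add_zero, Real.sqrt_one] at h1
      have h2 := (tendsto_const_nhds (x := ∑ j, g j x * q j x) (f := atTop)).div h1 one_ne_zero
      rw [div_one] at h2
      exact h2
  refine tendsto_nhds_unique hT (tendsto_const_nhds.congr fun m => ?_)
  exact (setIntegral_truncation_mul_eq_zero hO hconv hb hκ hκ1 hU hflux hq hg h (hpos m)).symm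

end Regularization

end Energy

/-! ### Geometry of the fluid domain -/

section Geometry

variable {O : Set (Eu 3)} {Ω : Set (Eu 2)}

/-- The orthogonal projection to the plane of the plate. -/
noncomputable def planeProj (x : Eu 3) : Eu 2 := !₂[x 0, x 1]

/-- The height attains its maximum over the compact closure at a boundary point, which lies at
height zero or in the solid part below. Points of the open set `O` are strictly lower, since they
can be moved upwards inside `O`. -/
theorem IsFluidPlateDomain.lt_zero (h : IsFluidPlateDomain O Ω) {x : Eu 3} (hx : x ∈ O) :
    x 2 < 0 := by
  have hc : IsCompact (closure O) := h.bounded_fluid.isCompact_closure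
  obtain ⟨z, hz, hmax⟩ := hc.exists_isMaxOn ⟨x, subset_closure hx⟩
    (f := fun y : Eu 3 => y 2) (by fun_prop)
  have hlt : ∀ y ∈ O, y 2 < z 2 := by
    intro y hy
    obtain ⟨r, hr, hball⟩ := Metric.isOpen_iff.1 h.isOpen_fluid y hy
    have hmem : y + EuclideanSpace.single 2 (r / 2) ∈ O := by
      refine hball ?_
      rw [Metric.mem_ball, dist_eq_norm, add_sub_cancel_left, PiLp.norm_single,
        Real.norm_of_nonneg (by positivity)]
      linarith
    have : y 2 + r / 2 ≤ z 2 := by simpa using hmax (subset_closure hmem)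
    linarith
  have hzO : z ∉ O := fun h' => lt_irrefl _ (hlt z h')
  have hfr : z ∈ frontier O := ⟨hz, by rwa [h.isOpen_fluid.interior_eq]⟩
  refine (hlt x hx).trans_le ?_
  by_cases hp : z ∈ closure (plateEmb '' Ω)
  · have hsub : closure (plateEmb '' Ω) ⊆ {y : Eu 3 | y 2 ≤ 0} := by
      refine closure_minimal ?_ (isClosed_le (by fun_prop) continuous_const)
      rintro _ ⟨y, -, rfl⟩
      simp [plateEmb]
    exact hsub hp
  · exact h.solid_below z ⟨hfr, hp⟩

theorem norm_plateEmb (y : Eu 2) : ‖plateEmb y‖ = ‖y‖ := by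
  rw [EuclideanSpace.norm_eq, EuclideanSpace.norm_eq, Fin.sum_univ_three, Fin.sum_univ_two]
  simp [plateEmb]

theorem IsFluidPlateDomain.bounded_plate (h : IsFluidPlateDomain O Ω) : Bornology.IsBounded Ω := by
  have hb : Bornology.IsBounded (frontier O) :=
    h.bounded_fluid.closure.subset frontier_subset_closure
  obtain ⟨C, hC⟩ := isBounded_iff_forall_norm_le.1 hb
  refine isBounded_iff_forall_norm_le.2 ⟨C, fun y hy => ?_⟩
  rw [← norm_plateEmb]
  exact hC _ (h.plate_subset ⟨y, hy, rfl⟩)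

/-- A point slightly below `K` lies on a segment from a fixed interior point `a` to a point of the
plate near `K`, and such open segments stay in the interior of a convex set. -/
theorem IsFluidPlateDomain.exists_collar (h : IsFluidPlateDomain O Ω) {K : Set (Eu 2)}
    (hK : IsCompact K) (hKΩ : K ⊆ Ω) :
    ∃ δ : ℝ, 0 < δ ∧ ∀ x : Eu 3, planeProj x ∈ K → -δ < x 2 → x 2 < 0 → x ∈ O := by
  rcases K.eq_empty_or_nonempty with rfl | ⟨y₀, hy₀⟩
  · exact ⟨1, one_pos, fun x hx => hx.elim⟩
  have hcl : plateEmb y₀ ∈ closure O :=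
    frontier_subset_closure (h.plate_subset ⟨y₀, hKΩ hy₀, rfl⟩)
  obtain ⟨a, ha⟩ : O.Nonempty := closure_nonempty_iff.1 ⟨_, hcl⟩
  have ham := h.lt_zero ha
  obtain ⟨ρ, hρ, hthick⟩ := hK.exists_cthickening_subset_open h.isOpen_plate hKΩ
  obtain ⟨D, hD⟩ := hK.exists_bound_of_continuousOn (f := fun y => y - planeProj a) (by fun_prop)
  have hD0 : 0 ≤ D := (norm_nonneg _).trans (hD y₀ hy₀)
  -- With `s = x 2 / a 2` the weight of `a`, the first bound yields `s < 1 / 2`, hence `s / (1 - s)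
  -- ≤ 2 s`; the second keeps the end point of the segment within `ρ` of `K`.
  refine ⟨min (-a 2 / 2) (-a 2 * ρ / (2 * (D + 1))), lt_min (by linarith) ?_,
    fun x hx hx1 hx2 => ?_⟩
  · have : 0 < -a 2 := by linarith
    positivity
  have hx3 : -x 2 < -a 2 / 2 := by linarith [min_le_left (-a 2 / 2) (-a 2 * ρ / (2 * (D + 1)))]
  have hx4 : -x 2 < -a 2 * ρ / (2 * (D + 1)) := by
    linarith [min_le_right (-a 2 / 2) (-a 2 * ρ / (2 * (D + 1)))]
  obtain ⟨s, hs⟩ : ∃ s : ℝ, s = x 2 / a 2 := ⟨_, rfl⟩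
  have hsa : s * a 2 = x 2 := by rw [hs, div_mul_cancel₀ _ ham.ne]
  have hs0 : 0 < s := by rw [hs]; exact div_pos_of_neg_of_neg hx2 ham
  have hs1 : s < 1 / 2 := by nlinarith
  have hs2 : 2 * s * (D + 1) < ρ := by
    rw [lt_div_iff₀ (by positivity)] at hx4
    nlinarith
  -- The point where the ray from `a` through `x` meets the plane.
  obtain ⟨y', hy'⟩ : ∃ y' : Eu 2, y' = planeProj x + (s / (1 - s)) • (planeProj x - planeProj a) :=
    ⟨_, rfl⟩
  have hs3 : s / (1 - s) ≤ 2 * s := by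
    rw [div_le_iff₀ (by linarith)]
    nlinarith
  have hmem : y' ∈ Ω := by
    refine hthick (Metric.mem_cthickening_of_dist_le y' _ ρ K hx ?_)
    rw [hy', dist_eq_norm, add_sub_cancel_left, norm_smul,
      Real.norm_of_nonneg (div_nonneg hs0.le (by linarith))]
    have := hD _ hx
    calc s / (1 - s) * ‖planeProj x - planeProj a‖ ≤ 2 * s * D := by gcongr
      _ ≤ ρ := by nlinarith
  have hcl' : plateEmb y' ∈ closure O := frontier_subset_closure (h.plate_subset ⟨y', hmem, rfl⟩)
  have hcomb := h.convex_fluid.combo_interior_closure_mem_interior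
    (by rwa [h.isOpen_fluid.interior_eq]) hcl' hs0 (by linarith : (0 : ℝ) ≤ 1 - s) (by ring)
  rw [h.isOpen_fluid.interior_eq] at hcomb
  convert hcomb using 1
  have h1s : (1 - s) ≠ 0 := by linarith
  ext i
  fin_cases i
  · simp [hy', plateEmb, planeProj]
    field_simp
    ring
  · simp [hy', plateEmb, planeProj]
    field_simp
    ring
  · simp [plateEmb, hsa]

end Geometry

/-! ### Green's formula in a half-space -/

section HalfSpace

theorem integral_eq_integral_insertNth {n : ℕ} (i : Fin (n + 1)) {F : Eu (n + 1) → ℝ}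
    (hF : Integrable F) :
    ∫ x, F x = ∫ y : Fin n → ℝ, ∫ t : ℝ, F (WithLp.toLp 2 (i.insertNth t y)) := by
  have h1 := (EuclideanSpace.volume_preserving_symm_measurableEquiv_toLp (Fin (n + 1))).symm
  have h2 := (volume_preserving_piFinSuccAbove (fun _ : Fin (n + 1) => ℝ) i).symm
  have h3 := h2.trans h1
  rw [← h3.integral_comp' F, Measure.volume_eq_prod, integral_prod_symm]
  · rfl
  · exact (h3.integrable_comp_emb (MeasurableEquiv.measurableEmbedding _)).2 hF

/-- Fubini with the `i`-th variable integrated first. In the normal direction the line ends at the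
plane and leaves a boundary value; a tangential line lies entirely inside or outside the half-space.
-/
theorem setIntegral_pderiv_halfSpace {G : Eu 3 → ℝ} (hG : ContDiff ℝ ∞ G)
    (hc : HasCompactSupport G) (i : Fin 3) :
    ∫ x in {x : Eu 3 | x 2 < 0}, pderiv i G x
      = if i = 2 then ∫ y : Eu 2, G (plateEmb y) else 0 := by
  have hm : MeasurableSet {x : Eu 3 | x 2 < 0} :=
    (isOpen_lt (by fun_prop) continuous_const).measurableSet
  have hc' : HasCompactSupport (pderiv i G) :=
    hc.of_isClosed_subset (isClosed_tsupport _) (tsupport_pderiv_subset G)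
  have hint : Integrable (pderiv i G) :=
    (hG.pderiv i).continuous.integrable_of_hasCompactSupport hc'
  rw [← integral_indicator hm, integral_eq_integral_insertNth i (hint.indicator hm)]
  obtain ⟨C, hC⟩ := isBounded_iff_forall_norm_le.1 hc.isCompact.isBounded
  have hsupp : ∀ {H : Eu 3 → ℝ}, tsupport H ⊆ tsupport G → ∀ y : Fin 2 → ℝ,
      HasCompactSupport fun t : ℝ => H (WithLp.toLp 2 (i.insertNth t y)) := by
    intro H hH y
    refine HasCompactSupport.intro (isCompact_closedBall (0 : ℝ) C) fun t ht => ?_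
    by_contra h0
    refine ht ?_
    rw [mem_closedBall_zero_iff]
    refine le_trans ?_ (hC _ (hH (subset_tsupport _ h0)))
    simpa using PiLp.norm_apply_le (WithLp.toLp 2 (i.insertNth t y) : Eu 3) i
  have hline : ∀ (y : Fin 2 → ℝ) (t : ℝ), HasDerivAt
      (fun t : ℝ => (WithLp.toLp 2 (i.insertNth t y) : Eu 3)) (EuclideanSpace.single i 1) t := by
    intro y t
    have e : (fun t : ℝ => (WithLp.toLp 2 (i.insertNth t y) : Eu 3))
        = fun t => WithLp.toLp 2 (i.insertNth 0 y) + t • EuclideanSpace.single i (1 : ℝ) := by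
      ext t j
      rcases Fin.eq_self_or_eq_succAbove i j with rfl | ⟨k, rfl⟩ <;> simp
    rw [e]
    simpa using ((hasDerivAt_id t).smul_const (EuclideanSpace.single i (1 : ℝ))).const_add
      (WithLp.toLp 2 (i.insertNth 0 y) : Eu 3)
  have hderiv : ∀ (y : Fin 2 → ℝ) (t : ℝ), HasDerivAt
      (fun t : ℝ => G (WithLp.toLp 2 (i.insertNth t y)))
      (pderiv i G (WithLp.toLp 2 (i.insertNth t y))) t := fun y t =>
    (hG.differentiable (by simp) _).hasFDerivAt.comp_hasDerivAt t (hline y t)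
  have hcont : ∀ y : Fin 2 → ℝ,
      Continuous fun t : ℝ => (WithLp.toLp 2 (i.insertNth t y) : Eu 3) := fun y =>
    continuous_iff_continuousAt.2 fun t => (hline y t).continuousAt
  split_ifs with hi
  · subst hi
    have e1 : ∀ y : Fin 2 → ℝ, ∫ t : ℝ, Set.indicator {x : Eu 3 | x 2 < 0} (pderiv 2 G)
        (WithLp.toLp 2 ((2 : Fin 3).insertNth t y)) = G (plateEmb (WithLp.toLp 2 y)) := by
      intro y
      have e2 : (fun t : ℝ => Set.indicator {x : Eu 3 | x 2 < 0} (pderiv 2 G)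
          (WithLp.toLp 2 ((2 : Fin 3).insertNth t y)))
          = (Set.Iio (0 : ℝ)).indicator fun t => deriv (fun t : ℝ =>
            G (WithLp.toLp 2 ((2 : Fin 3).insertNth t y))) t := by
        ext t
        have hd := (hderiv y t).deriv
        simp only [Set.indicator, Set.mem_ofPred_eq, Set.mem_Iio, hd, Fin.insertNth_apply_same]
      have hsm : ContDiff ℝ 1 fun t : ℝ => G (WithLp.toLp 2 ((2 : Fin 3).insertNth t y)) := by
        rw [contDiff_one_iff_deriv]
        refine ⟨fun t => (hderiv y t).differentiableAt, ?_⟩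
        have : deriv (fun t : ℝ => G (WithLp.toLp 2 ((2 : Fin 3).insertNth t y)))
            = fun t => pderiv 2 G (WithLp.toLp 2 ((2 : Fin 3).insertNth t y)) :=
          funext fun t => (hderiv y t).deriv
        rw [this]
        exact (hG.pderiv 2).continuous.comp (hcont y)
      rw [e2, integral_indicator measurableSet_Iio, ← integral_Iic_eq_integral_Iio,
        (hsupp subset_rfl y).integral_Iic_deriv_eq hsm 0]
      congr 1
      ext j
      fin_cases j
      · rfl
      · rfl
      · simp [plateEmb]
    simp_rw [e1]
    exact (PiLp.volume_preserving_toLp (Fin 2)).integral_comp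
      (MeasurableEquiv.toLp 2 (Fin 2 → ℝ)).measurableEmbedding fun y => G (plateEmb y)
  · obtain ⟨k, hk⟩ := Fin.exists_succAbove_eq (Ne.symm hi)
    have e1 : ∀ y : Fin 2 → ℝ, ∫ t : ℝ, Set.indicator {x : Eu 3 | x 2 < 0} (pderiv i G)
        (WithLp.toLp 2 (i.insertNth t y)) = 0 := by
      intro y
      have hcoord : ∀ t : ℝ, (WithLp.toLp 2 (i.insertNth t y) : Eu 3) 2 = y k := fun t => by
        rw [← hk]; simp
      have h0 : ∫ t : ℝ, pderiv i G (WithLp.toLp 2 (i.insertNth t y)) = 0 := by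
        refine integral_eq_zero_of_hasDerivAt_of_integrable (hderiv y) ?_ ?_
        · exact ((hG.pderiv i).continuous.comp (hcont y)).integrable_of_hasCompactSupport
            (hsupp (tsupport_pderiv_subset G) y)
        · exact (hG.continuous.comp (hcont y)).integrable_of_hasCompactSupport
            (hsupp subset_rfl y)
      by_cases hy : y k < 0
      · refine (integral_congr_ae (Eventually.of_forall fun t => ?_)).trans h0
        simp only
        rw [Set.indicator_of_mem]
        rwa [Set.mem_ofPred_eq, hcoord t]
      · have : (fun t : ℝ => Set.indicator {x : Eu 3 | x 2 < 0} (pderiv i G)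
            (WithLp.toLp 2 (i.insertNth t y))) = 0 := by
          ext t
          rw [Set.indicator_of_notMem, Pi.zero_apply]
          rwa [Set.mem_ofPred_eq, hcoord t]
        rw [this]
        simp
    simp_rw [e1]
    simp

end HalfSpace

/-! ### Extension of plate displacements into the fluid -/

section Extension

variable {O : Set (Eu 3)} {Ω : Set (Eu 2)}

theorem contDiff_planeProj : ContDiff ℝ ∞ planeProj := by
  rw [contDiff_euclidean]
  intro i
  fin_cases i
  · simp [planeProj]; fun_prop
  · simp [planeProj]; fun_prop

/-- The sum of the diagonal identities `i = k`, of which only `i = k = 2` has a boundary term. -/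
theorem HasVerticalTrace.hasNormalTrace (hO : IsOpen O) (hb : Bornology.IsBounded O)
    {ψ : Eu 3 → Eu 3} {β : Eu 2 → ℝ} (hψ : MemHVec O 1 ψ) (h : HasVerticalTrace O Ω ψ β) :
    HasNormalTrace O Ω ψ β := by
  intro φ hφ
  have hi : ∀ i : Fin 3, Integrable (fun x => wderiv O i (fun y => ψ y i) x * φ x
      + ψ x i * pderiv i φ x) (volume.restrict O) := fun i =>
    (integrable_mul_continuous hO hb (((hψ i).wderiv_spec i).1.integrable hb) hφ.continuous).add
      (integrable_mul_continuous hO hb ((hψ i).1.integrable hb) (hφ.pderiv i).continuous)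
  have e : ∀ x, divg O ψ x * φ x + ∑ i : Fin 3, ψ x i * pderiv i φ x
      = ∑ i : Fin 3, (wderiv O i (fun y => ψ y i) x * φ x + ψ x i * pderiv i φ x) := fun x => by
    rw [divg, Finset.sum_mul, Finset.sum_add_distrib]
  simp_rw [e]
  rw [integral_finsetSum _ fun i _ => hi i]
  simp_rw [fun i => h i i φ hφ]
  simp

/-- The lift is `β(x₁, x₂) χ(x₃) e₃` with a cut-off `χ` so narrow that, below the plane, its support
stays in `O`. Green's formula in `O` thereby reduces to that of the half-space, and no regularity of
the solid boundary is involved. -/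
theorem IsFluidPlateDomain.exists_hasVerticalTrace (h : IsFluidPlateDomain O Ω) {β : Eu 2 → ℝ}
    (hβ : IsTestFunction Ω β) :
    ∃ ψ : Eu 3 → Eu 3, MemHVec O 1 ψ ∧ HasVerticalTrace O Ω ψ β := by
  have hO := h.isOpen_fluid
  have hb := h.bounded_fluid
  obtain ⟨δ, hδ, hcollar⟩ := h.exists_collar hβ.2.1.isCompact hβ.2.2
  -- The outer radius `δ / 2` keeps the closed support strictly inside the collar of depth `δ`.
  let χ : ContDiffBump (0 : ℝ) := ⟨δ / 4, δ / 2, by positivity, by linarith⟩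
  set g : Eu 3 → ℝ := fun x => β (planeProj x) * χ (x 2) with hg
  have hgs : ContDiff ℝ ∞ g := by
    have h1 : ContDiff ℝ ∞ fun x : Eu 3 => β (planeProj x) := hβ.1.comp contDiff_planeProj
    have h2 : ContDiff ℝ ∞ fun x : Eu 3 => χ (x 2) := χ.contDiff.comp (by fun_prop)
    exact h1.mul h2
  have hg0 : ∀ x, g x ≠ 0 → planeProj x ∈ tsupport β ∧ |x 2| ≤ δ / 2 := by
    intro x hx
    refine ⟨subset_tsupport _ (left_ne_zero_of_mul hx), ?_⟩
    have := subset_tsupport _ (right_ne_zero_of_mul hx)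
    rw [χ.tsupport_eq, mem_closedBall_zero_iff] at this
    exact this
  have hclosed : tsupport g ⊆ {x | planeProj x ∈ tsupport β ∧ |x 2| ≤ δ / 2} := by
    refine closure_minimal hg0 ?_
    have h1 : Continuous fun x : Eu 3 => |x 2| := by fun_prop
    exact ((isClosed_tsupport β).preimage contDiff_planeProj.continuous).inter
      (isClosed_le h1 continuous_const)
  have hgc : HasCompactSupport g := by
    refine HasCompactSupport.intro ((hβ.2.1.isCompact.prod
      (isCompact_closedBall (0 : ℝ) (δ / 2))).image
      (f := fun z : Eu 2 × ℝ => (!₂[z.1 0, z.1 1, z.2] : Eu 3)) (by fun_prop)) fun x hx => ?_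
    by_contra h0
    obtain ⟨h1, h2⟩ := hg0 x h0
    refine hx ⟨(planeProj x, x 2), ⟨h1, mem_closedBall_zero_iff.2 h2⟩, ?_⟩
    ext i
    fin_cases i <;> simp [planeProj]
  have hplate : ∀ y, g (plateEmb y) = β y := by
    intro y
    have e1 : planeProj (plateEmb y) = y := by
      ext i; fin_cases i <;> simp [planeProj, plateEmb]
    have e2 : plateEmb y 2 = 0 := by simp [plateEmb]
    simp only [hg, e1, e2]
    rw [χ.one_of_mem_closedBall (Metric.mem_closedBall_self (by positivity)), mul_one]
  refine ⟨fun x => EuclideanSpace.single 2 (g x), fun i => ?_, fun i k φ hφ => ?_⟩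
  · refine memH_of_contDiff hO hb 1 ?_
    by_cases hi : i = 2
    · subst hi; simpa using hgs
    · simpa [hi] using contDiff_const
  · by_cases hk : k = 2
    · subst hk
      simp only [PiLp.single_apply, if_true, and_true]
      have e1 : ∫ x in O, (wderiv O i g x * φ x + g x * pderiv i φ x)
          = ∫ x in O, pderiv i (fun y => g y * φ y) x := by
        refine integral_congr_ae ?_
        filter_upwards [wderiv_smooth hO hb hgs i] with x hx
        rw [hx, pderiv_mul (hgs.differentiable (by simp) x) (hφ.differentiable (by simp) x)]
        ring
      have hsub : O ⊆ {x : Eu 3 | x 2 < 0} := fun x hx => h.lt_zero hx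
      have e2 : ∫ x in O, pderiv i (fun y => g y * φ y) x
          = ∫ x in {x : Eu 3 | x 2 < 0}, pderiv i (fun y => g y * φ y) x := by
        have hm : MeasurableSet {x : Eu 3 | x 2 < 0} :=
          (isOpen_lt (by fun_prop) continuous_const).measurableSet
        refine (setIntegral_eq_of_subset_of_forall_sdiff_eq_zero hm hsub ?_).symm
        rintro x ⟨hx1, hx2⟩
        by_contra h0
        have h1 := hclosed (tsupport_mul_subset_left (tsupport_pderiv_subset _
          (subset_tsupport _ h0)))
        refine hx2 (hcollar x h1.1 ?_ hx1)
        have := neg_abs_le (x 2)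
        have := h1.2
        linarith
      rw [e1, e2, setIntegral_pderiv_halfSpace (hgs.mul hφ) hgc.mul_right]
      simp_rw [hplate]
      congr 1
      exact (setIntegral_eq_integral_of_forall_compl_eq_zero fun y hy => by
        rw [hβ.eq_zero hy, zero_mul]).symm
    · have e0 : (fun y : Eu 3 => (EuclideanSpace.single 2 (g y) : Eu 3) k) = 0 := by
        ext y; simp [hk]
      simp only [hk, and_false, if_false, e0]
      rw [← integral_zero (Eu 3) ℝ (μ := volume.restrict O)]
      refine integral_congr_ae ?_
      filter_upwards [wderiv_zero hO hb i] with x hx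
      simp [hx, hk]

end Extension

/-! ### Boundedness of `H²` functions in three dimensions -/

section Bounded

variable {O : Set (Eu 3)} {κ : Eu 3 → ℝ}

theorem fderiv_apply_eq_sum {n : ℕ} (v : Eu n → ℝ) (z w : Eu n) :
    fderiv ℝ v z w = ∑ i, w i * pderiv i v z := by
  have hw : w = ∑ i, w i • EuclideanSpace.single i (1 : ℝ) := by
    have := (EuclideanSpace.basisFun (Fin n) ℝ).sum_repr w
    simpa using this.symm
  conv_lhs => rw [hw, map_sum]
  refine Finset.sum_congr rfl fun i _ => ?_
  rw [map_smul, smul_eq_mul, pderiv]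

/-- The sum of the absolute values of the second derivatives. -/
noncomputable def hessianSum {n : ℕ} (v : Eu n → ℝ) (z : Eu n) : ℝ :=
  ∑ i, ∑ j, ‖pderiv j (pderiv i v) z‖

theorem continuous_hessianSum {n : ℕ} {v : Eu n → ℝ} (hv : ContDiff ℝ ∞ v) :
    Continuous (hessianSum v) :=
  continuous_finsetSum _ fun i _ => continuous_finsetSum _ fun j _ =>
    ((hv.pderiv i).pderiv j).continuous.norm

/-- Taylor's formula at the end point `x + w`, with the integral remainder reparametrized by `t =
s²`. The weight `t dt` becomes `2 s³ ds`, whose square root structure matches the Jacobian `s⁶` in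
dimension three. -/
theorem taylor_two_segment {n : ℕ} {v : Eu n → ℝ} (hv : ContDiff ℝ ∞ v) (x w : Eu n) :
    v x = v (x + w) - fderiv ℝ v (x + w) w + ∫ s in (0 : ℝ)..1,
      2 * s ^ 3 * ∑ i, w i * fderiv ℝ (pderiv i v) (x + s ^ 2 • w) w := by
  have hz : ∀ s : ℝ, HasDerivAt (fun s : ℝ => x + s ^ 2 • w) ((2 * s) • w) s := fun s => by
    simpa using ((hasDerivAt_pow 2 s).smul_const w).const_add x
  have hz' : Continuous fun s : ℝ => x + s ^ 2 • w := by fun_prop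
  have h1 : ∀ s : ℝ, HasDerivAt (fun s : ℝ => v (x + s ^ 2 • w))
      (2 * s * fderiv ℝ v (x + s ^ 2 • w) w) s := fun s => by
    have := (hv.differentiable (by simp) _).hasFDerivAt.comp_hasDerivAt s (hz s)
    rwa [map_smul, smul_eq_mul] at this
  have h2 : ∀ s : ℝ, HasDerivAt (fun s : ℝ => fderiv ℝ v (x + s ^ 2 • w) w)
      (2 * s * ∑ i, w i * fderiv ℝ (pderiv i v) (x + s ^ 2 • w) w) s := fun s => by
    simp_rw [fderiv_apply_eq_sum v]
    rw [Finset.mul_sum]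
    refine HasDerivAt.fun_sum fun i _ => ?_
    have := (((hv.pderiv i).differentiable (by simp) _).hasFDerivAt.comp_hasDerivAt s
      (hz s)).const_mul (w i)
    rw [map_smul, smul_eq_mul] at this
    refine this.congr_deriv ?_
    ring
  have h3 : ∀ s : ℝ, HasDerivAt
      (fun s : ℝ => s ^ 2 * fderiv ℝ v (x + s ^ 2 • w) w - v (x + s ^ 2 • w))
      (2 * s ^ 3 * ∑ i, w i * fderiv ℝ (pderiv i v) (x + s ^ 2 • w) w) s := fun s => by
    have := ((hasDerivAt_pow 2 s).fun_mul (h2 s)).fun_sub (h1 s)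
    refine this.congr_deriv ?_
    push_cast
    ring
  have hc : Continuous fun s : ℝ =>
      2 * s ^ 3 * ∑ i, w i * fderiv ℝ (pderiv i v) (x + s ^ 2 • w) w := by
    refine Continuous.mul (by fun_prop) (continuous_finsetSum _ fun i _ =>
      continuous_const.mul ?_)
    exact (((hv.pderiv i).continuous_fderiv (by simp)).comp hz').clm_apply continuous_const
  rw [intervalIntegral.integral_eq_sub_of_hasDerivAt (fun s _ => h3 s)
    (hc.intervalIntegrable 0 1)]
  simp only [one_pow, one_smul, one_mul, ne_eq, OfNat.ofNat_ne_zero, not_false_eq_true, zero_pow,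
    zero_smul, add_zero, zero_mul, zero_sub]
  ring

theorem enorm_le_one_add_sq (r : ℝ) : ‖r‖ₑ ≤ 1 + ‖r‖ₑ ^ 2 := by
  rcases le_total ‖r‖ₑ 1 with h | h
  · exact h.trans le_self_add
  · calc ‖r‖ₑ = ‖r‖ₑ * 1 := (mul_one _).symm
      _ ≤ ‖r‖ₑ * ‖r‖ₑ := by gcongr
      _ = ‖r‖ₑ ^ 2 := (sq _).symm
      _ ≤ _ := le_add_self

/-- All terms are bounded through `r ≤ 1 + r²` or `2 s³ r ≤ 1 + s⁶ r²`, so that averaging over `a`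
meets only `L²` norms. -/
theorem enorm_le_taylor (hconv : Convex ℝ O) (hb : Bornology.IsBounded O)
    {v : Eu 3 → ℝ} (hv : ContDiff ℝ ∞ v) {x a : Eu 3} (hx : x ∈ O) (ha : a ∈ O) :
    ‖v x‖ₑ ≤ (1 + ‖v a‖ₑ ^ 2)
      + ENNReal.ofReal (Metric.diam O) * ∑ i, (1 + ‖pderiv i v a‖ₑ ^ 2)
      + ENNReal.ofReal (Metric.diam O) ^ 2 * ∫⁻ s in Set.Ioc (0 : ℝ) 1, (1 + ENNReal.ofReal (s ^ 6)
        * O.indicator (fun z => ‖hessianSum v z‖ₑ ^ 2) (s ^ 2 • a + (1 - s ^ 2) • x)) := by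
  set d := Metric.diam O
  have hw : ‖a - x‖ ≤ d := by
    rw [← dist_eq_norm]; exact Metric.dist_le_diam_of_mem hb ha hx
  have hd : 0 ≤ d := Metric.diam_nonneg
  have ht := taylor_two_segment hv x (a - x)
  rw [add_sub_cancel, intervalIntegral.integral_of_le zero_le_one] at ht
  rw [ht]
  refine (enorm_add_le _ _).trans ?_
  gcongr
  · refine enorm_sub_le.trans ?_
    gcongr
    · exact enorm_le_one_add_sq _
    · calc ‖fderiv ℝ v a (a - x)‖ₑ ≤ ENNReal.ofReal (d * ∑ i, ‖pderiv i v a‖) := by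
            rw [← ofReal_norm]
            refine ENNReal.ofReal_le_ofReal ((norm_fderiv_apply_le v a _).trans ?_)
            gcongr
        _ = ENNReal.ofReal d * ∑ i, ‖pderiv i v a‖ₑ := by
            rw [ENNReal.ofReal_mul hd, ENNReal.ofReal_sum_of_nonneg fun i _ => norm_nonneg _]
            simp_rw [ofReal_norm]
        _ ≤ _ := by
            gcongr
            exact enorm_le_one_add_sq _
  · refine (enorm_integral_le_lintegral_enorm _).trans ?_
    rw [← lintegral_const_mul' _ _ (by finiteness)]
    refine setLIntegral_mono' measurableSet_Ioc fun s hs => ?_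
    have e : x + s ^ 2 • (a - x) = s ^ 2 • a + (1 - s ^ 2) • x := by module
    have hs2 : s ^ 2 ≤ 1 := pow_le_one₀ hs.1.le hs.2
    have hmem : s ^ 2 • a + (1 - s ^ 2) • x ∈ O :=
      hconv ha hx (sq_nonneg s) (by linarith) (by ring)
    rw [e, Set.indicator_of_mem hmem]
    set z := s ^ 2 • a + (1 - s ^ 2) • x
    have hH0 : 0 ≤ hessianSum v z :=
      Finset.sum_nonneg fun i _ => Finset.sum_nonneg fun j _ => norm_nonneg _
    have hH : ‖∑ i, (a - x) i * fderiv ℝ (pderiv i v) z (a - x)‖ ≤ d ^ 2 * hessianSum v z := by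
      rw [hessianSum, Finset.mul_sum]
      refine (norm_sum_le _ _).trans (Finset.sum_le_sum fun i _ => ?_)
      rw [norm_mul, sq, mul_assoc]
      gcongr
      · exact (PiLp.norm_apply_le _ i).trans hw
      · refine (norm_fderiv_apply_le _ z _).trans ?_
        gcongr
    have hkey : ‖2 * s ^ 3 * ∑ i, (a - x) i * fderiv ℝ (pderiv i v) z (a - x)‖
        ≤ d ^ 2 * (1 + s ^ 6 * hessianSum v z ^ 2) := by
      have hs3 : 0 ≤ s ^ 3 := pow_nonneg hs.1.le 3
      rw [norm_mul, Real.norm_of_nonneg (by positivity)]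
      calc 2 * s ^ 3 * ‖∑ i, (a - x) i * fderiv ℝ (pderiv i v) z (a - x)‖
          ≤ 2 * s ^ 3 * (d ^ 2 * hessianSum v z) := by gcongr
        _ = d ^ 2 * (2 * (s ^ 3 * hessianSum v z)) := by ring
        _ ≤ d ^ 2 * (1 + s ^ 6 * hessianSum v z ^ 2) := by
            gcongr
            nlinarith [sq_nonneg (s ^ 3 * hessianSum v z - 1)]
    rw [← ofReal_norm]
    refine (ENNReal.ofReal_le_ofReal hkey).trans_eq ?_
    rw [ENNReal.ofReal_mul (by positivity), ENNReal.ofReal_pow hd,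
      ENNReal.ofReal_add zero_le_one (by positivity), ENNReal.ofReal_one,
      ENNReal.ofReal_mul (by positivity), Real.enorm_of_nonneg hH0, ENNReal.ofReal_pow hH0]

/-- The pointwise Taylor bound integrated over `a ∈ O`. For fixed `s` the map `a ↦ s² a + (1 - s²)
x` has Jacobian `s⁶`, which cancels the weight of the Hessian exactly; the result is independent of
`x`. -/
theorem enorm_mul_volume_le (hO : IsOpen O) (hconv : Convex ℝ O) (hb : Bornology.IsBounded O)
    {v : Eu 3 → ℝ} (hv : ContDiff ℝ ∞ v) {x : Eu 3} (hx : x ∈ O) :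
    ‖v x‖ₑ * volume O ≤ (volume O + eLpNorm v 2 (volume.restrict O) ^ 2)
      + ENNReal.ofReal (Metric.diam O) *
        ∑ i, (volume O + eLpNorm (pderiv i v) 2 (volume.restrict O) ^ 2)
      + ENNReal.ofReal (Metric.diam O) ^ 2 *
        (volume O + eLpNorm (hessianSum v) 2 (volume.restrict O) ^ 2) := by
  set D := ENNReal.ofReal (Metric.diam O)
  set G : Eu 3 → ENNReal := O.indicator fun z => ‖hessianSum v z‖ₑ ^ 2 with hG
  have hGm : Measurable G :=
    ((continuous_hessianSum hv).enorm.measurable.pow_const 2).indicator hO.measurableSet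
  have hm : ∀ {f : Eu 3 → ℝ}, Continuous f → Measurable fun a => ‖f a‖ₑ ^ 2 := fun hf =>
    hf.enorm.measurable.pow_const 2
  have hI : ∀ {f : Eu 3 → ℝ}, Continuous f → ∫⁻ a in O, (1 + ‖f a‖ₑ ^ 2)
      = volume O + eLpNorm f 2 (volume.restrict O) ^ 2 := fun {f} hf => by
    rw [lintegral_add_right _ (hm hf), eLpNorm_two_sq]; simp
  have hmi : ∀ i, Measurable fun a => 1 + ‖pderiv i v a‖ₑ ^ 2 := fun i =>
    measurable_const.add (hm (hv.pderiv i).continuous)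
  have hprod : Measurable fun z : Eu 3 × ℝ => 1 + ENNReal.ofReal (z.2 ^ 6)
        * G (z.2 ^ 2 • z.1 + (1 - z.2 ^ 2) • x) := by
    refine measurable_const.add (Measurable.mul (by fun_prop) (hGm.comp ?_))
    fun_prop
  have hm2 : Measurable fun a => ∫⁻ s in Set.Ioc (0 : ℝ) 1, (1 + ENNReal.ofReal (s ^ 6)
        * G (s ^ 2 • a + (1 - s ^ 2) • x)) := hprod.lintegral_prod_right'
  have hlast : ∫⁻ a in O, ∫⁻ s in Set.Ioc (0 : ℝ) 1, (1 + ENNReal.ofReal (s ^ 6)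
        * G (s ^ 2 • a + (1 - s ^ 2) • x))
      ≤ volume O + eLpNorm (hessianSum v) 2 (volume.restrict O) ^ 2 := by
    rw [lintegral_lintegral_swap hprod.aemeasurable]
    calc _ ≤ ∫⁻ s in Set.Ioc (0 : ℝ) 1,
          (volume O + eLpNorm (hessianSum v) 2 (volume.restrict O) ^ 2) := by
          refine setLIntegral_mono' measurableSet_Ioc fun s hs => ?_
          have hGs : Measurable fun a => G (s ^ 2 • a + (1 - s ^ 2) • x) :=
            hGm.comp (by fun_prop)
          rw [lintegral_add_left measurable_const, lintegral_const_mul _ hGs]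
          gcongr
          · simp
          · have hs0 : s ^ 2 ≠ 0 := (pow_pos hs.1 2).ne'
            calc ENNReal.ofReal (s ^ 6) * ∫⁻ a in O, G (s ^ 2 • a + (1 - s ^ 2) • x)
                ≤ ENNReal.ofReal (s ^ 6) * ∫⁻ a, G (s ^ 2 • a + (1 - s ^ 2) • x) := by
                  gcongr
                  exact Measure.restrict_le_self
              _ = ∫⁻ a, G a := by
                  have hs6 : 0 < s ^ 6 := pow_pos hs.1 6
                  rw [lintegral_comp_smul_add hGm hs0, ← mul_assoc,
                    ← ENNReal.ofReal_mul hs6.le, ← pow_mul, abs_of_pos (by positivity),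
                    mul_inv_cancel₀ hs6.ne']
                  simp
              _ = _ := by
                  rw [hG, lintegral_indicator hO.measurableSet, eLpNorm_two_sq]
      _ = _ := by simp
  calc ‖v x‖ₑ * volume O = ∫⁻ a in O, ‖v x‖ₑ := by simp
    _ ≤ ∫⁻ a in O, ((1 + ‖v a‖ₑ ^ 2) + D * ∑ i, (1 + ‖pderiv i v a‖ₑ ^ 2)
          + D ^ 2 * ∫⁻ s in Set.Ioc (0 : ℝ) 1, (1 + ENNReal.ofReal (s ^ 6)
            * G (s ^ 2 • a + (1 - s ^ 2) • x))) :=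
        setLIntegral_mono' hO.measurableSet fun a ha => enorm_le_taylor hconv hb hv hx ha
    _ = (∫⁻ a in O, (1 + ‖v a‖ₑ ^ 2)) + D * ∑ i, (∫⁻ a in O, (1 + ‖pderiv i v a‖ₑ ^ 2))
          + D ^ 2 * ∫⁻ a in O, ∫⁻ s in Set.Ioc (0 : ℝ) 1, (1 + ENNReal.ofReal (s ^ 6)
            * G (s ^ 2 • a + (1 - s ^ 2) • x)) := by
        rw [lintegral_add_right _ (hm2.const_mul _), lintegral_add_right _
          ((Finset.measurable_fun_sum _ fun i _ => hmi i).const_mul _), lintegral_const_mul _ hm2,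
          lintegral_const_mul _ (Finset.measurable_fun_sum _ fun i _ => hmi i),
          lintegral_finsetSum _ fun i _ => hmi i]
    _ ≤ _ := by
        rw [hI hv.continuous]
        simp_rw [fun i => hI (hv.pderiv i).continuous]
        gcongr

theorem eLpNorm_pderiv_kernelAvg_le {n : ℕ} {O : Set (Eu n)} {κ : Eu n → ℝ} (hO : IsOpen O)
    (hconv : Convex ℝ O) (hb : Bornology.IsBounded O) (hκ : IsTestFunction O κ) {ε : ℝ}
    (hε : 0 < ε) (hε' : ε ≤ 1 / 2) {v : Eu n → ℝ} (hv : MemH O 1 v) (i : Fin n) :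
    eLpNorm (pderiv i (kernelAvg O κ ε v)) 2 (volume.restrict O)
      ≤ (2 ^ n * ∫⁻ a, ‖κ a‖ₑ) * eLpNorm (wderiv O i v) 2 (volume.restrict O) := by
  refine le_trans ?_ (eLpNorm_kernelAvg_le hκ.continuous hε hε' (hv.wderiv_spec i).1)
  refine eLpNorm_mono_ae (ae_restrict_of_forall hO fun x hx => ?_)
  rw [pderiv_kernelAvg_of_hasWeakPDeriv hO hconv hb hκ hε hε' hv.1 (hv.wderiv_spec i).2 hx,
    norm_mul]
  refine mul_le_of_le_one_left (norm_nonneg _) ?_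
  rw [Real.norm_of_nonneg (by linarith)]
  linarith

theorem eLpNorm_hessianSum_kernelAvg_le (hO : IsOpen O) (hconv : Convex ℝ O)
    (hb : Bornology.IsBounded O) (hκ : IsTestFunction O κ) {ε : ℝ} (hε : 0 < ε) (hε' : ε ≤ 1 / 2)
    {v : Eu 3 → ℝ} (hv : MemH O 2 v) :
    eLpNorm (hessianSum (kernelAvg O κ ε v)) 2 (volume.restrict O) ≤ ∑ i, ∑ j,
      (2 ^ 3 * ∫⁻ a, ‖κ a‖ₑ) * eLpNorm (wderiv O j (wderiv O i v)) 2 (volume.restrict O) := by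
  have hs : ContDiff ℝ ∞ (kernelAvg O κ ε v) :=
    contDiff_kernelAvg hO.measurableSet hκ hε (hv.1.integrable hb)
  have e : hessianSum (kernelAvg O κ ε v)
      = ∑ i, ∑ j, fun z => ‖pderiv j (pderiv i (kernelAvg O κ ε v)) z‖ := by
    ext z; simp [hessianSum]
  have hc : ∀ i j, AEStronglyMeasurable
      (fun z => ‖pderiv j (pderiv i (kernelAvg O κ ε v)) z‖) (volume.restrict O) := fun i j =>
    ((hs.pderiv i).pderiv j).continuous.norm.aestronglyMeasurable
  rw [e]
  refine (eLpNorm_sum_le (fun i _ => Finset.aestronglyMeasurable_sum _ fun j _ => hc i j)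
    one_le_two).trans (Finset.sum_le_sum fun i _ => ?_)
  refine (eLpNorm_sum_le (fun j _ => hc i j) one_le_two).trans (Finset.sum_le_sum fun j _ => ?_)
  rw [eLpNorm_norm]
  have hw : MemH O 1 (wderiv O i v) := hv.wderiv hO hb i
  refine le_trans ?_ (eLpNorm_pderiv_kernelAvg_le hO hconv hb hκ hε hε' hw j)
  refine eLpNorm_mono_ae (ae_restrict_of_forall hO fun x hx => ?_)
  -- The formula for the first derivative holds only in `O`, so it is differentiated as an identity
  -- of germs at `x`.
  have hloc : pderiv i (kernelAvg O κ ε v) =ᶠ[𝓝 x]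
      fun y => (1 - ε) * kernelAvg O κ ε (wderiv O i v) y := by
    filter_upwards [hO.mem_nhds hx] with y hy
    exact pderiv_kernelAvg_of_hasWeakPDeriv hO hconv hb hκ hε hε' hv.1
      (hv.of_succ.wderiv_spec i).2 hy
  have hd : Differentiable ℝ (kernelAvg O κ ε (wderiv O i v)) :=
    (contDiff_kernelAvg hO.measurableSet hκ hε (hw.1.integrable hb)).differentiable (by simp)
  have e2 : pderiv j (pderiv i (kernelAvg O κ ε v)) x
      = (1 - ε) * pderiv j (kernelAvg O κ ε (wderiv O i v)) x := by
    rw [pderiv, hloc.fderiv_eq, fderiv_const_mul (hd x)]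
    simp [pderiv]
  rw [e2, norm_mul]
  refine mul_le_of_le_one_left (norm_nonneg _) ?_
  rw [Real.norm_of_nonneg (by linarith)]
  linarith

/-- The averages satisfy the smooth bound with constants controlled by the `L²` norms of the weak
derivatives up to order two. A pointwise convergent sequence of them transfers the bound. -/
theorem exists_ae_bound_of_memH_two (hO : IsOpen O) (hconv : Convex ℝ O) (hb : Bornology.IsBounded O)
    {v : Eu 3 → ℝ} (hv : MemH O 2 v) : ∃ C : ℝ, ∀ᵐ x ∂(volume.restrict O), ‖v x‖ ≤ C := by
  rcases O.eq_empty_or_nonempty with rfl | hne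
  · exact ⟨0, by simp⟩
  obtain ⟨κ, hκ, hκ1⟩ := exists_weight hO hne
  have hvol : volume O ≠ 0 := (hO.measure_pos volume hne).ne'
  have hvol' : volume O ≠ ⊤ := hb.measure_lt_top.ne
  have hB := (lintegral_enorm_lt_top hκ).ne
  set B := 2 ^ 3 * ∫⁻ a, ‖κ a‖ₑ
  have hB' : B ≠ ⊤ := by finiteness
  set D := ENNReal.ofReal (Metric.diam O)
  set E : ENNReal := (volume O + (B * eLpNorm v 2 (volume.restrict O)) ^ 2)
      + D * ∑ i, (volume O + (B * eLpNorm (wderiv O i v) 2 (volume.restrict O)) ^ 2)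
      + D ^ 2 * (volume O + (∑ i, ∑ j, B *
        eLpNorm (wderiv O j (wderiv O i v)) 2 (volume.restrict O)) ^ 2) with hE
  have hE' : E ≠ ⊤ := by
    have h0 := hv.1.2.ne
    have h1 : ∀ i, eLpNorm (wderiv O i v) 2 (volume.restrict O) ≠ ⊤ := fun i =>
      (hv.wderiv_spec i).1.2.ne
    have h2 : ∀ i j, eLpNorm (wderiv O j (wderiv O i v)) 2 (volume.restrict O) ≠ ⊤ := fun i j =>
      ((hv.wderiv hO hb i).wderiv_spec j).1.2.ne
    have h3 : ∑ i, (volume O + (B * eLpNorm (wderiv O i v) 2 (volume.restrict O)) ^ 2) ≠ ⊤ :=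
      ENNReal.sum_ne_top.2 fun i _ => by
        have := h1 i
        finiteness
    have h4 : (∑ i, ∑ j, B * eLpNorm (wderiv O j (wderiv O i v)) 2 (volume.restrict O)) ≠ ⊤ :=
      ENNReal.sum_ne_top.2 fun i _ => ENNReal.sum_ne_top.2 fun j _ => by
        have := h2 i j
        finiteness
    have h5 : D ≠ ⊤ := ENNReal.ofReal_ne_top
    rw [hE]
    finiteness
  obtain ⟨ε, hε, hae⟩ := exists_seq_tendsto_ae_kernelAvg (ι := Unit) hO hconv hb hκ hκ1
    (q := fun _ => v) fun _ => hv.1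
  refine ⟨(E / volume O).toReal, ?_⟩
  filter_upwards [hae, ae_restrict_mem hO.measurableSet] with x hx hxO
  have hbound : ∀ᶠ m in atTop, ‖kernelAvg O κ (ε m) v x‖ₑ ≤ E / volume O := by
    filter_upwards [hε.eventually eventually_small] with m hm
    rw [ENNReal.le_div_iff_mul_le (Or.inl hvol) (Or.inl hvol')]
    refine (enorm_mul_volume_le hO hconv hb
      (contDiff_kernelAvg hO.measurableSet hκ hm.1 (hv.1.integrable hb)) hxO).trans ?_
    rw [hE]
    gcongr with i
    · exact eLpNorm_kernelAvg_le hκ.continuous hm.1 hm.2 hv.1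
    · exact eLpNorm_pderiv_kernelAvg_le hO hconv hb hκ hm.1 hm.2 hv.of_succ i
    · exact eLpNorm_hessianSum_kernelAvg_le hO hconv hb hκ hm.1 hm.2 hv
  have hlim : Tendsto (fun m => ‖kernelAvg O κ (ε m) v x‖ₑ) atTop (𝓝 ‖v x‖ₑ) := (hx ()).enorm
  have h := le_of_tendsto hlim hbound
  have hdiv : E / volume O ≠ ⊤ := ENNReal.div_ne_top hE' hvol
  rw [← toReal_enorm]
  exact ENNReal.toReal_mono hdiv h

end Bounded

/-! ### The space `H^k_0` -/

section HZero

variable {n : ℕ} {D : Set (Eu n)}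

theorem normH_congr : ∀ (k : ℕ) {f g : Eu n → ℝ}, f =ᵐ[volume.restrict D] g →
    normH D k f = normH D k g
  | 0, _, _, h => eLpNorm_congr_ae h
  | _ + 1, _, _, h => by simp only [normH, eLpNorm_congr_ae h, wderiv_congr h]

theorem normH_zero (hD : IsOpen D) (hb : Bornology.IsBounded D) :
    ∀ k : ℕ, normH D k (0 : Eu n → ℝ) = 0
  | 0 => eLpNorm_zero
  | k + 1 => by
    have h : ∀ i, normH D k (wderiv D i 0) = 0 := fun i =>
      (normH_congr k (wderiv_zero hD hb i)).trans (normH_zero hD hb k)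
    simp [normH, h]

theorem IsTestFunction.memH0 (hD : IsOpen D) (hb : Bornology.IsBounded D) {φ : Eu n → ℝ}
    (h : IsTestFunction D φ) (k : ℕ) : MemH0 D k φ := by
  refine ⟨memH_of_contDiff hD hb k h.1, fun _ => φ, fun _ => h, ?_⟩
  have h0 : (fun x => φ x - φ x) = 0 := funext fun x => sub_self _
  simp only [h0, normH_zero hD hb]
  exact tendsto_const_nhds

theorem memL2_lap (hD : IsOpen D) (hb : Bornology.IsBounded D) {w : Eu n → ℝ} (hw : MemH D 2 w) :
    MemL2 D (lap D w) :=
  memLp_finsetSum _ fun i _ => ((hw.wderiv hD hb i).wderiv_spec i).1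

theorem lap_zero (hD : IsOpen D) (hb : Bornology.IsBounded D) :
    lap D (0 : Eu n → ℝ) =ᵐ[volume.restrict D] 0 := by
  have h : ∀ᵐ x ∂(volume.restrict D), ∀ i, wderiv D i (wderiv D i 0) x = 0 :=
    ae_all_iff.2 fun i => by
      rw [wderiv_congr (wderiv_zero hD hb i)]
      exact wderiv_zero hD hb i
  filter_upwards [h] with x hx
  simp [lap, hx]

theorem lap_sub (hD : IsOpen D) (hb : Bornology.IsBounded D) {v w : Eu n → ℝ} (hv : MemH D 2 v)
    (hw : MemH D 2 w) :
    lap D (fun x => v x - w x) =ᵐ[volume.restrict D] fun x => lap D v x - lap D w x := by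
  have h : ∀ᵐ x ∂(volume.restrict D), ∀ i, wderiv D i (wderiv D i fun x => v x - w x) x
      = wderiv D i (wderiv D i v) x - wderiv D i (wderiv D i w) x :=
    ae_all_iff.2 fun i => by
      rw [wderiv_congr (hv.wderiv_sub hD hb hw i)]
      exact (hv.wderiv hD hb i).wderiv_sub hD hb (hw.wderiv hD hb i) i
  filter_upwards [h] with x hx
  simp [lap, hx]

theorem eLpNorm_lap_le_normH (hD : IsOpen D) (hb : Bornology.IsBounded D) {v : Eu n → ℝ}
    (hv : MemH D 2 v) : eLpNorm (lap D v) 2 (volume.restrict D) ≤ normH D 2 v := by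
  have e : lap D v = ∑ i, wderiv D i (wderiv D i v) := by ext x; simp [lap]
  rw [e]
  refine (eLpNorm_sum_le (fun i _ => ((hv.wderiv hD hb i).wderiv_spec i).1.1) one_le_two).trans ?_
  simp only [normH]
  refine le_trans (Finset.sum_le_sum fun i _ => ?_) le_add_self
  refine le_trans ?_ le_add_self
  exact Finset.single_le_sum
    (f := fun j => eLpNorm (wderiv D j (wderiv D i v)) 2 (volume.restrict D))
    (fun _ _ => zero_le) (Finset.mem_univ i)

theorem eLpNorm_le_normH : ∀ (k : ℕ) (v : Eu n → ℝ),
    eLpNorm v 2 (volume.restrict D) ≤ normH D k v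
  | 0, _ => le_rfl
  | _ + 1, _ => le_self_add

theorem tendsto_integral_mul_of_tendsto_eLpNorm {k f : Eu n → ℝ} {F : ℕ → Eu n → ℝ}
    (hk : MemL2 D k) (hf : MemL2 D f) (hF : ∀ m, MemL2 D (F m))
    (h : Tendsto (fun m => eLpNorm (fun x => f x - F m x) 2 (volume.restrict D)) atTop (𝓝 0)) :
    Tendsto (fun m => ∫ x in D, k x * F m x) atTop (𝓝 (∫ x in D, k x * f x)) := by
  have h1 := ENNReal.Tendsto.const_mul (a := eLpNorm k 2 (volume.restrict D)) h
    (Or.inr hk.2.ne)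
  rw [mul_zero] at h1
  refine tendsto_integral_of_L1' _ (hk.integrable_mul hf).1
    (Eventually.of_forall fun m => hk.integrable_mul (hF m)) ?_
  refine tendsto_of_tendsto_of_tendsto_of_le_of_le tendsto_const_nhds h1 (fun _ => zero_le)
    fun m => ?_
  refine le_of_eq_of_le ?_ (eLpNorm_one_mul_le hk (MemLp.sub hf (hF m)))
  rw [← eLpNorm_neg]
  congr 1
  ext x
  simp [mul_sub]

/-- A weak equation `Δ²w = c` tested with `C₀^∞(Ω)` may be tested with `H²₀(Ω)`. -/
theorem isClampedBiharmonic_of_isTestFunction {Ω : Set (Eu 2)} (hΩ : IsOpen Ω)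
    (hb : Bornology.IsBounded Ω) {c : ℝ} {w : Eu 2 → ℝ} (hw : MemH0 Ω 2 w)
    (h : ∀ β, IsTestFunction Ω β → ∫ y in Ω, lap Ω w y * lap Ω β y = ∫ y in Ω, c * β y) :
    IsClampedBiharmonic Ω c w := by
  refine ⟨hw, fun v ⟨hv2, φ, hφ, hlim⟩ => ?_⟩
  have hφ2 : ∀ m, MemH Ω 2 (φ m) := fun m => memH_of_contDiff hΩ hb 2 (hφ m).1
  have h1 := tendsto_integral_mul_of_tendsto_eLpNorm (memL2_lap hΩ hb hw.1) (memL2_lap hΩ hb hv2)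
    (fun m => memL2_lap hΩ hb (hφ2 m))
    (tendsto_of_tendsto_of_tendsto_of_le_of_le tendsto_const_nhds hlim (fun _ => zero_le)
      fun m => by
        rw [← eLpNorm_congr_ae (lap_sub hΩ hb hv2 (hφ2 m))]
        exact eLpNorm_lap_le_normH hΩ hb (hv2.sub hΩ hb (hφ2 m)))
  have h2 := tendsto_integral_mul_of_tendsto_eLpNorm
    (memL2_of_continuous hΩ hb (continuous_const (y := c))) hv2.memL2 (fun m => (hφ2 m).memL2)
    (tendsto_of_tendsto_of_tendsto_of_le_of_le tendsto_const_nhds hlim (fun _ => zero_le)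
      fun m => eLpNorm_le_normH 2 _)
  simp only [h _ (hφ _)] at h1
  exact tendsto_nhds_unique h1 h2

end HZero

/-! ### Energy identities in the fluid domain -/

section Fluid

variable {O : Set (Eu 3)} {Ω : Set (Eu 2)} {U : Eu 3 → Eu 3}

theorem HasNormalTrace.integral_divg {v : Eu 3 → Eu 3} {β : Eu 2 → ℝ}
    (h : HasNormalTrace O Ω v β) : ∫ x in O, divg O v x = ∫ y in Ω, β y := by
  have := h (fun _ => 1) contDiff_const
  simpa [pderiv_const] using this

theorem memL2_divg {v : Eu 3 → Eu 3} (hv : MemHVec O 1 v) : MemL2 O (divg O v) :=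
  memLp_finsetSum _ fun i _ => ((hv i).wderiv_spec i).1

theorem integral_dirDeriv_eq_zero (hU : HasNormalTrace O Ω U 0)
    (hdiv : ∀ᵐ x ∂(volume.restrict O), divg O U x = 0) {φ : Eu 3 → ℝ} (hφ : ContDiff ℝ ∞ φ) :
    ∫ x in O, dirDeriv U φ x = 0 := by
  have := hU φ hφ
  simp only [Pi.zero_apply, zero_mul, integral_zero] at this
  rw [← this]
  refine integral_congr_ae ?_
  filter_upwards [hdiv] with x hx
  simp [hx, dirDeriv]

/-- Needed for the constant pressure of a rest state, against an arbitrary `q` in `W_U`. -/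
theorem integral_transport_eq_zero (hO : IsOpen O) (hconv : Convex ℝ O)
    (hb : Bornology.IsBounded O) (hU : MemV0 O Ω U)
    (hdiv : ∀ᵐ x ∂(volume.restrict O), divg O U x = 0) {q g : Eu 3 → ℝ} (hq : MemL2 O q)
    (hg : MemL2 O g) (h : HasTransport O U q g) : ∫ x in O, g x = 0 := by
  rcases O.eq_empty_or_nonempty with rfl | hne
  · simp
  obtain ⟨κ, hκ, hκ1⟩ := exists_weight hO hne
  exact setIntegral_eq_zero_of_tendsto_dirDeriv hO hb hκ (fun i => (hU.1 i).1)
    (fun φ hφ => integral_dirDeriv_eq_zero hU.2 hdiv hφ) hq (hg.integrable hb)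
    (tendsto_dirDeriv_kernelAvg_of_hasTransport hO hconv hb hκ hκ1 hU.1 hdiv hq hg h)

theorem integral_transport_mul_self_eq_zero (hO : IsOpen O) (hconv : Convex ℝ O)
    (hb : Bornology.IsBounded O) (hU : MemV0 O Ω U)
    (hdiv : ∀ᵐ x ∂(volume.restrict O), divg O U x = 0) {q g : Eu 3 → ℝ} (hq : MemL2 O q)
    (hg : MemL2 O g) (h : HasTransport O U q g) : ∫ x in O, g x * q x = 0 := by
  rcases O.eq_empty_or_nonempty with rfl | hne
  · simp
  obtain ⟨κ, hκ, hκ1⟩ := exists_weight hO hne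
  have := setIntegral_mul_eq_zero_of_tendsto_dirDeriv (ι := Unit) hO hconv hb hκ hκ1
    (fun i => (hU.1 i).1) (fun φ hφ => integral_dirDeriv_eq_zero hU.2 hdiv hφ)
    (q := fun _ => q) (g := fun _ => g) (fun _ => hq) (fun _ => hg.integrable hb)
    (fun _ => tendsto_dirDeriv_kernelAvg_of_hasTransport hO hconv hb hκ hκ1 hU.1 hdiv hq hg h)
    (by simpa using hg.integrable_mul hq)
  simpa using this

/-- `U` is bounded because its components are in `H²`, so its product with `∇u ∈ L²` is square
integrable and may be paired with `u`. -/
theorem memL2_convect (hO : IsOpen O) (hconv : Convex ℝ O) (hb : Bornology.IsBounded O)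
    (hU : MemHVec O 2 U) {u : Eu 3 → Eu 3} (hu : MemHVec O 1 u) (j : Fin 3) :
    MemL2 O (convect O U u j) := by
  refine memLp_finsetSum _ fun i _ => ?_
  obtain ⟨C, hC⟩ := exists_ae_bound_of_memH_two hO hconv hb (hU i)
  have hw := ((hu j).wderiv_spec i).1
  refine MemLp.of_le_mul (c := C) hw ((hU i).1.1.mul hw.1) ?_
  filter_upwards [hC] with x hx
  rw [norm_mul]
  gcongr

theorem integral_convect_mul_self_eq_zero (hO : IsOpen O) (hconv : Convex ℝ O)
    (hb : Bornology.IsBounded O) (hU : MemV0 O Ω U) (hU2 : MemHVec O 2 U)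
    (hdiv : ∀ᵐ x ∂(volume.restrict O), divg O U x = 0) {u : Eu 3 → Eu 3} (hu : MemHVec O 1 u) :
    ∫ x in O, ∑ j : Fin 3, convect O U u j x * u x j = 0 := by
  rcases O.eq_empty_or_nonempty with rfl | hne
  · simp
  obtain ⟨κ, hκ, hκ1⟩ := exists_weight hO hne
  have hc := memL2_convect hO hconv hb hU2 hu
  exact setIntegral_mul_eq_zero_of_tendsto_dirDeriv hO hconv hb hκ hκ1
    (fun i => (hU.1 i).1) (fun φ hφ => integral_dirDeriv_eq_zero hU.2 hdiv hφ)
    (q := fun j x => u x j) (fun j => (hu j).1) (fun j => (hc j).integrable hb)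
    (fun j => tendsto_dirDeriv_kernelAvg_of_memH hO hconv hb hκ hκ1 (fun i => (hU.1 i).1) (hu j))
    (integrable_finsetSum _ fun j _ => (hc j).integrable_mul (hu j).1)

theorem stress_mul_strain_nonneg {ν lam : ℝ} (hν : 0 ≤ ν) (hlam : 0 ≤ lam) (u : Eu 3 → Eu 3)
    (x : Eu 3) : 0 ≤ ∑ i : Fin 3, ∑ j : Fin 3, stress O ν lam u i j x * strain O u i j x := by
  have e : ∑ i : Fin 3, ∑ j : Fin 3, stress O ν lam u i j x * strain O u i j x
      = 2 * ν * (∑ i : Fin 3, ∑ j : Fin 3, strain O u i j x ^ 2)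
        + lam * (∑ k : Fin 3, strain O u k k x) ^ 2 := by
    simp only [stress, add_mul, Finset.sum_add_distrib, ite_mul, zero_mul, Finset.sum_ite_eq,
      Finset.mem_univ, if_true]
    congr 1
    · simp only [Finset.mul_sum]
      refine Finset.sum_congr rfl fun i _ => Finset.sum_congr rfl fun j _ => ?_
      ring
    · rw [← Finset.mul_sum]
      ring
  rw [e]
  have : 0 ≤ ∑ i : Fin 3, ∑ j : Fin 3, strain O u i j x ^ 2 :=
    Finset.sum_nonneg fun i _ => Finset.sum_nonneg fun j _ => sq_nonneg _
  positivity

/-- The zero order term `η |u|²` alone forces `u = 0`; from the stress part only its sign is used,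
and no Korn inequality enters. -/
theorem ae_eq_zero_of_aForm_self_eq_zero {ν lam η : ℝ} (hν : 0 < ν) (hlam : 0 ≤ lam) (hη : 0 < η)
    {u : Eu 3 → Eu 3} (hu : MemHVec O 1 u) (h : aForm O ν lam η u u = 0) :
    ∀ᵐ x ∂(volume.restrict O), u x = 0 := by
  have h1 : 0 ≤ ∫ x in O, ∑ i : Fin 3, ∑ j : Fin 3, stress O ν lam u i j x * strain O u i j x :=
    integral_nonneg fun x => stress_mul_strain_nonneg hν.le hlam u x
  have hnn : 0 ≤ fun x => ∑ j : Fin 3, u x j * u x j := fun x =>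
    Finset.sum_nonneg fun j _ => mul_self_nonneg _
  have h2 : 0 ≤ ∫ x in O, ∑ j : Fin 3, u x j * u x j := integral_nonneg hnn
  have h3 : ∫ x in O, ∑ j : Fin 3, u x j * u x j = 0 := by
    rw [aForm] at h
    nlinarith
  rw [integral_eq_zero_iff_of_nonneg hnn
    (integrable_finsetSum _ fun j _ => (hu j).1.integrable_mul (hu j).1)] at h3
  filter_upwards [h3] with x hx
  ext j
  have := (Finset.sum_eq_zero_iff_of_nonneg fun j _ => mul_self_nonneg (u x j)).1 hx j
    (Finset.mem_univ j)
  simpa using this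

theorem wderiv_eq_zero_of_ae_eq_zero (hO : IsOpen O) (hb : Bornology.IsBounded O)
    {u : Eu 3 → Eu 3} (hu : ∀ᵐ x ∂(volume.restrict O), u x = 0) :
    ∀ᵐ x ∂(volume.restrict O), ∀ i j, wderiv O i (fun y => u y j) x = 0 := by
  refine ae_all_iff.2 fun i => ae_all_iff.2 fun j => ?_
  have h : (fun y => u y j) =ᵐ[volume.restrict O] 0 := by
    filter_upwards [hu] with x hx
    simp [hx]
  rw [wderiv_congr h]
  exact wderiv_zero hO hb i

theorem integral_stress_mul_strain_eq_zero {ν lam : ℝ} {u : Eu 3 → Eu 3}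
    (hu : ∀ᵐ x ∂(volume.restrict O), ∀ i j, wderiv O i (fun y => u y j) x = 0)
    (ψ : Eu 3 → Eu 3) :
    ∫ x in O, ∑ i : Fin 3, ∑ j : Fin 3, stress O ν lam u i j x * strain O ψ i j x = 0 := by
  refine integral_eq_zero_of_ae ?_
  filter_upwards [hu] with x hx
  simp [stress, strain, hx]

theorem ae_eq_const_of_integral_mul_pderiv_eq_zero (hO : IsOpen O) (hconv : Convex ℝ O)
    (hb : Bornology.IsBounded O) {p : Eu 3 → ℝ} (hp : MemL2 O p)
    (h : ∀ (j : Fin 3) (φ : Eu 3 → ℝ), IsTestFunction O φ → ∫ x in O, p x * pderiv j φ x = 0) :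
    ∃ c : ℝ, ∀ᵐ x ∂(volume.restrict O), p x = c :=
  ae_eq_const_of_hasWeakPDeriv_zero hO hconv hb hp fun j φ hφ => by simp [h j φ hφ]

end Fluid

/-! ### Equivalence of both notions of solution with rest states. -/

section Stationary

variable {O : Set (Eu 3)} {Ω : Set (Eu 2)} {U : Eu 3 → Eu 3} {ν lam η : ℝ} {p : Eu 3 → ℝ}
  {u : Eu 3 → Eu 3} {w : Eu 2 → ℝ}

/-! ### Test fields with a single component -/

theorem memHVec_single (hO : IsOpen O) (hb : Bornology.IsBounded O) {φ : Eu 3 → ℝ}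
    (hφ : ContDiff ℝ ∞ φ) (j : Fin 3) (k : ℕ) :
    MemHVec O k fun x => EuclideanSpace.single j (φ x) := by
  intro i
  by_cases hij : i = j
  · subst hij
    simpa using memH_of_contDiff hO hb k hφ
  · simpa [hij] using memH_of_contDiff hO hb k contDiff_const

theorem divg_single (hO : IsOpen O) (hb : Bornology.IsBounded O) {φ : Eu 3 → ℝ}
    (hφ : ContDiff ℝ ∞ φ) (j : Fin 3) :
    divg O (fun x => EuclideanSpace.single j (φ x)) =ᵐ[volume.restrict O] pderiv j φ := by
  have h : ∀ᵐ x ∂(volume.restrict O), ∀ i,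
      wderiv O i (fun y => EuclideanSpace.single j (φ y) i) x = if i = j then pderiv j φ x else 0 := by
    refine ae_all_iff.2 fun i => ?_
    by_cases hij : i = j
    · subst hij
      simp only [PiLp.single_apply, if_true]
      exact wderiv_smooth hO hb hφ i
    · simp only [PiLp.single_apply, hij, if_false]
      exact wderiv_zero hO hb i
  filter_upwards [h] with x hx
  simp only [divg, hx]
  simp

theorem IsTestFunction.hasNormalTrace_single (hO : IsOpen O) (hb : Bornology.IsBounded O)
    {φ : Eu 3 → ℝ} (hφ : IsTestFunction O φ) (j : Fin 3) :
    HasNormalTrace O Ω (fun x => EuclideanSpace.single j (φ x)) 0 := by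
  intro χ hχ
  simp only [Pi.zero_apply, zero_mul, integral_zero]
  rw [← (hφ.smooth_mul hχ).setIntegral_pderiv j]
  refine integral_congr_ae ?_
  filter_upwards [divg_single hO hb hφ.1 j] with x hx
  rw [hx, pderiv_mul (hχ.differentiable (by simp) x) (hφ.differentiable x)]
  simp [mul_comm]

/-! ### The energy argument -/

/-- The triples `(c, 0, w_c)`. -/
def IsRestState (O : Set (Eu 3)) (Ω : Set (Eu 2)) (p : Eu 3 → ℝ) (u : Eu 3 → Eu 3)
    (w : Eu 2 → ℝ) : Prop :=
  ∃ c : ℝ, (∀ᵐ x ∂(volume.restrict O), p x = c) ∧ (∀ᵐ x ∂(volume.restrict O), u x = 0) ∧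
    IsClampedBiharmonic Ω c w

theorem integral_mul_divg_of_ae_eq_const {c : ℝ} (hp : ∀ᵐ x ∂(volume.restrict O), p x = c)
    {ψ : Eu 3 → Eu 3} {β : Eu 2 → ℝ} (hψ : HasNormalTrace O Ω ψ β) :
    ∫ x in O, p x * divg O ψ x = ∫ y in Ω, c * β y := by
  rw [integral_const_mul, ← hψ.integral_divg, ← integral_const_mul]
  refine integral_congr_ae ?_
  filter_upwards [hp] with x hx
  rw [hx]

theorem aForm_eq_zero_of_ae_eq_zero (hO : IsOpen O) (hb : Bornology.IsBounded O)
    (hu : ∀ᵐ x ∂(volume.restrict O), u x = 0) (ψ : Eu 3 → Eu 3) : aForm O ν lam η u ψ = 0 := by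
  have h : ∫ x in O, ∑ j : Fin 3, u x j * ψ x j = 0 := by
    refine integral_eq_zero_of_ae ?_
    filter_upwards [hu] with x hx
    simp [hx]
  rw [aForm, integral_stress_mul_strain_eq_zero (wderiv_eq_zero_of_ae_eq_zero hO hb hu), h]
  simp

theorem convect_eq_zero_of_ae_eq_zero (hO : IsOpen O) (hb : Bornology.IsBounded O)
    (hu : ∀ᵐ x ∂(volume.restrict O), u x = 0) :
    ∀ᵐ x ∂(volume.restrict O), ∀ j, convect O U u j x = 0 := by
  filter_upwards [wderiv_eq_zero_of_ae_eq_zero hO hb hu] with x hx j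
  simp [convect, hx]

theorem divg_eq_zero_of_ae_eq_zero (hO : IsOpen O) (hb : Bornology.IsBounded O)
    (hu : ∀ᵐ x ∂(volume.restrict O), u x = 0) : ∀ᵐ x ∂(volume.restrict O), divg O u x = 0 := by
  filter_upwards [wderiv_eq_zero_of_ae_eq_zero hO hb hu] with x hx
  simp [divg, hx]

theorem integral_convect_mul_eq_zero (hO : IsOpen O) (hb : Bornology.IsBounded O)
    (hu : ∀ᵐ x ∂(volume.restrict O), u x = 0) (ψ : Eu 3 → Eu 3) :
    ∫ x in O, ∑ j : Fin 3, convect O U u j x * ψ x j = 0 := by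
  refine integral_eq_zero_of_ae ?_
  filter_upwards [convect_eq_zero_of_ae_eq_zero (U := U) hO hb hu] with x hx
  simp [hx]

/-- A test function is itself a member of `W_U`, so the weak equation contains the distributional
one. This puts `p` in `W_U` and makes the energy identity available for it. -/
theorem IsWeakSolution.hasTransport (hO : IsOpen O) (hb : Bornology.IsBounded O)
    (hU : MemV0 O Ω U) (hdiv : ∀ᵐ x ∂(volume.restrict O), divg O U x = 0)
    (h : IsWeakSolution O Ω ν lam η U p u w) : HasTransport O U p fun x => -divg O u x := by
  intro φ hφ
  have := h.transport_eq φ (dirDeriv U φ) (memL2_of_continuous hO hb hφ.continuous)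
    (memL2_dirDeriv_of_contDiff hO hb (fun i => (hU.1 i).1) hφ.1)
    (hasTransport_of_contDiff hO hb hU.1 hφ.1)
  have e : ∫ x in O, divg O U x * (p x * φ x) = 0 := by
    refine integral_eq_zero_of_ae ?_
    filter_upwards [hdiv] with x hx
    simp [hx]
  rw [e, zero_add] at this
  have e' : ∫ x in O, -divg O u x * φ x = -∫ x in O, divg O u x * φ x := by
    rw [← integral_neg]
    simp only [neg_mul]
  rw [e', this]
  congr 1
  refine integral_congr_ae ?_
  filter_upwards [hdiv] with x hx
  simp [hx, dirDeriv, mul_comm]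

theorem IsWeakSolution.isRestState (hgeom : IsFluidPlateDomain O Ω) (hν : 0 < ν) (hlam : 0 ≤ lam)
    (hη : 0 < η) (hU : MemV0 O Ω U) (hU2 : MemHVec O 2 U)
    (hdiv : ∀ᵐ x ∂(volume.restrict O), divg O U x = 0)
    (h : IsWeakSolution O Ω ν lam η U p u w) : IsRestState O Ω p u w := by
  have hO := hgeom.isOpen_fluid
  have hb := hgeom.bounded_fluid
  have hconv := hgeom.convex_fluid
  have hΩ := hgeom.isOpen_plate
  have hbΩ := hgeom.bounded_plate
  have hlap : ∫ y in Ω, lap Ω w y * lap Ω 0 y = 0 := by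
    refine integral_eq_zero_of_ae ?_
    filter_upwards [lap_zero hΩ hbΩ] with y hy
    simp [hy]
  have hpu : ∫ x in O, p x * divg O u x = 0 := by
    have := integral_transport_mul_self_eq_zero hO hconv hb hU hdiv h.memL2_p
      (MemLp.neg (memL2_divg h.memV0_u.1)) (h.hasTransport hO hb hU hdiv)
    simpa [integral_neg, mul_comm] using this
  have hu : ∀ᵐ x ∂(volume.restrict O), u x = 0 := by
    refine ae_eq_zero_of_aForm_self_eq_zero hν hlam hη h.memV0_u.1 ?_
    -- `u` belongs to `V_Ω` with `β = 0`, because its normal trace vanishes.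
    have := h.momentum_eq u 0 ⟨h.memV0_u.1, IsTestFunction.zero.memH0 hΩ hbΩ 2, h.memV0_u.2⟩
    rwa [hpu, hlap, integral_convect_mul_self_eq_zero hO hconv hb hU hU2 hdiv h.memV0_u.1,
      neg_zero, sub_zero, sub_zero] at this
  have hmom : ∀ {ψ β}, MemVPlate O Ω ψ β →
      ∫ x in O, p x * divg O ψ x = ∫ y in Ω, lap Ω w y * lap Ω β y := by
    intro ψ β hψ
    have := h.momentum_eq ψ β hψ
    rw [aForm_eq_zero_of_ae_eq_zero hO hb hu, integral_convect_mul_eq_zero hO hb hu] at this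
    linarith
  -- Test fields `φ e_j` with compact support in `O` have `β = 0` and divergence `∂_j φ`.
  obtain ⟨c, hc⟩ := ae_eq_const_of_integral_mul_pderiv_eq_zero hO hconv hb h.memL2_p
    fun j φ hφ => by
      rw [← hlap, ← hmom ⟨memHVec_single hO hb hφ.1 j 1, IsTestFunction.zero.memH0 hΩ hbΩ 2,
        hφ.hasNormalTrace_single hO hb j⟩]
      refine integral_congr_ae ?_
      filter_upwards [divg_single hO hb hφ.1 j] with x hx
      rw [hx]
  refine ⟨c, hc, hu, isClampedBiharmonic_of_isTestFunction hΩ hbΩ h.memH0_w fun β hβ => ?_⟩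
  obtain ⟨ψ, hψ, hψβ⟩ := hgeom.exists_hasVerticalTrace hβ
  have hn := hψβ.hasNormalTrace hO hb hψ
  rw [← hmom ⟨hψ, hβ.memH0 hΩ hbΩ 2, hn⟩, integral_mul_divg_of_ae_eq_const hc hn]

/-- Since `u` is tangential, the vanishing tangential traction plays the role of the weak momentum
equation tested with `u`. -/
theorem IsStrongSolution.isRestState (hgeom : IsFluidPlateDomain O Ω) (hν : 0 < ν)
    (hlam : 0 ≤ lam) (hη : 0 < η) (hU : MemV0 O Ω U) (hU2 : MemHVec O 2 U)
    (hdiv : ∀ᵐ x ∂(volume.restrict O), divg O U x = 0)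
    (h : IsStrongSolution O Ω ν lam η U p u w) : IsRestState O Ω p u w := by
  have hO := hgeom.isOpen_fluid
  have hb := hgeom.bounded_fluid
  have hconv := hgeom.convex_fluid
  obtain ⟨hp, hu1, hw, ⟨g, hg, hgp, hgu⟩, F, hF, hσ, hFu, htan, hvert⟩ := h
  have hpu : ∫ x in O, p x * divg O u x = 0 := by
    have := integral_transport_mul_self_eq_zero hO hconv hb hU hdiv hp hg hgp
    rw [← neg_eq_zero, ← integral_neg, ← this]
    refine integral_congr_ae ?_
    filter_upwards [hgu] with x hx
    linear_combination -(p x) * hx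
  have hu : ∀ᵐ x ∂(volume.restrict O), u x = 0 := by
    refine ae_eq_zero_of_aForm_self_eq_zero hν hlam hη hu1.1 ?_
    have hc := memL2_convect hO hconv hb hU2 hu1.1
    have e : ∫ x in O, ∑ j : Fin 3, F x j * u x j
        = η * ∫ x in O, ∑ j : Fin 3, u x j * u x j := by
      rw [← zero_add (η * _), ← integral_convect_mul_self_eq_zero hO hconv hb hU hU2 hdiv hu1.1,
        ← integral_const_mul, ← integral_add
        (integrable_finsetSum _ fun j _ => (hc j).integrable_mul (hu1.1 j).1)
        ((integrable_finsetSum _ fun j _ =>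
          (hu1.1 j).1.integrable_mul (hu1.1 j).1).const_mul η)]
      refine integral_congr_ae ?_
      filter_upwards [hFu] with x hx
      rw [Finset.mul_sum, ← Finset.sum_add_distrib]
      refine Finset.sum_congr rfl fun j _ => ?_
      linear_combination -(u x j) * hx j
    have := htan u hu1
    rwa [traction, hpu, e, sub_zero] at this
  -- With `u = 0` the momentum equation leaves `F = 0`, so `div σ(u) - ∇p` vanishes and then `∇p =
  -- 0`.
  have hF0 : ∀ᵐ x ∂(volume.restrict O), ∀ j, F x j = 0 := by
    filter_upwards [hFu, hu, convect_eq_zero_of_ae_eq_zero (U := U) hO hb hu] with x h1 h2 h3 j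
    have := h1 j
    rw [h2, h3] at this
    simpa using this
  have hS := wderiv_eq_zero_of_ae_eq_zero hO hb hu
  have hFψ : ∀ ψ : Eu 3 → Eu 3, ∫ x in O, ∑ j : Fin 3, F x j * ψ x j = 0 := by
    intro ψ
    refine integral_eq_zero_of_ae ?_
    filter_upwards [hF0] with x hx
    simp [hx]
  obtain ⟨c, hc⟩ := ae_eq_const_of_integral_mul_pderiv_eq_zero hO hconv hb hp fun j φ hφ => by
    have h1 : ∫ x in O, F x j * φ x = 0 := by
      refine integral_eq_zero_of_ae ?_
      filter_upwards [hF0] with x hx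
      simp [hx]
    rw [← h1, hσ j φ hφ, ← integral_neg]
    refine integral_congr_ae ?_
    filter_upwards [hS] with x hx
    simp [stress, strain, hx]
  refine ⟨c, hc, hu, isClampedBiharmonic_of_isTestFunction hgeom.isOpen_plate hgeom.bounded_plate
    hw fun β hβ => ?_⟩
  obtain ⟨ψ, hψ, hψβ⟩ := hgeom.exists_hasVerticalTrace hβ
  have := hvert β ψ hβ hψ hψβ
  rw [traction, hFψ, integral_stress_mul_strain_eq_zero hS,
    integral_mul_divg_of_ae_eq_const hc (hψβ.hasNormalTrace hO hb hψ)] at this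
  linarith

theorem IsRestState.isWeakSolution (hgeom : IsFluidPlateDomain O Ω) (hU : MemV0 O Ω U)
    (hdiv : ∀ᵐ x ∂(volume.restrict O), divg O U x = 0) (hp : MemL2 O p) (hu1 : MemV0 O Ω u)
    (h : IsRestState O Ω p u w) : IsWeakSolution O Ω ν lam η U p u w := by
  have hO := hgeom.isOpen_fluid
  have hb := hgeom.bounded_fluid
  obtain ⟨c, hc, hu, hw, hwc⟩ := h
  refine ⟨hp, hu1, hw, fun q g hq hg hqg => ?_, fun ψ β ⟨_, hβ, hn⟩ => ?_⟩
  · have h1 : ∫ x in O, divg O u x * q x = 0 := by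
      refine integral_eq_zero_of_ae ?_
      filter_upwards [divg_eq_zero_of_ae_eq_zero hO hb hu] with x hx
      simp [hx]
    have h2 : ∫ x in O, divg O U x * (p x * q x) = 0 := by
      refine integral_eq_zero_of_ae ?_
      filter_upwards [hdiv] with x hx
      simp [hx]
    -- As `p = c`, this is `c ∫ U·∇q`, zero by the flux identity.
    have h3 : ∫ x in O, g x * p x = 0 := by
      rw [← zero_mul c, ← integral_transport_eq_zero hO hgeom.convex_fluid hb hU hdiv hq hg hqg,
        ← integral_mul_const]
      refine integral_congr_ae ?_
      filter_upwards [hc] with x hx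
      rw [hx]
    rw [h1, h2, h3, zero_add]
  · rw [aForm_eq_zero_of_ae_eq_zero hO hb hu, integral_convect_mul_eq_zero hO hb hu, hwc β hβ,
      integral_mul_divg_of_ae_eq_const hc hn, neg_zero]

theorem IsRestState.isStrongSolution (hgeom : IsFluidPlateDomain O Ω) (hU : MemV0 O Ω U)
    (hdiv : ∀ᵐ x ∂(volume.restrict O), divg O U x = 0) (hp : MemL2 O p) (hu1 : MemV0 O Ω u)
    (h : IsRestState O Ω p u w) : IsStrongSolution O Ω ν lam η U p u w := by
  have hO := hgeom.isOpen_fluid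
  have hb := hgeom.bounded_fluid
  obtain ⟨c, hc, hu, hw, hwc⟩ := h
  have hS := wderiv_eq_zero_of_ae_eq_zero hO hb hu
  have htr : ∀ {ψ β}, HasNormalTrace O Ω ψ β →
      traction O ν lam p u 0 ψ = -∫ y in Ω, c * β y := by
    intro ψ β hn
    rw [traction, integral_stress_mul_strain_eq_zero hS, integral_mul_divg_of_ae_eq_const hc hn]
    simp
  -- Both witnesses are zero: `U·∇c = 0` because `U` is solenoidal, and `div σ(0) - ∇c = 0`.
  refine ⟨hp, hu1, hw, ⟨0, MemLp.zero, fun φ hφ => ?_, ?_⟩, 0, fun _ => ?_, fun j φ hφ => ?_, ?_,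
    fun τ hτ => ?_, fun β ψ hβ hψ hψβ => ?_⟩
  · simp only [Pi.zero_apply, zero_mul, integral_zero]
    rw [eq_comm, neg_eq_zero, ← mul_zero c, ← integral_dirDeriv_eq_zero hU.2 hdiv hφ.1,
      ← integral_const_mul]
    refine integral_congr_ae ?_
    filter_upwards [hc, hdiv] with x h1 h2
    simp [h1, h2, dirDeriv]
  · filter_upwards [divg_eq_zero_of_ae_eq_zero hO hb hu] with x hx
    simp [hx]
  · simp [MemL2]
  · simp only [Pi.zero_apply, PiLp.zero_apply, zero_mul, integral_zero]
    rw [eq_comm, neg_eq_zero, ← mul_zero (-c), ← hφ.setIntegral_pderiv j, ← integral_const_mul]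
    refine integral_congr_ae ?_
    filter_upwards [hc, hS] with x h1 h2
    simp [stress, strain, h1, h2]
  · filter_upwards [hu, convect_eq_zero_of_ae_eq_zero (U := U) hO hb hu] with x h1 h2 j
    simp [h1, h2]
  · simpa using htr hτ.2
  · rw [htr (hψβ.hasNormalTrace hO hb hψ), hwc β (hβ.memH0 hgeom.isOpen_plate
      hgeom.bounded_plate 2), add_neg_cancel]

end Stationary

end FluidPlate

theorem lemma6p2 (O : Set (Eu 3)) (Ω : Set (Eu 2)) (hgeom : FluidPlate.IsFluidPlateDomain O Ω)
    (ν lam η : ℝ) (hν : 0 < ν) (hlam : 0 ≤ lam) (hη : 0 < η)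
    (U : Eu 3 → Eu 3) (hU : FluidPlate.IsAmbientField O Ω U)
    (hdiv : ∀ᵐ x ∂(volume.restrict O), FluidPlate.divg O U x = 0)
    (p : Eu 3 → ℝ) (u : Eu 3 → Eu 3) (w : Eu 2 → ℝ) :
    (FluidPlate.IsWeakSolution O Ω ν lam η U p u w ↔
      FluidPlate.IsStrongSolution O Ω ν lam η U p u w) ∧
    (FluidPlate.IsWeakSolution O Ω ν lam η U p u w →
      ∃ c : ℝ, (∀ᵐ x ∂(volume.restrict O), p x = c) ∧
        (∀ᵐ x ∂(volume.restrict O), u x = 0) ∧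
        FluidPlate.IsClampedBiharmonic Ω c w) := by
  have hU2 : FluidPlate.MemHVec O 2 U := fun i => (hU.2 i).of_succ
  have hweak := fun h : FluidPlate.IsWeakSolution O Ω ν lam η U p u w =>
    h.isRestState hgeom hν hlam hη hU.1 hU2 hdiv
  exact ⟨⟨fun h => (hweak h).isStrongSolution hgeom hU.1 hdiv h.memL2_p h.memV0_u,
    fun h => (h.isRestState hgeom hν hlam hη hU.1 hU2 hdiv).isWeakSolution hgeom hU.1 hdiv h.1
      h.2.1⟩, hweak⟩
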